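/- Let $K$ be a field, let $C=(c_{ij})_{i,j\in Q_0}$ be a symmetrizable generalized Cartan matrix with finite index set $Q_0$ and let $D=\mathrm{diag}(c_i)$, $c_i\in\mathbb Z_{\ge 1}$, be a symmetrizer of $C$, so that $c_ic_{ij}=c_jc_{ji}$. **Preprojective algebras.** For $c_{ij}<0$ put $g_{ij}=\gcd(c_{ij},c_{ji})$ and $f_{ij}=|c_{ij}|/g_{ij}$. Let $\Omega$ be an orientation of $C$: for $i\ne j$, $(i,j)$ or $(j,i)$ lies in $\Omega$ if and only if $c_{ij}<0$, and $\Omega$ has no oriented cycle. Put $\overline\Omega=\Omega\cup\Omega^*$, where $\Omega^*=\{(j,i)\mid (i,j)\in\Omega\}$, and let $\mathrm{sgn}(i,j)$ be $1$ on $\Omega$ and $-1$ on $\Omega^*$. The generalized preprojective algebra $\Pi(C,D)$ is the path $K$-algebra of the quiver with vertex set $Q_0$, loops $\varepsilon_i$ at $i\in Q_0$ and arrows $\alpha_{ij}^{(g)}\colon j\to i$ ($(i,j)\in\overline\Omega$, $1\le g\le g_{ij}$), modulo the relations $\varepsilon_i^{c_i}=0$, $\varepsilon_i^{f_{ji}}\alpha_{ij}^{(g)}=\alpha_{ij}^{(g)}\varepsilon_j^{f_{ij}}$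 and, for each $i$, $$\sum_{j:(i,j)\in\overline\Omega}\ \sum_{g=1}^{g_{ij}}\ \sum_{f=0}^{f_{ji}-1}\mathrm{sgn}(i,j)\,\varepsilon_i^{f}\alpha_{ij}^{(g)}\alpha_{ji}^{(g)}\varepsilon_i^{f_{ji}-1-f}=0.$$ Write $e_i$ for the idempotent and $S_i$ for the one-dimensional simple module at the vertex $i$, and put $H_i=K[\varepsilon_i]/(\varepsilon_i^{c_i})$. A (left) module $M$ is locally free of finite rank if every $e_iM$ is a free $H_i$-module of finite rank. The generalized simple module $E_i$ is the locally free module with $e_iE_i\cong H_i$ and $e_jE_i=0$ for $j\neq i$. A module is $\mathbb E$-filtered if it is locally free of finite rank and has a finite filtration by submodules with successive quotients isomorphic to modules $E_j$. Let $\mathrm{sub}_iM$ (resp. $\mathrm{fac}_iM$) be the largest submodule (resp. factor module) of $M$ all of whose composition factors are isomorphic to $S_i$. **Framing.** Let $\widetilde\Pi=\Pi(\widetilde C,\widetilde D)$, for any orientation of $\widetilde C$, where $$\widetilde C=\begin{pmatrix} C&-I\\-I&2I\end{pmatrix},\qquad \widetilde D=\begin{pmatrix} D&0\\0&D\end{pmatrix};$$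 its vertices are $i$ and $i'$ for $i\in Q_0$. A $\widetilde\Pi$-module $M$ is stable if it is $\mathbb E$-filtered and $\mathrm{sub}_iM=0$ for every $i\in Q_0$. **Weights.** Let $R=\bigoplus_i\mathbb Z\alpha_i$ and $P=\bigoplus_i\mathbb Z\varpi_i$ be the free abelian groups on the simple roots and on the fundamental weights, and define $\langle-,\alpha_i\rangle$ on $R\oplus P$ by $\langle\alpha_j,\alpha_i\rangle=c_{ij}$ and $\langle\varpi_j,\alpha_i\rangle=\delta_{ij}$. The Weyl group $W$ is the group of automorphisms of $R\oplus P$ generated by the reflections $s_i(x)=x-\langle x,\alpha_i\rangle\alpha_i$. For $\lambda\in P$ and $w\in W$ one has $w\lambda-\lambda\in R$. A weight $\lambda\in P$ is anti-dominant if $\langle\lambda,\alpha_i\rangle\le0$ for all $i$. A $\widetilde\Pi$-module that is locally free of finite rank has rank vector $(\nu,\lambda)$ with $\nu=\sum_i\nu_i\alpha_i\in R$ and $\lambda=-\sum_i\lambda_{i'}\varpi_i\in P$, where $\nu_i$ is the rank of $e_iM$ and $\lambda_{i'}$ is the rank of $e_{i'}M$. A stable module $M$ of rank vector $(\nu,\lambda)$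 has a small $i$-factor, for $i\in Q_0$, if $\mathrm{fac}_iM$ is a free $H_i$-module of rank $\max\{0,\langle\nu+\lambda,\alpha_i\rangle\}$. **Theorem.** Let $\lambda\in P$ be an anti-dominant weight and let $w\in W$. Every stable $\widetilde\Pi$-module with rank vector $(w\lambda-\lambda,\lambda)$ has a small $i$-factor for every $i\in Q_0$. Moreover, there exists a stable $\widetilde\Pi$-module $\widetilde N(w\lambda)$ with rank vector $(w\lambda-\lambda,\lambda)$, and it is unique up to isomorphism. -/

import Mathlib

universe u v w

noncomputable section

namespace FramedPreprojective

/-! ## Cartan matrices, symmetrizers, orientations -/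

/-- Generalized Cartan matrices. -/
structure IsGCM {I : Type w} (C : Matrix I I ℤ) : Prop where
  diag : ∀ i, C i i = 2
  nonpos : ∀ i j, i ≠ j → C i j ≤ 0
  zero_iff : ∀ i j, C i j = 0 ↔ C j i = 0

/-- `D = diag(c_i)`, with positive integers `c_i`, is a symmetrizer of `C`. -/
structure IsSymmetrizer {I : Type w} (C : Matrix I I ℤ) (D : I → ℕ) : Prop where
  pos : ∀ i, 1 ≤ D i
  symm : ∀ i j, (D i : ℤ) * C i j = (D j : ℤ) * C j i

/-- `Ω` is an orientation of `C`: it orients exactly the edges of the valued graph of `C`,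
and it has no oriented cycles (in particular it contains at most one of `(i, j)`, `(j, i)`). -/
structure IsOrientation {I : Type w} (C : Matrix I I ℤ) (Ω : I → I → Prop) : Prop where
  edge_iff : ∀ i j, i ≠ j → ((Ω i j ∨ Ω j i) ↔ C i j < 0)
  acyclic : ∀ i, ¬ Relation.TransGen Ω i i

/-- `g_{ij} = gcd(c_{ij}, c_{ji})`. -/
def gNum {I : Type w} (C : Matrix I I ℤ) (i j : I) : ℕ := Int.gcd (C i j) (C j i)

/-- `f_{ij} = |c_{ij}| / g_{ij}`. -/
def fNum {I : Type w} (C : Matrix I I ℤ) (i j : I) : ℕ := (C i j).natAbs / gNum C i j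

theorem gNum_comm {I : Type w} (C : Matrix I I ℤ) (i j : I) : gNum C i j = gNum C j i :=
  Int.gcd_comm _ _

/-! ## Generalized preprojective algebras -/

/-- Generators of the path algebra of the double quiver: the trivial paths `e_i`, the loops `ε_i`,
and the arrows `α_{ij}^{(g)} : j → i` for `(i, j)` in `Ω ∪ Ω*` and `1 ≤ g ≤ g_{ij}`. -/
inductive Gen {I : Type w} (C : Matrix I I ℤ) (Ω : I → I → Prop) : Type w
  | e (i : I) : Gen C Ω
  | eps (i : I) : Gen C Ω
  | arr (i j : I) (h : Ω i j ∨ Ω j i) (g : Fin (gNum C i j)) : Gen C Ω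

section Algebra

variable (K : Type u) [Field K] {I : Type w} [Fintype I] [DecidableEq I]
  (C : Matrix I I ℤ) (D : I → ℕ) (Ω : I → I → Prop)

/-- The generators, as elements of the free algebra on them. -/
abbrev fe (i : I) : FreeAlgebra K (Gen C Ω) := FreeAlgebra.ι K (Gen.e i)
abbrev feps (i : I) : FreeAlgebra K (Gen C Ω) := FreeAlgebra.ι K (Gen.eps i)
abbrev farr (i j : I) (h : Ω i j ∨ Ω j i) (g : Fin (gNum C i j)) : FreeAlgebra K (Gen C Ω) :=
  FreeAlgebra.ι K (Gen.arr i j h g)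

open Classical in
/-- `sgn(i, j)` is `1` on `Ω` and `-1` on `Ω*`. -/
def sgn (i j : I) : K := if Ω i j then 1 else -1

open Classical in
/-- The left-hand side of the preprojective relation at the vertex `i`. -/
def mesh (i : I) : FreeAlgebra K (Gen C Ω) :=
  ∑ j : I, if h : Ω i j ∨ Ω j i then
    ∑ g : Fin (gNum C i j), ∑ f ∈ Finset.range (fNum C j i),
      sgn K Ω i j • (feps K C Ω i ^ f * farr K C Ω i j h g *
        farr K C Ω j i h.symm (Fin.cast (gNum_comm C i j) g) *
        feps K C Ω i ^ (fNum C j i - 1 - f))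
  else 0

/-- The relations of the generalized preprojective algebra. The constructors up to `arr_e` say that
we are in the path algebra of the double quiver; `P1`, `P2`, `P3` are the defining relations. -/
inductive Rel : FreeAlgebra K (Gen C Ω) → FreeAlgebra K (Gen C Ω) → Prop
  | e_mul_self (i : I) : Rel (fe K C Ω i * fe K C Ω i) (fe K C Ω i)
  | e_mul_ne (i j : I) (h : i ≠ j) : Rel (fe K C Ω i * fe K C Ω j) 0
  | e_sum : Rel (∑ i, fe K C Ω i) 1
  | e_eps (i : I) : Rel (fe K C Ω i * feps K C Ω i) (feps K C Ω i)
  | eps_e (i : I) : Rel (feps K C Ω i * fe K C Ω i) (feps K C Ω i)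
  | e_arr (i j : I) (h : Ω i j ∨ Ω j i) (g : Fin (gNum C i j)) :
      Rel (fe K C Ω i * farr K C Ω i j h g) (farr K C Ω i j h g)
  | arr_e (i j : I) (h : Ω i j ∨ Ω j i) (g : Fin (gNum C i j)) :
      Rel (farr K C Ω i j h g * fe K C Ω j) (farr K C Ω i j h g)
  | P1 (i : I) : Rel (feps K C Ω i ^ D i) 0
  | P2 (i j : I) (h : Ω i j ∨ Ω j i) (g : Fin (gNum C i j)) :
      Rel (feps K C Ω i ^ fNum C j i * farr K C Ω i j h g)
        (farr K C Ω i j h g * feps K C Ω j ^ fNum C i j)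
  | P3 (i : I) : Rel (mesh K C Ω i) 0

/-- The generalized preprojective algebra `Π(C, D)` over `K`, built with the orientation `Ω`. -/
def Preproj : Type max u w := RingQuot (Rel K C D Ω)

instance : Ring (Preproj K C D Ω) := inferInstanceAs (Ring (RingQuot (Rel K C D Ω)))

instance : Algebra K (Preproj K C D Ω) := inferInstanceAs (Algebra K (RingQuot (Rel K C D Ω)))

variable {K C D Ω}

/-- The quotient map from the free algebra onto `Π(C, D)`. -/
def toPreproj : FreeAlgebra K (Gen C Ω) →ₐ[K] Preproj K C D Ω :=
  RingQuot.mkAlgHom K (Rel K C D Ω)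

theorem toPreproj_rel {x y : FreeAlgebra K (Gen C Ω)} (h : Rel K C D Ω x y) :
    (toPreproj x : Preproj K C D Ω) = toPreproj y :=
  RingQuot.mkAlgHom_rel K h

/-- The image of a generator in `Π(C, D)`. -/
def gen (x : Gen C Ω) : Preproj K C D Ω := toPreproj (FreeAlgebra.ι K x)

/-! ## Modules over generalized preprojective algebras -/

section Modules

variable (M : Type v) [AddCommGroup M] [Module (Preproj K C D Ω) M]

/-- The subspace `e_i M` of `M`. -/
def vertexSpace (i : I) : AddSubgroup M where
  carrier := {m | (gen (.e i) : Preproj K C D Ω) • m = m}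
  add_mem' {a b} ha hb := by
    simp only [Set.mem_ofPred_eq] at *
    rw [smul_add, ha, hb]
  zero_mem' := by simp
  neg_mem' {a} ha := by
    simp only [Set.mem_ofPred_eq] at *
    rw [smul_neg, ha]

/-- The truncated polynomial ring `H_i = K[x]/(x^{c_i})`. -/
abbrev Hring (K : Type u) [Field K] {I : Type w} (D : I → ℕ) (i : I) : Type u :=
  Polynomial K ⧸ Ideal.span {(Polynomial.X : Polynomial K) ^ D i}

/-- `e_i M`, on which `x` acts as `ε_i`, is a free `H_i`-module of rank `a`:
there is an isomorphism of `H_i`-modules from `H_i ^ a` to `e_i M`. -/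
def HasRankAt (i : I) (a : ℕ) : Prop :=
  ∃ φ : (Fin a → Hring K D i) ≃+ vertexSpace (K := K) (C := C) (D := D) (Ω := Ω) M i,
    ∀ (p : Polynomial K) (x : Fin a → Hring K D i),
      (φ (Ideal.Quotient.mk (Ideal.span {(Polynomial.X : Polynomial K) ^ D i}) p • x) : M) =
        (Polynomial.aeval (gen (.eps i) : Preproj K C D Ω) p) • (φ x : M)

variable (K C D Ω)

/-- Locally free modules of finite rank. -/
def IsLocallyFree : Prop :=
  ∀ i : I, ∃ a : ℕ, HasRankAt (K := K) (C := C) (D := D) (Ω := Ω) M i a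

/-- `M` is isomorphic to the generalized simple module `E_j`: `e_j M` is isomorphic to `H_j`, and
`e_i M = 0` for `i ≠ j`. -/
def IsGenSimple (j : I) : Prop :=
  ∀ i : I, HasRankAt (K := K) (C := C) (D := D) (Ω := Ω) M i (if i = j then 1 else 0)

/-- `M` is isomorphic to the simple module `S_j`: it is a one-dimensional `K`-space,
concentrated at the vertex `j`, on which all `ε_i` and all arrows act as zero. -/
def IsVertexSimple (j : I) : Prop :=
  ∃ x : M, x ≠ 0 ∧ (∀ y : M, ∃ c : K, y = algebraMap K (Preproj K C D Ω) c • x) ∧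
    (gen (.e j) : Preproj K C D Ω) • x = x ∧
    (∀ i, (gen (.eps i) : Preproj K C D Ω) • x = 0) ∧
    (∀ i k h g, (gen (.arr i k h g) : Preproj K C D Ω) • x = 0)

/-- Every composition factor (simple subquotient `B/A`) of `M` is isomorphic to `S_i`. -/
def AllFactorsSimpleAt (i : I) : Prop :=
  ∀ A B : Submodule (Preproj K C D Ω) M, A ⋖ B →
    IsVertexSimple K C D Ω (B ⧸ A.submoduleOf B) i

/-- `sub_i M`: the largest submodule of `M` all of whose composition factors are `S_i`. -/
def subAt (i : I) : Submodule (Preproj K C D Ω) M :=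
  sSup {N | AllFactorsSimpleAt K C D Ω N i}

/-- `fac_i M`: the largest factor module of `M` all of whose composition factors are `S_i`. -/
abbrev facAt (i : I) : Type v :=
  M ⧸ (sInf {N | AllFactorsSimpleAt K C D Ω (M ⧸ N) i} : Submodule (Preproj K C D Ω) M)

/-- `M` is `𝔼`-filtered: it is locally free of finite rank and has a finite filtration by
submodules whose successive quotients are generalized simple modules. -/
def IsEFiltered : Prop :=
  IsLocallyFree K C D Ω M ∧
  ∃ (n : ℕ) (F : Fin (n + 1) → Submodule (Preproj K C D Ω) M),
    F 0 = ⊥ ∧ F (Fin.last n) = ⊤ ∧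
    ∀ k : Fin n, F k.castSucc < F k.succ ∧
      ∃ j : I, IsGenSimple K C D Ω (F k.succ ⧸ (F k.castSucc).submoduleOf (F k.succ)) j

end Modules

end Algebra

/-! ## Weights and the Weyl group -/

section Weights

variable {ι : Type w} [Fintype ι] [DecidableEq ι]

/-- The lattice `R ⊕ P` with basis the simple roots `α_i` and the fundamental weights `ϖ_i`.
The pair `(r, p)` stands for `∑ r_i α_i + ∑ p_i ϖ_i`. Keeping the roots as independent vectors makes
`wλ - λ` a well-defined element of the root lattice `R` even if `C` is degenerate. -/
abbrev WeightLattice (ι : Type w) : Type w := (ι → ℤ) × (ι → ℤ)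

/-- The simple root `α_i`. -/
def simpleRoot (i : ι) : WeightLattice ι := (Pi.single i 1, 0)

/-- The pairing `⟨-, α_i⟩` with the simple coroot:
`⟨α_j, α_i⟩ = c_{ij}` and `⟨ϖ_j, α_i⟩ = δ_{ij}`. -/
def coroot (C : Matrix ι ι ℤ) (i : ι) : Module.Dual ℤ (WeightLattice ι) :=
  (LinearMap.proj i ∘ₗ C.mulVecLin).coprod (LinearMap.proj i)

theorem coroot_simpleRoot {C : Matrix ι ι ℤ} (hC : IsGCM C) (i : ι) :
    coroot C i (simpleRoot i) = 2 := by
  simp [coroot, simpleRoot, hC.diag i]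

/-- The simple reflection `s_i : x ↦ x - ⟨x, α_i⟩ α_i`. -/
def simpleReflection {C : Matrix ι ι ℤ} (hC : IsGCM C) (i : ι) :
    WeightLattice ι ≃ₗ[ℤ] WeightLattice ι :=
  Module.reflection (coroot_simpleRoot hC i)

/-- The Weyl group, generated by the simple reflections. -/
def weylGroup {C : Matrix ι ι ℤ} (hC : IsGCM C) :
    Subgroup (WeightLattice ι ≃ₗ[ℤ] WeightLattice ι) :=
  Subgroup.closure (Set.range (simpleReflection hC))

/-- The weight `∑ p_i ϖ_i`. -/
def weight (p : ι → ℤ) : WeightLattice ι := (0, p)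

end Weights

/-! ## The framed preprojective algebra and stable modules -/

section Framed

variable {ι : Type w} [Fintype ι] [DecidableEq ι]

/-- The framed Cartan matrix; `Sum.inl i` is the vertex `i` and `Sum.inr i` the added vertex `i'`. -/
def framedMatrix (C : Matrix ι ι ℤ) : Matrix (ι ⊕ ι) (ι ⊕ ι) ℤ :=
  Matrix.fromBlocks C (-1) (-1) (2 • (1 : Matrix ι ι ℤ))

/-- The symmetrizer `diag(D, D)` of the framed Cartan matrix. -/
def framedSymmetrizer (D : ι → ℕ) : ι ⊕ ι → ℕ := Sum.elim D D

variable (K : Type u) [Field K] (C : Matrix ι ι ℤ) (D : ι → ℕ) (Ω : ι ⊕ ι → ι ⊕ ι → Prop)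

/-- The framed preprojective algebra. -/
abbrev FramedPreproj : Type max u w := Preproj K (framedMatrix C) (framedSymmetrizer D) Ω

variable (M : Type v) [AddCommGroup M] [Module (FramedPreproj K C D Ω) M]

/-- Stable modules: `𝔼`-filtered, with `sub_i M = 0` for every unframed vertex `i`. -/
def IsStable : Prop :=
  IsEFiltered K (framedMatrix C) (framedSymmetrizer D) Ω M ∧
    ∀ i : ι, subAt K (framedMatrix C) (framedSymmetrizer D) Ω M (Sum.inl i) = ⊥

/-- `M` is locally free with rank vector `(∑ ν_i α_i, ∑ lam_i ϖ_i)`: its rank at `i` is `ν_i`,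
and its rank at `i'` is `-lam_i`. -/
def HasRankVec (ν lam : ι → ℤ) : Prop :=
  ∀ i : ι,
    (∃ a : ℕ, (a : ℤ) = ν i ∧ HasRankAt (K := K) (C := framedMatrix C)
      (D := framedSymmetrizer D) (Ω := Ω) M (Sum.inl i) a) ∧
    (∃ a : ℕ, (a : ℤ) = - lam i ∧ HasRankAt (K := K) (C := framedMatrix C)
      (D := framedSymmetrizer D) (Ω := Ω) M (Sum.inr i) a)

/-- `M`, of rank vector `(ν, lam)`, has a small `i`-factor: `fac_i M` is a free `H_i`-module of rank
`max {0, ⟨ν + lam, α_i⟩}`. -/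
def HasSmallFactor (i : ι) : Prop :=
  ∃ ν lam : ι → ℤ, HasRankVec K C D Ω M ν lam ∧
    HasRankAt (K := K) (C := framedMatrix C) (D := framedSymmetrizer D) (Ω := Ω)
      (facAt K (framedMatrix C) (framedSymmetrizer D) Ω M (Sum.inl i)) (Sum.inl i)
      (max 0 (coroot C i (ν, lam))).toNat

end Framed

end FramedPreprojective

end

set_option linter.unusedSectionVars false
noncomputable section

namespace FramedPreprojective

/-! ### The defining relations as identities in the algebra -/

section Relations

variable {K : Type u} [Field K] {I : Type w} [Fintype I] [DecidableEq I]
  {C : Matrix I I ℤ} {D : I → ℕ} {Ω : I → I → Prop}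

local notation "𝒫" => Preproj K C D Ω

/-! Fix an unframed vertex i and let X be the sum of the spaces e_jM over the neighbours j of i,
each induced up to H_i. The arrows at i amount to H_i-linear maps in : X → e_iM and out : e_iM → X,
and the mesh relation at i says in ∘ out = 0. If S_i does not embed in M, then out is injective
(`NoSoc.outX_injective`), so dim im(in) ≤ dim e_iM ≤ dim ker(in). The rest of the module sees e_iM
only through out ∘ in. Hence e_iM may be replaced by im(in) or by ker(in) without breaking a
relation (`VertexData`), and no socle appears at the unframed vertices (`VertexData.noSoc`). The two
new dimension vectors have the form n' and s_i n', and the dimension vector of M lies on the segment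
joining them (`exists_string`).

Dimension vectors are nonnegative. By induction on words and convexity, every word in the unframed
reflections sends the dimension vector of a module without unframed socle to a nonnegative vector
(`IsStringClosed.wordAct_nonneg`). The vector attached to (wλ - λ, λ) is sent by some word to one
that vanishes at all unframed vertices. Were it strictly inside its i-string, both ends of the
string would be sent to vectors vanishing there too; the framing coordinates never change, so the
two ends would coincide, which is absurd (`IsStringClosed.extremal`). Thus e_iM is im(in) or is
identified by out with ker(in), according to the sign of ⟨wλ, α_i⟩ (`inSurj_or_exactX`). Since fac_i
M is e_iM / im(in), this is the statement about small factors.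

At an end of a string the module is recovered from what remains away from i, including out ∘ in
(`SameOff.nonempty_equiv`). So reflection is reversible, and both existence and uniqueness descend
along a word for w to the rank vector (0, λ), where no arrow can act and a locally free module is
determined by its ranks. Local freeness survives because the new space is a kernel or cokernel in a
short exact sequence of free H_i-modules.

Uniqueness uses only local freeness and the absence of socle, not the 𝔼-filtration. For existence
the filtration is built by climbing: a reflection that enlarges the module embeds the old one with a
locally free quotient concentrated at i. The climb starts from a vector with no positive pairing,
and such a vector must vanish at the unframed vertices (`exists_isGood_filtered`). -/

theorem e_mul_self (i : I) : (gen (.e i) * gen (.e i) : 𝒫) = gen (.e i) := by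
  simpa [gen] using toPreproj_rel (Rel.e_mul_self (K := K) (C := C) (D := D) (Ω := Ω) i)

theorem e_mul_ne {i j : I} (h : i ≠ j) : (gen (.e i) * gen (.e j) : 𝒫) = 0 := by
  simpa [gen] using toPreproj_rel (Rel.e_mul_ne (K := K) (C := C) (D := D) (Ω := Ω) i j h)

theorem sum_e : (∑ i, gen (.e i) : 𝒫) = 1 := by
  simpa [gen] using toPreproj_rel (Rel.e_sum (K := K) (C := C) (D := D) (Ω := Ω))

theorem e_mul_eps (i : I) : (gen (.e i) * gen (.eps i) : 𝒫) = gen (.eps i) := by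
  simpa [gen] using toPreproj_rel (Rel.e_eps (K := K) (C := C) (D := D) (Ω := Ω) i)

theorem eps_mul_e (i : I) : (gen (.eps i) * gen (.e i) : 𝒫) = gen (.eps i) := by
  simpa [gen] using toPreproj_rel (Rel.eps_e (K := K) (C := C) (D := D) (Ω := Ω) i)

theorem e_mul_arr (i j : I) (h : Ω i j ∨ Ω j i) (g : Fin (gNum C i j)) :
    (gen (.e i) * gen (.arr i j h g) : 𝒫) = gen (.arr i j h g) := by
  simpa [gen] using toPreproj_rel (Rel.e_arr (K := K) (C := C) (D := D) (Ω := Ω) i j h g)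

theorem arr_mul_e (i j : I) (h : Ω i j ∨ Ω j i) (g : Fin (gNum C i j)) :
    (gen (.arr i j h g) * gen (.e j) : 𝒫) = gen (.arr i j h g) := by
  simpa [gen] using toPreproj_rel (Rel.arr_e (K := K) (C := C) (D := D) (Ω := Ω) i j h g)

theorem eps_pow (i : I) : (gen (.eps i) ^ D i : 𝒫) = 0 := by
  simpa [gen] using toPreproj_rel (Rel.P1 (K := K) (C := C) (D := D) (Ω := Ω) i)

theorem eps_pow_mul_arr (i j : I) (h : Ω i j ∨ Ω j i) (g : Fin (gNum C i j)) :
    (gen (.eps i) ^ fNum C j i * gen (.arr i j h g) : 𝒫) =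
      gen (.arr i j h g) * gen (.eps j) ^ fNum C i j := by
  simpa [gen] using toPreproj_rel (Rel.P2 (K := K) (C := C) (D := D) (Ω := Ω) i j h g)

/-- The neighbours of a vertex. -/
abbrev Nb (Ω : I → I → Prop) (i : I) : Type w := {j : I // Ω i j ∨ Ω j i}

instance (i : I) : Fintype (Nb Ω i) := Fintype.ofFinite _

theorem sum_dite_eq_sum_nb {A : Type*} [AddCommMonoid A] (i : I)
    [∀ j, Decidable (Ω i j ∨ Ω j i)] (F : ∀ j, (Ω i j ∨ Ω j i) → A) :
    (∑ j, if h : Ω i j ∨ Ω j i then F j h else 0) = ∑ j : Nb Ω i, F j.1 j.2 := by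
  set G : I → A := fun j => if h : Ω i j ∨ Ω j i then F j h else 0
  have hG : ∀ j : Nb Ω i, F j.1 j.2 = G j.1 := fun j => by simp only [G, dif_pos j.2]
  rw [Fintype.sum_congr _ _ hG,
    ← Finset.sum_subtype (Finset.univ.filter fun j => Ω i j ∨ Ω j i) (by simp) G]
  refine (Finset.sum_subset (Finset.subset_univ _) fun j _ hj => ?_).symm
  simp only [Finset.mem_filter, Finset.mem_univ, true_and] at hj
  simp only [dif_neg hj]

/-- The mesh relation, as a sum over the neighbours of the vertex. -/
theorem mesh_relation (i : I) :
    (∑ j : Nb Ω i, ∑ g : Fin (gNum C i j), ∑ f ∈ Finset.range (fNum C j i),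
      sgn K Ω i j • (gen (.eps i) ^ f * gen (.arr i j.1 j.2 g) *
        gen (.arr j.1 i j.2.symm (Fin.cast (gNum_comm C i j) g)) *
        gen (.eps i) ^ (fNum C j i - 1 - f)) : 𝒫) = 0 := by
  classical
  have h := toPreproj_rel (Rel.P3 (K := K) (C := C) (D := D) (Ω := Ω) i)
  rw [mesh, sum_dite_eq_sum_nb i (A := FreeAlgebra K (Gen C Ω))] at h
  simpa [gen] using h

theorem sgn_mul_self (i j : I) : sgn K Ω i j * sgn K Ω i j = 1 := by
  unfold sgn; split_ifs <;> simp

/-- Algebra homomorphisms out of a preprojective algebra. -/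
def Preproj.lift {A : Type*} [Ring A] [Algebra K A] (F : Gen C Ω → A)
    (h : ∀ ⦃x y⦄, Rel K C D Ω x y → FreeAlgebra.lift K F x = FreeAlgebra.lift K F y) :
    𝒫 →ₐ[K] A :=
  RingQuot.liftAlgHom K ⟨FreeAlgebra.lift K F, h⟩

theorem Preproj.lift_gen {A : Type*} [Ring A] [Algebra K A] (F : Gen C Ω → A)
    (h : ∀ ⦃x y⦄, Rel K C D Ω x y → FreeAlgebra.lift K F x = FreeAlgebra.lift K F y)
    (x : Gen C Ω) : Preproj.lift (D := D) F h (gen x) = F x :=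
  (RingQuot.liftAlgHom_mkAlgHom_apply (S := K) (FreeAlgebra.lift K F) h (FreeAlgebra.ι K x)).trans
    (FreeAlgebra.lift_ι_apply F x)

theorem preproj_induction {p : 𝒫 → Prop} (hK : ∀ r : K, p (algebraMap K 𝒫 r))
    (hg : ∀ x, p (gen x)) (hadd : ∀ a b, p a → p b → p (a + b))
    (hmul : ∀ a b, p a → p b → p (a * b)) (a : 𝒫) : p a := by
  obtain ⟨x, rfl⟩ : ∃ x, toPreproj x = a := RingQuot.mkAlgHom_surjective K _ a
  induction x using FreeAlgebra.induction with
  | grade0 r => rw [AlgHom.commutes]; exact hK r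
  | grade1 x => exact hg x
  | mul a b ha hb => rw [map_mul]; exact hmul _ _ ha hb
  | add a b ha hb => rw [map_add]; exact hadd _ _ ha hb

end Relations

/-! ### The action of the generators on a module -/

section Action

variable {K : Type u} [Field K] {I : Type w} [Fintype I] [DecidableEq I]
  {C : Matrix I I ℤ} {D : I → ℕ} {Ω : I → I → Prop}
  {M : Type*} [AddCommGroup M] [Module (Preproj K C D Ω) M]
  {N : Type*} [AddCommGroup N] [Module (Preproj K C D Ω) N]

local notation "𝒫" => Preproj K C D Ω

theorem e_smul_e (i : I) (m : M) :
    (gen (.e i) : 𝒫) • (gen (.e i) : 𝒫) • m = (gen (.e i) : 𝒫) • m := by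
  rw [← mul_smul, e_mul_self]

theorem e_smul_e_ne {i j : I} (h : i ≠ j) (m : M) :
    (gen (.e i) : 𝒫) • (gen (.e j) : 𝒫) • m = 0 := by
  rw [← mul_smul, e_mul_ne h, zero_smul]

theorem sum_e_smul (m : M) : ∑ i, (gen (.e i) : 𝒫) • m = m := by
  rw [← Finset.sum_smul, sum_e, one_smul]

theorem e_smul_eps (i : I) (m : M) :
    (gen (.e i) : 𝒫) • (gen (.eps i) : 𝒫) • m = (gen (.eps i) : 𝒫) • m := by
  rw [← mul_smul, e_mul_eps]

theorem eps_smul_e (i : I) (m : M) :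
    (gen (.eps i) : 𝒫) • (gen (.e i) : 𝒫) • m = (gen (.eps i) : 𝒫) • m := by
  rw [← mul_smul, eps_mul_e]

theorem e_smul_eps_ne {i j : I} (h : i ≠ j) (m : M) :
    (gen (.e i) : 𝒫) • (gen (.eps j) : 𝒫) • m = 0 := by
  rw [← e_smul_eps, e_smul_e_ne h]

theorem eps_smul_e_ne {i j : I} (h : i ≠ j) (m : M) :
    (gen (.eps i) : 𝒫) • (gen (.e j) : 𝒫) • m = 0 := by
  rw [← eps_smul_e, e_smul_e_ne h, smul_zero]

theorem e_smul_arr (i j : I) (h : Ω i j ∨ Ω j i) (g : Fin (gNum C i j)) (m : M) :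
    (gen (.e i) : 𝒫) • (gen (.arr i j h g) : 𝒫) • m = (gen (.arr i j h g) : 𝒫) • m := by
  rw [← mul_smul, e_mul_arr]

theorem arr_smul_e (i j : I) (h : Ω i j ∨ Ω j i) (g : Fin (gNum C i j)) (m : M) :
    (gen (.arr i j h g) : 𝒫) • (gen (.e j) : 𝒫) • m = (gen (.arr i j h g) : 𝒫) • m := by
  rw [← mul_smul, arr_mul_e]

theorem e_smul_arr_ne {k i : I} (hk : k ≠ i) (j : I) (h : Ω i j ∨ Ω j i)
    (g : Fin (gNum C i j)) (m : M) :
    (gen (.e k) : 𝒫) • (gen (.arr i j h g) : 𝒫) • m = 0 := by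
  rw [← e_smul_arr, e_smul_e_ne hk]

theorem arr_smul_e_ne {k j : I} (i : I) (hk : j ≠ k) (h : Ω i j ∨ Ω j i)
    (g : Fin (gNum C i j)) (m : M) :
    (gen (.arr i j h g) : 𝒫) • (gen (.e k) : 𝒫) • m = 0 := by
  rw [← arr_smul_e, e_smul_e_ne hk, smul_zero]

theorem eps_pow_smul_zero (i : I) (m : M) : (gen (.eps i) ^ D i : 𝒫) • m = 0 := by
  rw [eps_pow, zero_smul]

theorem e_smul_eps_pow (i : I) (n : ℕ) {m : M} (hm : (gen (.e i) : 𝒫) • m = m) :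
    (gen (.e i) : 𝒫) • (gen (.eps i) ^ n : 𝒫) • m = (gen (.eps i) ^ n : 𝒫) • m := by
  cases n with
  | zero => simpa using hm
  | succ n => rw [pow_succ', mul_smul, e_smul_eps]

theorem eps_pow_smul_arr (i j : I) (h : Ω i j ∨ Ω j i) (g : Fin (gNum C i j)) (m : M) :
    (gen (.eps i) ^ fNum C j i : 𝒫) • (gen (.arr i j h g) : 𝒫) • m =
      (gen (.arr i j h g) : 𝒫) • (gen (.eps j) ^ fNum C i j : 𝒫) • m := by
  rw [← mul_smul, eps_pow_mul_arr, mul_smul]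

variable [Module K M] [IsScalarTower K (Preproj K C D Ω) M]
  [Module K N] [IsScalarTower K (Preproj K C D Ω) N]

theorem mesh_smul (i : I) (m : M) :
    ∑ j : Nb Ω i, ∑ g : Fin (gNum C i j), ∑ f ∈ Finset.range (fNum C j i),
      sgn K Ω i j • (gen (.eps i) ^ f : 𝒫) • (gen (.arr i j.1 j.2 g) : 𝒫) •
        (gen (.arr j.1 i j.2.symm (Fin.cast (gNum_comm C i j) g)) : 𝒫) •
        (gen (.eps i) ^ (fNum C j i - 1 - f) : 𝒫) • m = 0 := by
  have h := congrArg (fun a : 𝒫 => a • m) (mesh_relation (K := K) (C := C) (D := D) (Ω := Ω) i)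
  simpa only [Finset.sum_smul, smul_assoc, mul_smul, zero_smul] using h

/-- A linear map commuting with the generators is a homomorphism of modules. -/
theorem map_smul_of_gen (T : M →ₗ[K] N)
    (h : ∀ (x : Gen C Ω) (m : M), T ((gen x : 𝒫) • m) = (gen x : 𝒫) • T m) (a : 𝒫) (m : M) :
    T (a • m) = a • T m := by
  induction a using preproj_induction generalizing m with
  | hK r => simp
  | hg x => exact h x m
  | hadd a b ha hb => rw [add_smul, map_add, ha, hb, add_smul]
  | hmul a b ha hb => rw [mul_smul, ha, hb, mul_smul]

variable (K C D Ω M) in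
/-- The `K`-subspace `e_i M`. -/
def vsp (i : I) : Submodule K M where
  carrier := {m | (gen (.e i) : 𝒫) • m = m}
  add_mem' {a b} ha hb := by
    simp only [Set.mem_ofPred_eq] at *
    rw [smul_add, ha, hb]
  zero_mem' := by simp
  smul_mem' r a ha := by
    simp only [Set.mem_ofPred_eq] at *
    rw [smul_comm, ha]

theorem mem_vsp {i : I} {m : M} : m ∈ vsp K C D Ω M i ↔ (gen (.e i) : 𝒫) • m = m := Iff.rfl

theorem e_smul_coe {i : I} (m : vsp K C D Ω M i) : (gen (.e i) : 𝒫) • (m : M) = m := m.2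

theorem e_smul_coe_ne {i j : I} (h : i ≠ j) (m : vsp K C D Ω M j) :
    (gen (.e i) : 𝒫) • (m : M) = 0 := by
  rw [← e_smul_coe m, e_smul_e_ne h]

variable (K C D Ω M) in
/-- The action of `ε_i` on `e_i M`. -/
def epsEnd (i : I) : Module.End K (vsp K C D Ω M i) :=
  (Algebra.lsmul K K M (gen (.eps i) : 𝒫)).restrict fun m _ => by
    rw [Algebra.lsmul_coe, mem_vsp, e_smul_eps]

@[simp] theorem coe_epsEnd (i : I) (m : vsp K C D Ω M i) :
    (epsEnd K C D Ω M i m : M) = (gen (.eps i) : 𝒫) • (m : M) := rfl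

@[simp] theorem coe_epsEnd_pow (i : I) (n : ℕ) (m : vsp K C D Ω M i) :
    ((epsEnd K C D Ω M i ^ n) m : M) = (gen (.eps i) ^ n : 𝒫) • (m : M) := by
  induction n generalizing m with
  | zero => simp
  | succ n ih => rw [pow_succ, Module.End.mul_apply, ih, coe_epsEnd, pow_succ, mul_smul]

theorem epsEnd_pow_eq_zero (i : I) : epsEnd K C D Ω M i ^ D i = 0 := by
  ext m
  simp [eps_pow_smul_zero]

end Action

end FramedPreprojective

end

noncomputable section

namespace FramedPreprojective

/-! ## Modules over truncated polynomial rings -/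

section FreeNil

variable {K : Type u} [Field K] {V V' V'' : Type*} [AddCommGroup V] [Module K V]
  [AddCommGroup V'] [Module K V'] [AddCommGroup V''] [Module K V'']

/-- Exactness of the powers of an endomorphism `ε` with `ε ^ c = 0`. For finite-dimensional spaces
it characterizes the free modules over `K[x]/(x ^ c)`. -/
def IsFreeNil (c : ℕ) (ε : Module.End K V) : Prop :=
  ∀ k ≤ c, ∀ v, (ε ^ k) v = 0 → ∃ w, (ε ^ (c - k)) w = v

/-- Exactness at the first power suffices. If ε^(k+1) kills v, then ε^k v lies in ker ε, hence is
ε^(c-1) w; subtracting ε^(c-k-1) w from v leaves a vector killed by ε^k, to which the induction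
applies. -/
theorem isFreeNil_of_ker {c : ℕ} {ε : Module.End K V}
    (h : ∀ v, ε v = 0 → ∃ w, (ε ^ (c - 1)) w = v) : IsFreeNil c ε := by
  intro k
  induction k with
  | zero => exact fun _ v hv => ⟨0, by simpa using hv.symm⟩
  | succ k ih =>
    intro hk v hv
    obtain ⟨w, hw⟩ := h ((ε ^ k) v) (by rw [← Module.End.mul_apply, ← pow_succ', hv])
    obtain ⟨w', hw'⟩ := ih (by omega) (v - (ε ^ (c - (k + 1))) w) (by
      rw [map_sub, ← Module.End.mul_apply, ← pow_add, show k + (c - (k + 1)) = c - 1 by omega, hw,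
        sub_self])
    refine ⟨w + ε w', ?_⟩
    rw [map_add, ← Module.End.mul_apply _ ε, ← pow_succ,
      show c - (k + 1) + 1 = c - k by omega, hw']
    abel

theorem map_pow_apply {ε : Module.End K V} {ε' : Module.End K V'} {f : V →ₗ[K] V'}
    (h : ∀ v, f (ε v) = ε' (f v)) (n : ℕ) (v : V) : f ((ε ^ n) v) = (ε' ^ n) (f v) := by
  induction n generalizing v with
  | zero => rfl
  | succ n ih => rw [pow_succ, Module.End.mul_apply, ih, h, pow_succ, Module.End.mul_apply]

theorem IsFreeNil.of_equiv {c : ℕ} {ε : Module.End K V} {ε' : Module.End K V'} (f : V ≃ₗ[K] V')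
    (h : ∀ v, f (ε v) = ε' (f v)) (hV : IsFreeNil c ε) : IsFreeNil c ε' := by
  intro k hk v hv
  have hf := map_pow_apply (f := f.toLinearMap) h
  obtain ⟨v, rfl⟩ := f.surjective v
  obtain ⟨w, rfl⟩ := hV k hk v (f.injective (by
    have := hf k v
    simp only [LinearEquiv.coe_coe] at this
    rw [this, hv, map_zero]))
  exact ⟨f w, (hf _ w).symm⟩

variable {ε : Module.End K V} {ε' : Module.End K V'} {ε'' : Module.End K V''}
  {f : V →ₗ[K] V'} {g : V' →ₗ[K] V''}

/-- A quotient of a free module by a free submodule is free. -/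
theorem IsFreeNil.quotient {c : ℕ} (hf : ∀ v, f (ε v) = ε' (f v)) (hg : ∀ v, g (ε' v) = ε'' (g v))
    (hsurj : Function.Surjective g) (hex : ∀ v, g v = 0 ↔ ∃ u, f u = v)
    (hinj : Function.Injective f) (hε' : ε' ^ c = 0)
    (hV : IsFreeNil c ε) (hV' : IsFreeNil c ε') : IsFreeNil c ε'' := by
  intro k hk v hv
  obtain ⟨b, rfl⟩ := hsurj v
  -- Diagram chase: ε'^k b = f a, and ε'^c = 0 forces ε^(c-k) a = 0. Freeness of V at the
  -- complementary exponent gives a = ε^k a', so b can be corrected by f a', which g does not see.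
  rw [← map_pow_apply hg, hex] at hv
  obtain ⟨a, ha⟩ := hv
  obtain ⟨a', rfl⟩ := hV (c - k) (by omega) a (hinj (by
    rw [map_pow_apply hf, ha, ← Module.End.mul_apply, ← pow_add, Nat.sub_add_cancel hk, hε',
      LinearMap.zero_apply, map_zero]))
  rw [Nat.sub_sub_self hk, map_pow_apply hf] at ha
  obtain ⟨b', hb'⟩ := hV' k hk (b - f a') (by rw [map_sub, ha, sub_self])
  refine ⟨g b', ?_⟩
  rw [← map_pow_apply hg, hb', map_sub, (hex (f a')).2 ⟨a', rfl⟩, sub_zero]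

/-- The kernel of an epimorphism between free modules is free. -/
theorem IsFreeNil.kernel {c : ℕ} (hf : ∀ v, f (ε v) = ε' (f v)) (hg : ∀ v, g (ε' v) = ε'' (g v))
    (hsurj : Function.Surjective g) (hex : ∀ v, g v = 0 ↔ ∃ u, f u = v)
    (hinj : Function.Injective f) (hε' : ε' ^ c = 0)
    (hV' : IsFreeNil c ε') (hV'' : IsFreeNil c ε'') : IsFreeNil c ε := by
  intro k hk a ha
  obtain ⟨b, hb⟩ := hV' k hk (f a) (by rw [← map_pow_apply hf, ha, map_zero])
  -- The preimage b of f a under ε'^(c-k) need not come from V. Its image g b is an ε''^k-multiple,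
  -- and removing ε'^k b' costs nothing because ε'^(c-k) kills it.
  obtain ⟨d, hd⟩ := hV'' (c - k) (by omega) (g b) (by
    rw [← map_pow_apply hg, hb, hex]; exact ⟨a, rfl⟩)
  obtain ⟨b', rfl⟩ := hsurj d
  rw [Nat.sub_sub_self hk, ← map_pow_apply hg, eq_comm, ← sub_eq_zero, ← map_sub, hex] at hd
  obtain ⟨a', ha'⟩ := hd
  refine ⟨a', hinj ?_⟩
  rw [map_pow_apply hf, ha', map_sub, hb, ← Module.End.mul_apply, ← pow_add,
    Nat.sub_add_cancel hk, hε', LinearMap.zero_apply, sub_zero]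

/-- The shift `(m_0, …, m_{f-1}) ↦ (N m_{f-1}, m_0, …, m_{f-2})`. -/
def shiftEnd (N : Module.End K V) (f : ℕ) : Module.End K (Fin f → V) :=
  LinearMap.pi fun k => if k.1 = 0
    then N ∘ₗ LinearMap.proj ⟨f - 1, by have := k.2; omega⟩
    else LinearMap.proj ⟨k.1 - 1, by have := k.2; omega⟩

theorem shiftEnd_zero (N : Module.End K V) {f : ℕ} (m : Fin f → V) (h : 0 < f) :
    shiftEnd N f m ⟨0, h⟩ = N (m ⟨f - 1, by omega⟩) := by
  simp [shiftEnd]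

theorem shiftEnd_succ (N : Module.End K V) {f : ℕ} (m : Fin f → V) (k : ℕ) (h : k + 1 < f) :
    shiftEnd N f m ⟨k + 1, h⟩ = m ⟨k, by omega⟩ := by
  simp [shiftEnd]

theorem shiftEnd_pow_apply (N : Module.End K V) {f : ℕ} (r : ℕ) (m : Fin f → V) (k : ℕ)
    (h : k + r < f) : (shiftEnd N f ^ r) m ⟨k + r, h⟩ = m ⟨k, by omega⟩ := by
  induction r with
  | zero => rfl
  | succ r ih =>
    rw [pow_succ', Module.End.mul_apply]
    exact (shiftEnd_succ N _ (k + r) h).trans (ih (by omega))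

theorem shiftEnd_pow_self (N : Module.End K V) {f : ℕ} (m : Fin f → V) (k : Fin f) :
    (shiftEnd N f ^ f) m k = N (m k) := by
  obtain ⟨k, hk⟩ := k
  -- Entry k takes f - 1 - k steps to reach the last place, one step to wrap around and meet N, and
  -- k steps to return.
  have h1 : shiftEnd N f ^ f = shiftEnd N f ^ k * (shiftEnd N f * shiftEnd N f ^ (f - 1 - k)) := by
    rw [← pow_succ', ← pow_add]; congr 1; omega
  rw [h1, Module.End.mul_apply, Module.End.mul_apply]
  have h2 := shiftEnd_pow_apply N k
    (shiftEnd N f ((shiftEnd N f ^ (f - 1 - k)) m)) 0 (by omega)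
  simp only [Nat.zero_add] at h2
  rw [h2, shiftEnd_zero]
  congr 1
  have h3 := shiftEnd_pow_apply N (f - 1 - k) m k (by omega)
  convert h3 using 3
  omega

theorem shiftEnd_pow_mul (N : Module.End K V) {f : ℕ} (t : ℕ) (m : Fin f → V) (k : Fin f) :
    (shiftEnd N f ^ (f * t)) m k = (N ^ t) (m k) := by
  induction t generalizing m with
  | zero => rfl
  | succ t ih =>
    rw [Nat.mul_succ, pow_add, Module.End.mul_apply, ih, shiftEnd_pow_self, pow_succ,
      Module.End.mul_apply]

theorem shiftEnd_pow_single (N : Module.End K V) {f : ℕ} (r : ℕ) (hr : r < f) (v : V) :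
    (shiftEnd N f ^ r) (Pi.single ⟨0, by omega⟩ v) = Pi.single ⟨r, hr⟩ v := by
  induction r with
  | zero => rfl
  | succ r ih =>
    rw [pow_succ', Module.End.mul_apply, ih (by omega)]
    ext ⟨k, hk⟩
    cases k with
    | zero =>
      rw [shiftEnd_zero, Pi.single_eq_of_ne, Pi.single_eq_of_ne, map_zero] <;>
        simp only [ne_eq, Fin.mk.injEq] <;> omega
    | succ k =>
      rw [shiftEnd_succ]
      simp [Pi.single_apply]

/-- The universal property of induction along K[x^f] ⊂ K[x]: a map A intertwining N with S^f extends
to the induced module, on which x acts as the shift. Only the wrapped entry needs the hypothesis. -/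
theorem sum_shiftEnd (N : Module.End K V) {W : Type*} [AddCommGroup W] [Module K W]
    (S : Module.End K W) (A : V →ₗ[K] W) {f : ℕ} (h : ∀ v, (S ^ f) (A v) = A (N v))
    (m : Fin f → V) :
    ∑ k : Fin f, (S ^ (k : ℕ)) (A (shiftEnd N f m k)) = S (∑ k : Fin f, (S ^ (k : ℕ)) (A (m k))) := by
  cases f with
  | zero => simp
  | succ f =>
    rw [Fin.sum_univ_succ, Fin.sum_univ_castSucc, map_add, map_sum]
    have h0 : shiftEnd N (f + 1) m 0 = N (m (Fin.last f)) := shiftEnd_zero N m (by omega)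
    rw [h0, ← h]
    have h1 : ∀ k : Fin f, shiftEnd N (f + 1) m k.succ = m k.castSucc := fun k =>
      shiftEnd_succ N m k.1 (by omega)
    simp only [h1, Fin.val_zero, pow_zero, Module.End.one_apply, Fin.val_succ, Fin.val_castSucc,
      Fin.val_last]
    rw [add_comm, ← Module.End.mul_apply S, ← pow_succ']
    congr 1
    exact Finset.sum_congr rfl fun k _ => by rw [pow_succ', Module.End.mul_apply]

/-- Restricting a free K[y]/(y^c')-module to y^f' gives a free module over K[z]/(z^t), and adjoining
an f-th root of z gives one over K[x]/(x^c). By `isFreeNil_of_ker` only the kernel of the shift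
matters: it sits in the last place, where N^f' vanishes. -/
theorem isFreeNil_shiftEnd {N : Module.End K V} {c c' f f' t : ℕ}
    (hf : 0 < f) (ht : 0 < t) (hc : c = f * t) (hc' : c' = f' * t)
    (h : IsFreeNil c' N) : IsFreeNil c (shiftEnd (N ^ f') f) := by
  refine isFreeNil_of_ker fun m hm => ?_
  have h0 : ∀ k (hk : k + 1 < f), m ⟨k, by omega⟩ = 0 := fun k hk => by
    rw [← shiftEnd_succ (N ^ f') m k hk, hm]; rfl
  have h1 : (N ^ f') (m ⟨f - 1, by omega⟩) = 0 := by
    rw [← shiftEnd_zero (N ^ f') m hf, hm]; rfl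
  obtain ⟨w, hw⟩ := h f' (by rw [hc']; exact Nat.le_mul_of_pos_right _ ht) _ h1
  refine ⟨Pi.single ⟨0, hf⟩ w, ?_⟩
  obtain ⟨t, rfl⟩ : ∃ s, t = s + 1 := ⟨t - 1, by omega⟩
  -- Here t has been replaced by t + 1. The f - 1 extra shifts carry w from place 0 to the last
  -- place; the f * t others apply N^(f' * t) = N^(c' - f').
  have hc1 : c - 1 = f * t + (f - 1) := by rw [hc, Nat.mul_succ]; omega
  rw [hc1, pow_add, Module.End.mul_apply, shiftEnd_pow_single _ _ (by omega)]
  ext ⟨k, hk⟩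
  rw [shiftEnd_pow_mul, ← pow_mul]
  by_cases hkf : k = f - 1
  · subst hkf
    rw [Pi.single_eq_same, ← hw, hc', Nat.mul_succ, Nat.add_sub_cancel]
  · rw [Pi.single_eq_of_ne (by simpa using hkf), map_zero, h0 k (by omega)]

theorem shiftEnd_pow_eq_zero {N : Module.End K V} {c c' f f' t : ℕ}
    (hc : c = f * t) (hc' : c' = f' * t) (h : N ^ c' = 0) : shiftEnd (N ^ f') f ^ c = 0 := by
  refine LinearMap.ext fun m => funext fun k => ?_
  rw [hc, shiftEnd_pow_mul, ← pow_mul, ← hc', h]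
  rfl

/-! ### Dimension and freeness -/

/-- For k < c the map ε^k sends ker ε^(k+1) onto ker ε with kernel ker ε^k, so the kernels of the
powers of ε grow in c steps of equal dimension. -/
theorem isFreeNil_finrank [FiniteDimensional K V] {c : ℕ} (hε : ε ^ c = 0)
    (h : IsFreeNil c ε) : Module.finrank K V = c * Module.finrank K (LinearMap.ker ε) := by
  have key : ∀ k ≤ c, Module.finrank K (LinearMap.ker (ε ^ k)) =
      k * Module.finrank K (LinearMap.ker ε) := by
    intro k
    induction k with
    | zero => intro _; simp [Module.End.one_eq_id]
    | succ k ih =>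
      intro hk
      have hmap : ∀ v ∈ LinearMap.ker (ε ^ (k + 1)), (ε ^ k) v ∈ LinearMap.ker ε := fun v hv => by
        rw [LinearMap.mem_ker] at hv ⊢
        rw [← Module.End.mul_apply, ← pow_succ', hv]
      have hsurj : Function.Surjective ((ε ^ k).restrict hmap) := fun ⟨v, hv⟩ => by
        obtain ⟨w, hw⟩ := h 1 (by omega) v (by simpa using hv)
        have hw' : (ε ^ k) ((ε ^ (c - 1 - k)) w) = v := by
          rw [← Module.End.mul_apply, ← pow_add, show k + (c - 1 - k) = c - 1 by omega, hw]
        refine ⟨⟨(ε ^ (c - 1 - k)) w, ?_⟩, Subtype.ext hw'⟩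
        rw [LinearMap.mem_ker, pow_succ', Module.End.mul_apply, hw']
        exact hv
      have hker : LinearMap.ker ((ε ^ k).restrict hmap) =
          (LinearMap.ker (ε ^ k)).submoduleOf (LinearMap.ker (ε ^ (k + 1))) := by
        ext v
        simp [Submodule.submoduleOf, Subtype.ext_iff]
      have hle : LinearMap.ker (ε ^ k) ≤ LinearMap.ker (ε ^ (k + 1)) := fun v hv => by
        rw [LinearMap.mem_ker] at hv ⊢
        rw [pow_succ', Module.End.mul_apply, hv, map_zero]
      have hrn := LinearMap.finrank_range_add_finrank_ker ((ε ^ k).restrict hmap)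
      rw [LinearMap.range_eq_top.2 hsurj, finrank_top, hker,
        (Submodule.submoduleOfEquivOfLe hle).finrank_eq, ih (by omega)] at hrn
      rw [← hrn]; ring
  have := key c le_rfl
  rw [hε, LinearMap.ker_zero, finrank_top] at this
  exact this

open Polynomial in
theorem finrank_truncated (c : ℕ) :
    Module.finrank K (K[X] ⧸ Ideal.span {(X : K[X]) ^ c}) = c := by
  rw [finrank_quotient_span_eq_natDegree, natDegree_X_pow]

open Polynomial in
/-- The homomorphism from a free module over `K[x]/(x ^ c)` given by a family of vectors. -/
theorem exists_freeEquiv_of_span [FiniteDimensional K V] {c a : ℕ} (hε : ε ^ c = 0)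
    (hdim : Module.finrank K V = c * a) (v : Fin a → V)
    (hspan : ∀ y, ∃ (r : Fin a → K) (z : V), y = ∑ i, r i • v i + ε z) :
    ∃ Φ : (Fin a → K[X] ⧸ Ideal.span {(X : K[X]) ^ c}) ≃ₗ[K] V,
      ∀ (p : K[X]) x, Φ (Ideal.Quotient.mk (Ideal.span {(X : K[X]) ^ c}) p • x) =
        aeval ε p (Φ x) := by
  let ψ : (K[X] ⧸ Ideal.span {(X : K[X]) ^ c}) →ₐ[K] Module.End K V :=
    Ideal.Quotient.liftₐ _ (aeval ε) (by
      intro p hp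
      obtain ⟨q, rfl⟩ := Ideal.mem_span_singleton.1 hp
      rw [map_mul, map_pow, aeval_X, hε, zero_mul])
  have hψ : ∀ p, ψ (Ideal.Quotient.mk _ p) = aeval ε p := fun p =>
    Ideal.Quotient.lift_mk _ _ _
  let Φ : (Fin a → K[X] ⧸ Ideal.span {(X : K[X]) ^ c}) →ₗ[K] V :=
    ∑ i, (LinearMap.applyₗ (v i)) ∘ₗ ψ.toLinearMap ∘ₗ LinearMap.proj i
  have hΦ : ∀ x, Φ x = ∑ i, ψ (x i) (v i) := fun x => by simp [Φ]
  have hΦp : ∀ (p : K[X]) x, Φ (Ideal.Quotient.mk (Ideal.span {(X : K[X]) ^ c}) p • x) =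
        aeval ε p (Φ x) := fun p x => by
    rw [hΦ, hΦ, map_sum]
    refine Finset.sum_congr rfl fun i _ => ?_
    rw [Pi.smul_apply, smul_eq_mul, map_mul, hψ, Module.End.mul_apply]
  have hstab : ∀ y ∈ LinearMap.range Φ, ε y ∈ LinearMap.range Φ := by
    rintro _ ⟨x, rfl⟩
    exact ⟨_, (hΦp X x).trans (by rw [aeval_X])⟩
  have hv : ∀ r : Fin a → K, ∑ i, r i • v i ∈ LinearMap.range Φ := fun r =>
    ⟨fun i => algebraMap K _ (r i), by
      rw [hΦ]
      exact Finset.sum_congr rfl fun i _ => by rw [AlgHom.commutes, Module.algebraMap_end_apply]⟩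
  -- Nakayama's lemma by hand: a family generating V modulo εV generates V modulo ε^k V for every k,
  -- and ε^c = 0.
  have hk : ∀ (k : ℕ) y, ∃ z, y - (ε ^ k) z ∈ LinearMap.range Φ := by
    intro k
    induction k with
    | zero => exact fun y => ⟨y, by simp⟩
    | succ k ih =>
      intro y
      obtain ⟨r, z, rfl⟩ := hspan y
      obtain ⟨z', hz'⟩ := ih z
      refine ⟨z', ?_⟩
      have := add_mem (hv r) (hstab _ hz')
      rwa [map_sub, ← Module.End.mul_apply, ← pow_succ', ← add_sub_assoc] at this
  have hsurj : Function.Surjective Φ := fun y => by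
    obtain ⟨z, hz⟩ := hk c y
    rwa [hε, LinearMap.zero_apply, sub_zero] at hz
  have hfin : Module.Finite K (K[X] ⧸ Ideal.span {(X : K[X]) ^ c}) :=
    Polynomial.Monic.finite_quotient (monic_X_pow c)
  have heq : Module.finrank K (Fin a → K[X] ⧸ Ideal.span {(X : K[X]) ^ c}) =
      Module.finrank K V := by
    rw [Module.finrank_pi_fintype, hdim]
    simp [finrank_truncated, mul_comm]
  exact ⟨LinearEquiv.ofBijective Φ
    ⟨(LinearMap.injective_iff_surjective_of_finrank_eq_finrank heq).2 hsurj, hsurj⟩, hΦp⟩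

open Polynomial in
-- The cokernel of ε has the same dimension as its kernel, namely a. Lifts of a basis of the
-- cokernel generate, and the dimension count makes them a basis over K[x]/(x^c).
theorem IsFreeNil.exists_freeEquiv [FiniteDimensional K V] {c a : ℕ} (hc : 0 < c) (hε : ε ^ c = 0)
    (h : IsFreeNil c ε) (hdim : Module.finrank K V = c * a) :
    ∃ Φ : (Fin a → K[X] ⧸ Ideal.span {(X : K[X]) ^ c}) ≃ₗ[K] V,
      ∀ (p : K[X]) x, Φ (Ideal.Quotient.mk (Ideal.span {(X : K[X]) ^ c}) p • x) =
        aeval ε p (Φ x) := by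
  have hker : Module.finrank K (LinearMap.ker ε) = a := by
    have := isFreeNil_finrank hε h
    rw [hdim] at this
    exact (Nat.eq_of_mul_eq_mul_left hc this).symm
  have hq : Module.finrank K (V ⧸ LinearMap.range ε) = a := by
    have h1 := Submodule.finrank_quotient_add_finrank (LinearMap.range ε)
    have h2 := LinearMap.finrank_range_add_finrank_ker ε
    omega
  let b := Module.finBasisOfFinrankEq K (V ⧸ LinearMap.range ε) hq
  choose v hv using fun i => Submodule.Quotient.mk_surjective _ (b i)
  refine exists_freeEquiv_of_span hε hdim v fun y => ?_
  refine ⟨b.repr (Submodule.Quotient.mk y), ?_⟩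
  have h0 : (Submodule.Quotient.mk (y - ∑ i, b.repr (Submodule.Quotient.mk y) i • v i) :
      V ⧸ LinearMap.range ε) = 0 := by
    rw [Submodule.Quotient.mk_sub, sub_eq_zero, ← Submodule.mkQ_apply _ (∑ i, _), map_sum]
    simp only [map_smul, Submodule.mkQ_apply, hv]
    exact (b.sum_repr _).symm
  obtain ⟨z, hz⟩ := (Submodule.Quotient.mk_eq_zero _).1 h0
  exact ⟨z, by rw [hz]; abel⟩

open Polynomial in
-- In K[x]/(x^c) the annihilator of x^k is generated by x^(c-k), since x^c ∣ x^k p gives x^(c-k) ∣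
-- p.
theorem isFreeNil_of_freeEquiv {c a : ℕ}
    (Φ : (Fin a → K[X] ⧸ Ideal.span {(X : K[X]) ^ c}) ≃ₗ[K] V)
    (hΦ : ∀ (p : K[X]) x, Φ (Ideal.Quotient.mk (Ideal.span {(X : K[X]) ^ c}) p • x) =
        aeval ε p (Φ x)) :
    IsFreeNil c ε ∧ FiniteDimensional K V ∧ Module.finrank K V = c * a := by
  have hfin : Module.Finite K (K[X] ⧸ Ideal.span {(X : K[X]) ^ c}) :=
    Polynomial.Monic.finite_quotient (monic_X_pow c)
  have hpow : ∀ k x, (ε ^ k) (Φ x) =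
      Φ (Ideal.Quotient.mk (Ideal.span {(X : K[X]) ^ c}) (X ^ k) • x) := fun k x => by
    rw [hΦ, map_pow, aeval_X]
  refine ⟨fun k hk v hv => ?_, Module.Finite.equiv Φ, ?_⟩
  · obtain ⟨x, rfl⟩ := Φ.surjective v
    rw [hpow, LinearEquiv.map_eq_zero_iff] at hv
    choose p hp using fun i => Ideal.Quotient.mk_surjective (x i)
    have hdvd : ∀ i, ∃ q, p i = X ^ (c - k) * q := fun i => by
      have h1 := congrFun hv i
      rw [Pi.smul_apply, smul_eq_mul, ← hp, ← map_mul, Pi.zero_apply,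
        Ideal.Quotient.eq_zero_iff_mem, Ideal.mem_span_singleton] at h1
      have h2 : (X : K[X]) ^ k * X ^ (c - k) ∣ X ^ k * p i := by
        rwa [← pow_add, Nat.add_sub_cancel' hk]
      exact (mul_dvd_mul_iff_left (pow_ne_zero _ X_ne_zero)).1 h2
    choose q hq using hdvd
    refine ⟨Φ fun i => Ideal.Quotient.mk _ (q i), ?_⟩
    rw [hpow]
    congr 1
    funext i
    rw [Pi.smul_apply, smul_eq_mul, ← map_mul, ← hq, hp]
  · rw [← Φ.finrank_eq, Module.finrank_pi_fintype]
    simp [finrank_truncated, mul_comm]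

end FreeNil

/-! ## Numbers attached to the edges -/

section Numbers

variable {I : Type w} {C : Matrix I I ℤ} {D : I → ℕ}

theorem gNum_mul_fNum (C : Matrix I I ℤ) (i j : I) : gNum C i j * fNum C i j = (C i j).natAbs :=
  Nat.mul_div_cancel' (Nat.gcd_dvd_left _ _)

theorem fNum_pos {i j : I} (h : C i j ≠ 0) : 0 < fNum C i j := by
  have := gNum_mul_fNum C i j
  have h' : 0 < (C i j).natAbs := Int.natAbs_pos.2 h
  exact Nat.pos_of_ne_zero fun h0 => by rw [h0] at this; omega

/-- The symmetrizer entries are a common multiple of the numbers `f_{ji}`, `f_{ij}`. -/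
theorem exists_symmetrizer_factor (hD : IsSymmetrizer C D) {i j : I} (h : C i j ≠ 0) :
    ∃ t, 0 < t ∧ D i = fNum C j i * t ∧ D j = fNum C i j * t := by
  have hg : 0 < gNum C i j := Int.gcd_pos_of_ne_zero_left _ h
  -- The symmetrizer identity with the common factor g_ij cancelled. As f_ij and f_ji are coprime,
  -- f_ji divides c_i, and t is the quotient.
  have hs : D i * fNum C i j = D j * fNum C j i := by
    have h1 := congrArg Int.natAbs (hD.symm i j)
    rw [Int.natAbs_mul, Int.natAbs_mul, Int.natAbs_natCast, Int.natAbs_natCast,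
      ← gNum_mul_fNum C i j, ← gNum_mul_fNum C j i, gNum_comm C j i] at h1
    refine Nat.eq_of_mul_eq_mul_left hg ?_
    linarith
  have hcop : Nat.Coprime (fNum C j i) (fNum C i j) := by
    have := Nat.coprime_div_gcd_div_gcd (m := (C j i).natAbs) (n := (C i j).natAbs)
      (by rw [Nat.gcd_comm]; exact hg)
    unfold fNum
    rw [gNum_comm C i j]
    exact this
  have hdvd : fNum C j i ∣ D i := hcop.dvd_of_dvd_mul_right ⟨D j, by rw [hs, mul_comm]⟩
  obtain ⟨t, ht⟩ := hdvd
  have hDi := hD.pos i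
  have hf : 0 < fNum C j i := Nat.pos_of_ne_zero fun h0 => by rw [h0] at ht; omega
  refine ⟨t, Nat.pos_of_ne_zero fun h0 => by rw [h0] at ht; omega, ht, ?_⟩
  refine Nat.eq_of_mul_eq_mul_left hf ?_
  rw [mul_comm, ← hs, ht]; ring

end Numbers

end FramedPreprojective
end

noncomputable section

namespace FramedPreprojective

/-! ## The maps into and out of a vertex -/

section InOut

variable {K : Type u} [Field K] {I : Type w} [Fintype I] [DecidableEq I]
  {C : Matrix I I ℤ} {D : I → ℕ} {Ω : I → I → Prop}

local notation "𝒫" => Preproj K C D Ω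

theorem IsOrientation.ne (hΩ : IsOrientation C Ω) {i j : I} (h : Ω i j ∨ Ω j i) : j ≠ i := by
  rintro rfl
  exact hΩ.acyclic j (Relation.TransGen.single (or_self_iff.1 h))

theorem IsOrientation.neg (hΩ : IsOrientation C Ω) {i j : I} (h : Ω i j ∨ Ω j i) : C i j < 0 :=
  (hΩ.edge_iff i j (hΩ.ne h).symm).1 h

theorem IsOrientation.fNum_pos (hΩ : IsOrientation C Ω) {i : I} (j : Nb Ω i) :
    0 < fNum C j.1 i :=
  FramedPreprojective.fNum_pos (hΩ.neg j.2.symm).ne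

variable (K C D Ω) in
/-- The space `⨁_j (_i H_j ⊗ e_j M)`, the sum over the neighbours `j` of the vertex `i`: the entry
with indices `j, g, f` is the coefficient of `ε_i^f α_{ij}^{(g)}`. -/
abbrev XSp (M : Type*) [AddCommGroup M] [Module 𝒫 M] [Module K M] [IsScalarTower K 𝒫 M] (i : I) :=
  ∀ j : Nb Ω i, Fin (gNum C i j.1) → Fin (fNum C j.1 i) → vsp K C D Ω M j.1

variable {M : Type*} [AddCommGroup M] [Module (Preproj K C D Ω) M]
  [Module K M] [IsScalarTower K (Preproj K C D Ω) M]

variable (K C D Ω M) in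
/-- The coordinates with indices `j, g`. -/
def projX {i : I} (j : Nb Ω i) (g : Fin (gNum C i j.1)) :
    XSp K C D Ω M i →ₗ[K] (Fin (fNum C j.1 i) → vsp K C D Ω M j.1) where
  toFun m := m j g
  map_add' _ _ := rfl
  map_smul' _ _ := rfl

variable (K C D Ω M) in
/-- The action of `ε_i` on `⨁_j (_i H_j ⊗ e_j M)`. -/
def shiftX (i : I) : Module.End K (XSp K C D Ω M i) where
  toFun m := fun j g =>
    shiftEnd (epsEnd K C D Ω M j.1 ^ fNum C i j.1) (fNum C j.1 i) (m j g)
  map_add' m m' := by funext j g; exact map_add _ (m j g) (m' j g)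
  map_smul' r m := by funext j g; exact map_smul _ r (m j g)

theorem shiftX_apply {i : I} (m : XSp K C D Ω M i) (j : Nb Ω i) (g : Fin (gNum C i j.1)) :
    shiftX K C D Ω M i m j g =
      shiftEnd (epsEnd K C D Ω M j.1 ^ fNum C i j.1) (fNum C j.1 i) (m j g) := rfl

theorem shiftX_pow_apply {i : I} (n : ℕ) (m : XSp K C D Ω M i) (j : Nb Ω i)
    (g : Fin (gNum C i j.1)) :
    (shiftX K C D Ω M i ^ n) m j g =
      (shiftEnd (epsEnd K C D Ω M j.1 ^ fNum C i j.1) (fNum C j.1 i) ^ n) (m j g) :=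
  map_pow_apply (f := projX K C D Ω M j g)
    (fun v => shiftX_apply v j g) n m

variable (K C D Ω M) in
/-- The map `⨁_j (_i H_j ⊗ e_j M) → e_i M`. -/
def inX (i : I) : XSp K C D Ω M i →ₗ[K] M where
  toFun m := ∑ j : Nb Ω i, ∑ g : Fin (gNum C i j.1), ∑ f : Fin (fNum C j.1 i),
    (gen (.eps i) ^ (f : ℕ) : 𝒫) • (gen (.arr i j.1 j.2 g) : 𝒫) • (m j g f : M)
  map_add' m m' := by
    simp only [Pi.add_apply, Submodule.coe_add, smul_add, Finset.sum_add_distrib]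
  map_smul' r m := by
    simp only [Pi.smul_apply, Submodule.coe_smul, smul_comm _ r, Finset.smul_sum, RingHom.id_apply]

theorem inX_apply {i : I} (m : XSp K C D Ω M i) :
    inX K C D Ω M i m = ∑ j : Nb Ω i, ∑ g : Fin (gNum C i j.1), ∑ f : Fin (fNum C j.1 i),
      (gen (.eps i) ^ (f : ℕ) : 𝒫) • (gen (.arr i j.1 j.2 g) : 𝒫) • (m j g f : M) := rfl

variable (K C D Ω M) in
/-- The map `e_i M → ⨁_j (_i H_j ⊗ e_j M)`. -/
def outX (i : I) : M →ₗ[K] XSp K C D Ω M i where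
  toFun m := fun j g f => ⟨sgn K Ω i j.1 •
      (gen (.arr j.1 i j.2.symm (Fin.cast (gNum_comm C i j.1) g)) : 𝒫) •
        (gen (.eps i) ^ (fNum C j.1 i - 1 - f) : 𝒫) • m,
      Submodule.smul_mem _ _ (e_smul_arr _ _ _ _ _)⟩
  map_add' m m' := by
    funext j g f
    exact Subtype.ext (by simp only [smul_add, Pi.add_apply, Submodule.coe_add])
  map_smul' r m := by
    funext j g f
    refine Subtype.ext ?_
    simp only [Pi.smul_apply, Submodule.coe_smul, RingHom.id_apply, smul_comm _ r]

theorem coe_outX {i : I} (m : M) (j : Nb Ω i) (g : Fin (gNum C i j.1)) (f : Fin (fNum C j.1 i)) :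
    (outX K C D Ω M i m j g f : M) = sgn K Ω i j.1 •
      (gen (.arr j.1 i j.2.symm (Fin.cast (gNum_comm C i j.1) g)) : 𝒫) •
        (gen (.eps i) ^ (fNum C j.1 i - 1 - f) : 𝒫) • m := rfl

theorem e_smul_inX {i : I} (m : XSp K C D Ω M i) :
    (gen (.e i) : 𝒫) • inX K C D Ω M i m = inX K C D Ω M i m := by
  rw [inX_apply, Finset.smul_sum]
  refine Finset.sum_congr rfl fun j _ => ?_
  rw [Finset.smul_sum]
  refine Finset.sum_congr rfl fun g _ => ?_
  rw [Finset.smul_sum]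
  exact Finset.sum_congr rfl fun f _ => e_smul_eps_pow i f (e_smul_arr _ _ _ _ _)

theorem eps_pow_smul_e (i : I) (n : ℕ) (m : M) :
    (gen (.eps i) ^ n : 𝒫) • (gen (.e i) : 𝒫) • m =
      (gen (.e i) : 𝒫) • (gen (.eps i) ^ n : 𝒫) • m := by
  cases n with
  | zero => simp
  | succ n =>
    rw [← mul_smul, pow_succ, mul_assoc, eps_mul_e, ← pow_succ, ← mul_smul, pow_succ',
      ← mul_assoc, e_mul_eps]

theorem outX_e (i : I) (m : M) :
    outX K C D Ω M i ((gen (.e i) : 𝒫) • m) = outX K C D Ω M i m := by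
  funext j g f
  apply Subtype.ext
  rw [coe_outX, coe_outX, eps_pow_smul_e, arr_smul_e]

theorem outX_eq_zero {i : I} {m : M} (hm : (gen (.e i) : 𝒫) • m = 0) :
    outX K C D Ω M i m = 0 := by
  rw [← outX_e, hm, map_zero]

/-- This is the relation ε_i^{f_ji} α_ij = α_ij ε_j^{f_ij}, fed into `sum_shiftEnd`. -/
theorem inX_shiftX {i : I} (m : XSp K C D Ω M i) :
    inX K C D Ω M i (shiftX K C D Ω M i m) = (gen (.eps i) : 𝒫) • inX K C D Ω M i m := by
  rw [inX_apply, inX_apply, Finset.smul_sum]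
  refine Finset.sum_congr rfl fun j _ => ?_
  rw [Finset.smul_sum]
  refine Finset.sum_congr rfl fun g _ => ?_
  have := sum_shiftEnd (epsEnd K C D Ω M j.1 ^ fNum C i j.1) (Algebra.lsmul K K M (gen (.eps i) : 𝒫))
    (Algebra.lsmul K K M (gen (.arr i j.1 j.2 g) : 𝒫) ∘ₗ (vsp K C D Ω M j.1).subtype)
    (f := fNum C j.1 i) (fun v => by
      rw [← map_pow]
      simp only [LinearMap.comp_apply, Submodule.subtype_apply, Algebra.lsmul_coe, coe_epsEnd_pow]
      exact eps_pow_smul_arr _ _ _ _ _) (m j g)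
  simp only [← map_pow] at this
  exact this

theorem outX_eps {i : I} (m : M) :
    outX K C D Ω M i ((gen (.eps i) : 𝒫) • m) = shiftX K C D Ω M i (outX K C D Ω M i m) := by
  funext j g ⟨f, hf⟩
  apply Subtype.ext
  rw [coe_outX, ← mul_smul (gen (.eps i) ^ _ : 𝒫), ← pow_succ, shiftX_apply]
  cases f with
  | zero =>
    rw [shiftEnd_zero, coe_epsEnd_pow, coe_outX, smul_comm _ (sgn K Ω i j.1), eps_pow_smul_arr]
    simp only [Nat.sub_zero, Nat.sub_self, pow_zero, one_smul]
    rw [Nat.sub_add_cancel hf]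
  | succ f =>
    rw [shiftEnd_succ _ _ _ hf, coe_outX]
    congr 4
    simp only
    omega

/-- The mesh relation at i, whose signs have been absorbed into the outgoing map. -/
theorem inX_outX (i : I) (m : M) : inX K C D Ω M i (outX K C D Ω M i m) = 0 := by
  rw [inX_apply, ← mesh_smul (K := K) (C := C) (D := D) (Ω := Ω) i m]
  refine Finset.sum_congr rfl fun j _ => Finset.sum_congr rfl fun g _ => ?_
  rw [Finset.sum_range]
  refine Finset.sum_congr rfl fun f _ => ?_
  rw [coe_outX, smul_comm _ (sgn K Ω i j.1), smul_comm _ (sgn K Ω i j.1)]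

variable (K C D Ω M) in
/-- The inclusion of `α_{ij}^{(g)} ⊗ e_j M`. -/
def incX {i : I} (hΩ : IsOrientation C Ω) (j : Nb Ω i) (g : Fin (gNum C i j.1)) :
    vsp K C D Ω M j.1 →ₗ[K] XSp K C D Ω M i where
  toFun m := Pi.single j (Pi.single g (Pi.single ⟨0, hΩ.fNum_pos j⟩ m))
  map_add' m m' := by simp only [Pi.single_add]
  map_smul' r m := by simp only [Pi.single_smul, RingHom.id_apply]

theorem incX_apply {i : I} (hΩ : IsOrientation C Ω) (j : Nb Ω i) (g : Fin (gNum C i j.1))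
    (m : vsp K C D Ω M j.1) : incX K C D Ω M hΩ j g m =
      Pi.single j (Pi.single g (Pi.single ⟨0, hΩ.fNum_pos j⟩ m)) := rfl

variable (K C D Ω M) in
/-- The last coefficient. -/
def lastX {i : I} (hΩ : IsOrientation C Ω) (j : Nb Ω i) (g : Fin (gNum C i j.1)) :
    XSp K C D Ω M i →ₗ[K] vsp K C D Ω M j.1 where
  toFun m := m j g ⟨fNum C j.1 i - 1, by have := hΩ.fNum_pos j; omega⟩
  map_add' _ _ := rfl
  map_smul' _ _ := rfl

variable (hΩ : IsOrientation C Ω)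
include hΩ

theorem inX_incX {i : I} (j : Nb Ω i) (g : Fin (gNum C i j.1)) (m : vsp K C D Ω M j.1) :
    inX K C D Ω M i (incX K C D Ω M hΩ j g m) = (gen (.arr i j.1 j.2 g) : 𝒫) • (m : M) := by
  rw [inX_apply, Finset.sum_eq_single j, Finset.sum_eq_single g, Finset.sum_eq_single
    (⟨0, hΩ.fNum_pos j⟩ : Fin (fNum C j.1 i))]
  · simp [incX_apply]
  · intro f _ hf
    simp [incX_apply, Pi.single_eq_of_ne hf]
  · simp
  · intro g' _ hg
    simp [incX_apply, Pi.single_eq_of_ne hg]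
  · simp
  · intro j' _ hj
    simp [incX_apply, Pi.single_eq_of_ne hj]
  · simp

theorem lastX_outX {i : I} (j : Nb Ω i) (g : Fin (gNum C i j.1)) (m : M) :
    (lastX K C D Ω M hΩ j g (outX K C D Ω M i m) : M) = sgn K Ω i j.1 •
      (gen (.arr j.1 i j.2.symm (Fin.cast (gNum_comm C i j.1) g)) : 𝒫) • m := by
  refine (coe_outX _ _ _ _).trans ?_
  simp

theorem incX_eps {i : I} (j : Nb Ω i) (g : Fin (gNum C i j.1)) (m : vsp K C D Ω M j.1) :
    incX K C D Ω M hΩ j g ((epsEnd K C D Ω M j.1 ^ fNum C i j.1) m) =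
      (shiftX K C D Ω M i ^ fNum C j.1 i) (incX K C D Ω M hΩ j g m) := by
  funext j' g'
  rw [shiftX_pow_apply]
  by_cases hj : j' = j
  · subst hj
    by_cases hg : g' = g
    · subst hg
      funext f
      rw [shiftEnd_pow_self]
      by_cases hf : f = ⟨0, hΩ.fNum_pos j'⟩
      · subst hf; simp [incX_apply]
      · simp [incX_apply, Pi.single_eq_of_ne hf]
    · simp [incX_apply, Pi.single_eq_of_ne hg]
  · simp [incX_apply, Pi.single_eq_of_ne hj]

theorem lastX_shiftX {i : I} (j : Nb Ω i) (g : Fin (gNum C i j.1)) (m : XSp K C D Ω M i) :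
    lastX K C D Ω M hΩ j g ((shiftX K C D Ω M i ^ fNum C j.1 i) m) =
      (epsEnd K C D Ω M j.1 ^ fNum C i j.1) (lastX K C D Ω M hΩ j g m) :=
  (congrFun (shiftX_pow_apply _ m j g) _).trans (shiftEnd_pow_self _ _ _)

theorem sum_shiftX_incX {i : I} (m : XSp K C D Ω M i) :
    ∑ j : Nb Ω i, ∑ g : Fin (gNum C i j.1), ∑ f : Fin (fNum C j.1 i),
      (shiftX K C D Ω M i ^ (f : ℕ)) (incX K C D Ω M hΩ j g (m j g f)) = m := by
  have key : ∀ (j : Nb Ω i) (g : Fin (gNum C i j.1)) (f : Fin (fNum C j.1 i)),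
      (shiftX K C D Ω M i ^ f.1) (incX K C D Ω M hΩ j g (m j g f)) =
      Pi.single j (Pi.single g (Pi.single f (m j g f))) := by
    intro j g ⟨f, hf⟩
    funext j' g'
    rw [shiftX_pow_apply]
    by_cases hj : j' = j
    · subst hj
      by_cases hg : g' = g
      · subst hg
        simp only [incX_apply, Pi.single_eq_same]
        exact shiftEnd_pow_single _ f hf _
      · simp [incX_apply, Pi.single_eq_of_ne hg]
    · simp [incX_apply, Pi.single_eq_of_ne hj]
  simp only [key]
  let S (j : Nb Ω i) := AddMonoidHom.single
    (fun j : Nb Ω i => Fin (gNum C i j.1) → Fin (fNum C j.1 i) → vsp K C D Ω M j.1) j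
  let S' (j : Nb Ω i) (g : Fin (gNum C i j.1)) := AddMonoidHom.single
    (fun _ : Fin (gNum C i j.1) => Fin (fNum C j.1 i) → vsp K C D Ω M j.1) g
  have h1 : ∀ j g, ∑ f, Pi.single j (Pi.single g (Pi.single f (m j g f))) =
      (Pi.single j (Pi.single g (m j g)) : XSp K C D Ω M i) := fun j g => by
    have := map_sum ((S j).comp (S' j g)) (fun f => Pi.single f (m j g f)) Finset.univ
    rw [Finset.univ_sum_single] at this
    exact this.symm
  have h2 : ∀ j, ∑ g, Pi.single j (Pi.single g (m j g)) =
      (Pi.single j (m j) : XSp K C D Ω M i) := fun j => by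
    have := map_sum (S j) (fun g => Pi.single g (m j g)) Finset.univ
    rw [Finset.univ_sum_single] at this
    exact this.symm
  simp only [h1, h2]
  exact Finset.univ_sum_single m

theorem lastX_shiftX_pow {i : I} (m : XSp K C D Ω M i) (j : Nb Ω i) (g : Fin (gNum C i j.1))
    (f : Fin (fNum C j.1 i)) :
    lastX K C D Ω M hΩ j g ((shiftX K C D Ω M i ^ (fNum C j.1 i - 1 - f)) m) = m j g f := by
  obtain ⟨f, hf⟩ := f
  refine (congrFun (shiftX_pow_apply _ m j g) _).trans ?_
  have := shiftEnd_pow_apply (epsEnd K C D Ω M j.1 ^ fNum C i j.1) (fNum C j.1 i - 1 - f)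
    (m j g) f (by omega)
  convert this using 3
  omega

/-- The identity of X, decomposed in the shape of the mesh relation. Placed between an outgoing and
an incoming map, it turns the mesh sum at i into their composite. -/
theorem sum_shiftX_incX_lastX {i : I} (m : XSp K C D Ω M i) :
    ∑ j : Nb Ω i, ∑ g : Fin (gNum C i j.1), ∑ f ∈ Finset.range (fNum C j.1 i),
      (shiftX K C D Ω M i ^ f) (incX K C D Ω M hΩ j g (lastX K C D Ω M hΩ j g
        ((shiftX K C D Ω M i ^ (fNum C j.1 i - 1 - f)) m))) = m := by
  simp only [Finset.sum_range, lastX_shiftX_pow hΩ]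
  exact sum_shiftX_incX hΩ m

omit hΩ

/-! ### Vertices without socle -/

variable (K C D Ω M) in
/-- There is no submodule of `M` isomorphic to `S_i`. -/
def NoSoc (i : I) : Prop :=
  ∀ x : M, (gen (.e i) : 𝒫) • x = x → (gen (.eps i) : 𝒫) • x = 0 →
    (∀ j h g, (gen (.arr j i h g) : 𝒫) • x = 0) → x = 0

include hΩ in
-- The kernel of the outgoing map is stable under ε_i, which is nilpotent. The last nonzero ε_i^n m
-- is killed by ε_i and, by its last coefficients under the outgoing map, by every arrow leaving i;
-- so it would span a copy of S_i.
theorem NoSoc.outX_injective {i : I} (h : NoSoc K C D Ω M i) {m : M}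
    (hm : (gen (.e i) : 𝒫) • m = m) (h0 : outX K C D Ω M i m = 0) : m = 0 := by
  by_contra hne
  have hex : ∃ n, (gen (.eps i) ^ n : 𝒫) • m = 0 := ⟨D i, eps_pow_smul_zero i m⟩
  classical
  obtain ⟨n, hn⟩ : ∃ n, Nat.find hex = n + 1 := Nat.exists_eq_succ_of_ne_zero fun h0 => hne (by
    have := Nat.find_spec hex
    rw [h0] at this
    simpa using this)
  have hpow : ∀ k, outX K C D Ω M i ((gen (.eps i) ^ k : 𝒫) • m) = 0 := fun k => by
    induction k with
    | zero => simpa using h0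
    | succ k ih => rw [pow_succ', mul_smul, outX_eps, ih, map_zero]
  refine Nat.find_min hex (m := n) (by omega) (h _ (e_smul_eps_pow i n hm) ?_ fun j hj g => ?_)
  · rw [← mul_smul, ← pow_succ', ← hn]
    exact Nat.find_spec hex
  · have h1 := lastX_outX (K := K) (D := D) hΩ (⟨j, hj.symm⟩ : Nb Ω i)
      (Fin.cast (gNum_comm C j i) g) ((gen (.eps i) ^ n : 𝒫) • m)
    rw [hpow, map_zero, Submodule.coe_zero] at h1
    have h2 := congrArg (fun y => sgn K Ω i j • y) h1
    simp only [smul_zero, smul_smul, sgn_mul_self, one_smul] at h2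
    rw [h2, mul_smul]
    rfl

/-! ### Dimension and freeness of the space at a vertex -/

include hΩ in
theorem isFreeNil_shiftX (hD : IsSymmetrizer C D) {i : I}
    (h : ∀ j, j ≠ i → IsFreeNil (D j) (epsEnd K C D Ω M j)) :
    IsFreeNil (D i) (shiftX K C D Ω M i) := by
  intro k hk m hm
  have key : ∀ (j : Nb Ω i) (g : Fin (gNum C i j.1)), ∃ w,
      (shiftEnd (epsEnd K C D Ω M j.1 ^ fNum C i j.1) (fNum C j.1 i) ^ (D i - k)) w = m j g := by
    intro j g
    obtain ⟨t, ht, h1, h2⟩ := exists_symmetrizer_factor hD (hΩ.neg j.2).ne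
    refine isFreeNil_shiftEnd (hΩ.fNum_pos j) ht h1 h2 (h _ (hΩ.ne j.2)) k hk _ ?_
    rw [← shiftX_pow_apply, hm]
    rfl
  choose w hw using key
  exact ⟨w, by funext j g; rw [shiftX_pow_apply, hw]⟩

include hΩ in
theorem shiftX_pow_eq_zero (hD : IsSymmetrizer C D) (i : I) : shiftX K C D Ω M i ^ D i = 0 := by
  refine LinearMap.ext fun m => ?_
  funext j g
  obtain ⟨t, ht, h1, h2⟩ := exists_symmetrizer_factor hD (hΩ.neg j.2).ne
  rw [shiftX_pow_apply, shiftEnd_pow_eq_zero h1 h2 (epsEnd_pow_eq_zero _)]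
  rfl

/-- Each neighbour j contributes g_ij f_ji = |c_ji| copies of e_jM. -/
theorem finrank_XSp [FiniteDimensional K M] (i : I) :
    Module.finrank K (XSp K C D Ω M i) =
      ∑ j : Nb Ω i, (C j.1 i).natAbs * Module.finrank K (vsp K C D Ω M j.1) := by
  rw [Module.finrank_pi_fintype]
  refine Finset.sum_congr rfl fun j _ => ?_
  rw [Module.finrank_pi_fintype, Finset.sum_congr rfl fun _ _ => Module.finrank_pi_fintype K]
  simp only [Finset.sum_const, Finset.card_univ, Fintype.card_fin, smul_eq_mul]
  rw [← mul_assoc, gNum_comm C i j.1, gNum_mul_fNum]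

end InOut

end FramedPreprojective
end

noncomputable section

namespace FramedPreprojective

/-! ## Replacing the space at a vertex -/

section Replace

variable {K : Type u} [Field K] {I : Type w} [Fintype I] [DecidableEq I]
  {C : Matrix I I ℤ} {D : I → ℕ} {Ω : I → I → Prop}

local notation "𝒫" => Preproj K C D Ω

variable (K C D Ω) in
/-- A space `U` that can replace `e_i M` in a module `M`. -/
structure VertexData (M : Type*) [AddCommGroup M] [Module (Preproj K C D Ω) M]
    [Module K M] [IsScalarTower K (Preproj K C D Ω) M] (i : I)
    (U : Type*) [AddCommGroup U] [Module K U] where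
  orient : IsOrientation C Ω
  D_pos : ∀ j, D j ≠ 0
  eps : Module.End K U
  inn : XSp K C D Ω M i →ₗ[K] U
  out : U →ₗ[K] XSp K C D Ω M i
  eps_pow : eps ^ D i = 0
  inn_shift : ∀ m, inn (shiftX K C D Ω M i m) = eps (inn m)
  out_eps : ∀ u, out (eps u) = shiftX K C D Ω M i (out u)
  inn_out : ∀ u, inn (out u) = 0
  out_inn : ∀ m, out (inn m) = outX K C D Ω M i (inX K C D Ω M i m)

namespace VertexData

variable {M : Type*} [AddCommGroup M] [Module (Preproj K C D Ω) M]
  [Module K M] [IsScalarTower K (Preproj K C D Ω) M] {i : I}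
  {U : Type*} [AddCommGroup U] [Module K U] (d : VertexData K C D Ω M i U)

/-- The module obtained from `M` by replacing `e_i M` with `U`. -/
@[nolint unusedArguments]
def Space (_ : VertexData K C D Ω M i U) : Type _ :=
  LinearMap.ker (Algebra.lsmul K K M (gen (.e i) : 𝒫)) × U

instance : AddCommGroup d.Space :=
  inferInstanceAs (AddCommGroup (LinearMap.ker (Algebra.lsmul K K M (gen (.e i) : 𝒫)) × U))

instance : Module K d.Space :=
  inferInstanceAs (Module K (LinearMap.ker (Algebra.lsmul K K M (gen (.e i) : 𝒫)) × U))

instance [FiniteDimensional K M] [FiniteDimensional K U] : FiniteDimensional K d.Space :=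
  inferInstanceAs (Module.Finite K (LinearMap.ker (Algebra.lsmul K K M (gen (.e i) : 𝒫)) × U))

/-- The projection from the new module to the old one, with image `(1 - e_i) M`. -/
def old : d.Space →ₗ[K] M := Submodule.subtype _ ∘ₗ LinearMap.fst K _ _

/-- The projection to the new space at the vertex. -/
def new : d.Space →ₗ[K] U := LinearMap.snd K _ _

/-- The map from the old module to the new one, with kernel `e_i M`. -/
def ofOld : M →ₗ[K] d.Space :=
  LinearMap.inl K _ _ ∘ₗ LinearMap.codRestrict _
    (LinearMap.id - Algebra.lsmul K K M (gen (.e i) : 𝒫)) fun m => by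
    simp [LinearMap.mem_ker, smul_sub, e_smul_e]

/-- The inclusion of the new space at the vertex. -/
def ofNew : U →ₗ[K] d.Space := LinearMap.inr K _ _

@[simp] theorem new_ofNew (u : U) : d.new (d.ofNew u) = u := rfl
@[simp] theorem new_ofOld (m : M) : d.new (d.ofOld m) = 0 := rfl
@[simp] theorem old_ofNew (u : U) : d.old (d.ofNew u) = 0 := rfl
@[simp] theorem old_ofOld (m : M) : d.old (d.ofOld m) = m - (gen (.e i) : 𝒫) • m := rfl

theorem e_smul_old (z : d.Space) : (gen (.e i) : 𝒫) • d.old z = 0 :=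
  LinearMap.mem_ker.1 (Prod.fst z).2

theorem ext_iff {z z' : d.Space} : z = z' ↔ d.old z = d.old z' ∧ d.new z = d.new z' :=
  ⟨fun h => by rw [h]; exact ⟨rfl, rfl⟩, fun h => Prod.ext (Subtype.ext h.1) h.2⟩

theorem ofOld_old_add_ofNew_new (z : d.Space) : d.ofOld (d.old z) + d.ofNew (d.new z) = z := by
  rw [ext_iff]
  simp [e_smul_old]

theorem ofOld_e (m : M) : d.ofOld ((gen (.e i) : 𝒫) • m) = 0 := by
  rw [ext_iff]
  simp [e_smul_e]

theorem hom_ext {A : Type*} [AddCommGroup A] [Module K A] {f g : d.Space →ₗ[K] A}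
    (h1 : ∀ m, f (d.ofOld m) = g (d.ofOld m)) (h2 : ∀ u, f (d.ofNew u) = g (d.ofNew u)) :
    f = g := by
  ext z
  rw [← d.ofOld_old_add_ofNew_new z, map_add, map_add, h1, h2]

variable (K C D Ω M) in
/-- The projection of `M` onto `e_k M`. -/
def _root_.FramedPreprojective.projV (k : I) : M →ₗ[K] vsp K C D Ω M k :=
  LinearMap.codRestrict _ (Algebra.lsmul K K M (gen (.e k) : 𝒫)) fun m => e_smul_e k m

@[simp] theorem _root_.FramedPreprojective.coe_projV (k : I) (m : M) :
    (projV K C D Ω M k m : M) = (gen (.e k) : 𝒫) • m := rfl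

/-- The arrows into the vertex. -/
def arrIn (k : I) (h : Ω i k ∨ Ω k i) (g : Fin (gNum C i k)) : Module.End K d.Space :=
  d.ofNew ∘ₗ d.inn ∘ₗ incX K C D Ω M d.orient ⟨k, h⟩ g ∘ₗ projV K C D Ω M k ∘ₗ d.old

/-- The arrows out of the vertex. -/
def arrOut (k : I) (h : Ω k i ∨ Ω i k) (g : Fin (gNum C k i)) : Module.End K d.Space :=
  sgn K Ω i k • (d.ofOld ∘ₗ (vsp K C D Ω M k).subtype ∘ₗ
    lastX K C D Ω M d.orient ⟨k, h.symm⟩ (Fin.cast (gNum_comm C k i) g) ∘ₗ d.out ∘ₗ d.new)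

/-- The action of the generators on the new module. -/
def genMap : Gen C Ω → Module.End K d.Space
  | .e j => if j = i then d.ofNew ∘ₗ d.new
      else d.ofOld ∘ₗ Algebra.lsmul K K M (gen (.e j) : 𝒫) ∘ₗ d.old
  | .eps j => if j = i then d.ofNew ∘ₗ d.eps ∘ₗ d.new
      else d.ofOld ∘ₗ Algebra.lsmul K K M (gen (.eps j) : 𝒫) ∘ₗ d.old
  | .arr j k h g =>
      if hj : j = i then by cases hj; exact d.arrIn k h g
      else if hk : k = i then by cases hk; exact d.arrOut j h g
      else d.ofOld ∘ₗ Algebra.lsmul K K M (gen (.arr j k h g) : 𝒫) ∘ₗ d.old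

theorem genMap_e_old (j : I) (m : M) :
    d.genMap (.e j) (d.ofOld m) = d.ofOld ((gen (.e j) : 𝒫) • m) := by
  by_cases h : j = i
  · subst h; simp [genMap, ofOld_e]
  · simp [genMap, h, smul_sub, e_smul_e_ne h]

theorem genMap_e_self_new (u : U) : d.genMap (.e i) (d.ofNew u) = d.ofNew u := by
  simp [genMap]

theorem genMap_e_new {j : I} (h : j ≠ i) (u : U) : d.genMap (.e j) (d.ofNew u) = 0 := by
  simp [genMap, h]

theorem genMap_eps_old (j : I) (m : M) :
    d.genMap (.eps j) (d.ofOld m) = d.ofOld ((gen (.eps j) : 𝒫) • m) := by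
  by_cases h : j = i
  · subst h; rw [← e_smul_eps, ofOld_e]; simp [genMap]
  · simp [genMap, h, smul_sub, eps_smul_e_ne h]

theorem genMap_eps_self_new (u : U) : d.genMap (.eps i) (d.ofNew u) = d.ofNew (d.eps u) := by
  simp [genMap]

theorem genMap_eps_new {j : I} (h : j ≠ i) (u : U) : d.genMap (.eps j) (d.ofNew u) = 0 := by
  simp [genMap, h]

theorem genMap_arr_old {j k : I} (hj : j ≠ i) (h : Ω j k ∨ Ω k j) (g : Fin (gNum C j k)) (m : M)
    (hk : k ≠ i) :
    d.genMap (.arr j k h g) (d.ofOld m) = d.ofOld ((gen (.arr j k h g) : 𝒫) • m) := by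
  simp [genMap, hj, hk, smul_sub, arr_smul_e_ne _ hk]

theorem genMap_arr_new {j k : I} (h : Ω j k ∨ Ω k j) (g : Fin (gNum C j k)) (u : U)
    (hk : k ≠ i) : d.genMap (.arr j k h g) (d.ofNew u) = 0 := by
  by_cases hj : j = i
  · subst hj; simp [genMap, arrIn]
  · simp [genMap, hj, hk]

theorem genMap_arrIn_old (k : I) (h : Ω i k ∨ Ω k i) (g : Fin (gNum C i k)) (m : M) :
    d.genMap (.arr i k h g) (d.ofOld m) =
      d.ofNew (d.inn (incX K C D Ω M d.orient ⟨k, h⟩ g (projV K C D Ω M k m))) := by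
  have : projV K C D Ω M k (m - (gen (.e i) : 𝒫) • m) = projV K C D Ω M k m :=
    Subtype.ext (by simp [e_smul_e_ne (d.orient.ne h)])
  simp only [genMap, dif_pos, arrIn, LinearMap.comp_apply, old_ofOld, this]

theorem genMap_arrOut_old (k : I) (h : Ω k i ∨ Ω i k) (g : Fin (gNum C k i)) (m : M) :
    d.genMap (.arr k i h g) (d.ofOld m) = 0 := by
  have hk : k ≠ i := d.orient.ne h.symm
  simp [genMap, dif_neg hk, arrOut]

theorem genMap_arrOut_new (k : I) (h : Ω k i ∨ Ω i k) (g : Fin (gNum C k i)) (u : U) :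
    d.genMap (.arr k i h g) (d.ofNew u) = sgn K Ω i k • d.ofOld (lastX K C D Ω M d.orient
      ⟨k, h.symm⟩ (Fin.cast (gNum_comm C k i) g) (d.out u)) := by
  have hk : k ≠ i := d.orient.ne h.symm
  simp [genMap, dif_neg hk, arrOut]

theorem genMap_eps_pow_old (j : I) (n : ℕ) (m : M) :
    (d.genMap (.eps j) ^ n) (d.ofOld m) = d.ofOld ((gen (.eps j) ^ n : 𝒫) • m) := by
  induction n generalizing m with
  | zero => simp
  | succ n ih => rw [pow_succ, Module.End.mul_apply, genMap_eps_old, ih, pow_succ, mul_smul]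

theorem genMap_eps_pow_self_new (n : ℕ) (u : U) :
    (d.genMap (.eps i) ^ n) (d.ofNew u) = d.ofNew ((d.eps ^ n) u) := by
  induction n generalizing u with
  | zero => simp
  | succ n ih =>
    rw [pow_succ, Module.End.mul_apply, genMap_eps_self_new, ih, pow_succ, Module.End.mul_apply]

theorem genMap_eps_pow_new {j : I} (hj : j ≠ i) (n : ℕ) (u : U) :
    (d.genMap (.eps j) ^ n) (d.ofNew u) = if n = 0 then d.ofNew u else 0 := by
  cases n with
  | zero => simp
  | succ n => simp [pow_succ, genMap_eps_new d hj]

theorem genMap_eps_pow_self_old (n : ℕ) (m : M) :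
    (d.genMap (.eps i) ^ n) (d.ofOld m) = if n = 0 then d.ofOld m else 0 := by
  cases n with
  | zero => simp
  | succ n =>
    rw [pow_succ, Module.End.mul_apply, genMap_eps_old, ← e_smul_eps, ofOld_e, map_zero]; simp

/-- The paths of length two through a vertex act on the new module as on the old one. -/
theorem genMap_arr_arr_old {k : I} (hk : k ≠ i) (j : I) (h : Ω k j ∨ Ω j k)
    (g : Fin (gNum C k j)) (m : M) :
    d.genMap (.arr k j h g) (d.genMap (.arr j k h.symm (Fin.cast (gNum_comm C k j) g))
      (d.ofOld m)) = d.ofOld ((gen (.arr k j h g) : 𝒫) •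
        (gen (.arr j k h.symm (Fin.cast (gNum_comm C k j) g)) : 𝒫) • m) := by
  by_cases hj : j = i
  · subst hj
    rw [genMap_arrIn_old, genMap_arrOut_new, d.out_inn, inX_incX, lastX_outX, map_smul,
      smul_smul, sgn_mul_self, one_smul, coe_projV, arr_smul_e]
    rfl
  · rw [genMap_arr_old d hj _ _ _ hk, genMap_arr_old d hk _ _ _ hj]

theorem lift_mesh {A : Type*} [Ring A] [Algebra K A] (F : Gen C Ω → A) (k : I) :
    FreeAlgebra.lift K F (mesh K C Ω k) =
      ∑ j : Nb Ω k, ∑ g : Fin (gNum C k j.1), ∑ f ∈ Finset.range (fNum C j.1 k),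
        sgn K Ω k j.1 • (F (.eps k) ^ f * F (.arr k j.1 j.2 g) *
          F (.arr j.1 k j.2.symm (Fin.cast (gNum_comm C k j.1) g)) *
          F (.eps k) ^ (fNum C j.1 k - 1 - f)) := by
  classical
  rw [mesh, sum_dite_eq_sum_nb k (A := FreeAlgebra K (Gen C Ω))]
  simp

/-- The mesh relation at another vertex meets the new space only through paths k → i → k, and the
condition `out_inn` says that these act as before. -/
theorem genMap_mesh_ne {k : I} (hk : k ≠ i) :
    FreeAlgebra.lift K d.genMap (mesh K C Ω k) = 0 := by
  rw [lift_mesh]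
  refine d.hom_ext (fun m => ?_) fun u => ?_
  · simp only [LinearMap.sum_apply, LinearMap.smul_apply, Module.End.mul_apply,
      genMap_eps_pow_old d, genMap_arr_arr_old d hk, ← map_smul, ← map_sum,
      LinearMap.zero_apply]
    rw [mesh_smul, map_zero]
  · simp only [LinearMap.sum_apply, LinearMap.smul_apply, Module.End.mul_apply,
      genMap_eps_pow_new d hk, LinearMap.zero_apply]
    refine Finset.sum_eq_zero fun j _ => Finset.sum_eq_zero fun g _ =>
      Finset.sum_eq_zero fun f _ => ?_
    split_ifs
    · rw [genMap_arr_new d _ _ _ hk, map_zero, map_zero, smul_zero]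
    · rw [map_zero, map_zero, map_zero, smul_zero]

/-- The two signs attached to an arrow pair cancel, and `sum_shiftX_incX_lastX` reduces the sum to
`inn` ∘ `out`, which is zero by assumption. -/
theorem genMap_mesh_self : FreeAlgebra.lift K d.genMap (mesh K C Ω i) = 0 := by
  rw [lift_mesh]
  refine d.hom_ext (fun m => ?_) fun u => ?_
  · simp only [LinearMap.sum_apply, LinearMap.smul_apply, Module.End.mul_apply,
      genMap_eps_pow_self_old, LinearMap.zero_apply]
    refine Finset.sum_eq_zero fun j _ => Finset.sum_eq_zero fun g _ =>
      Finset.sum_eq_zero fun f _ => ?_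
    split_ifs
    · rw [genMap_arrOut_old, map_zero, map_zero, smul_zero]
    · rw [map_zero, map_zero, map_zero, smul_zero]
  · have key : ∀ (j : Nb Ω i) (g : Fin (gNum C i j.1)) (n f : ℕ),
        sgn K Ω i j.1 • (d.genMap (.eps i) ^ f) (d.genMap (.arr i j.1 j.2 g)
          (d.genMap (.arr j.1 i j.2.symm (Fin.cast (gNum_comm C i j.1) g))
            ((d.genMap (.eps i) ^ n) (d.ofNew u)))) =
        d.ofNew (d.inn ((shiftX K C D Ω M i ^ f) (incX K C D Ω M d.orient j g
          (lastX K C D Ω M d.orient j g ((shiftX K C D Ω M i ^ n) (d.out u)))))) := by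
      intro j g n f
      have hp : ∀ x : vsp K C D Ω M j.1, projV K C D Ω M j.1 x = x := fun x =>
        Subtype.ext (e_smul_coe x)
      rw [genMap_eps_pow_self_new, genMap_arrOut_new, map_smul, genMap_arrIn_old, hp,
        map_smul, genMap_eps_pow_self_new, smul_smul, sgn_mul_self, one_smul,
        map_pow_apply d.inn_shift, map_pow_apply d.out_eps]
      rfl
    simp only [LinearMap.sum_apply, LinearMap.smul_apply, Module.End.mul_apply, key,
      LinearMap.zero_apply, ← map_sum]
    rw [sum_shiftX_incX_lastX, d.inn_out, map_zero]

theorem genMap_rel ⦃x y : FreeAlgebra K (Gen C Ω)⦄ (h : Rel K C D Ω x y) :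
    FreeAlgebra.lift K d.genMap x = FreeAlgebra.lift K d.genMap y := by
  induction h with
  | e_mul_self j =>
    simp only [map_mul, FreeAlgebra.lift_ι_apply]
    refine d.hom_ext (fun m => ?_) fun u => ?_
    · simp only [Module.End.mul_apply, genMap_e_old, e_smul_e]
    · by_cases hj : j = i
      · subst hj; simp only [Module.End.mul_apply, genMap_e_self_new]
      · simp only [Module.End.mul_apply, genMap_e_new d hj, map_zero]
  | e_mul_ne j k hjk =>
    simp only [map_mul, FreeAlgebra.lift_ι_apply, map_zero]
    refine d.hom_ext (fun m => ?_) fun u => ?_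
    · simp only [Module.End.mul_apply, genMap_e_old, e_smul_e_ne hjk, map_zero,
        LinearMap.zero_apply]
    · by_cases hk : k = i
      · subst hk
        simp only [Module.End.mul_apply, genMap_e_self_new, genMap_e_new d hjk,
          LinearMap.zero_apply]
      · simp only [Module.End.mul_apply, genMap_e_new d hk, map_zero, LinearMap.zero_apply]
  | e_sum =>
    simp only [map_sum, FreeAlgebra.lift_ι_apply, map_one]
    refine d.hom_ext (fun m => ?_) fun u => ?_
    · simp only [LinearMap.sum_apply, genMap_e_old, ← map_sum, sum_e_smul, Module.End.one_apply]
    · rw [LinearMap.sum_apply, Finset.sum_eq_single i]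
      · simp only [genMap_e_self_new, Module.End.one_apply]
      · exact fun j _ hj => genMap_e_new d hj u
      · simp
  | e_eps j =>
    simp only [map_mul, FreeAlgebra.lift_ι_apply]
    refine d.hom_ext (fun m => ?_) fun u => ?_
    · simp only [Module.End.mul_apply, genMap_e_old, genMap_eps_old, e_smul_eps]
    · by_cases hj : j = i
      · subst hj; simp only [Module.End.mul_apply, genMap_e_self_new, genMap_eps_self_new]
      · simp only [Module.End.mul_apply, genMap_eps_new d hj, map_zero]
  | eps_e j =>
    simp only [map_mul, FreeAlgebra.lift_ι_apply]
    refine d.hom_ext (fun m => ?_) fun u => ?_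
    · simp only [Module.End.mul_apply, genMap_e_old, genMap_eps_old, eps_smul_e]
    · by_cases hj : j = i
      · subst hj; simp only [Module.End.mul_apply, genMap_e_self_new, genMap_eps_self_new]
      · simp only [Module.End.mul_apply, genMap_eps_new d hj, genMap_e_new d hj, map_zero]
  | e_arr j k h g =>
    simp only [map_mul, FreeAlgebra.lift_ι_apply]
    have hjk := d.orient.ne h
    refine d.hom_ext (fun m => ?_) fun u => ?_
    · by_cases hj : j = i
      · subst hj
        simp only [Module.End.mul_apply, genMap_arrIn_old, genMap_e_self_new]
      · by_cases hk : k = i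
        · subst hk
          simp only [Module.End.mul_apply, genMap_arrOut_old, map_zero]
        · simp only [Module.End.mul_apply, genMap_arr_old d hj _ _ _ hk, genMap_e_old, e_smul_arr]
    · by_cases hk : k = i
      · subst hk
        simp only [Module.End.mul_apply, genMap_arrOut_new, map_smul, genMap_e_old, e_smul_coe]
      · simp only [Module.End.mul_apply, genMap_arr_new d _ _ _ hk, map_zero]
  | arr_e j k h g =>
    simp only [map_mul, FreeAlgebra.lift_ι_apply]
    have hjk := d.orient.ne h
    refine d.hom_ext (fun m => ?_) fun u => ?_
    · simp only [Module.End.mul_apply, genMap_e_old]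
      by_cases hj : j = i
      · subst hj
        have hp : projV K C D Ω M k ((gen (.e k) : 𝒫) • m) = projV K C D Ω M k m :=
          Subtype.ext (e_smul_e k m)
        simp only [genMap_arrIn_old, hp]
      · by_cases hk : k = i
        · subst hk
          simp only [genMap_arrOut_old]
        · simp only [genMap_arr_old d hj _ _ _ hk, arr_smul_e]
    · by_cases hk : k = i
      · subst hk
        simp only [Module.End.mul_apply, genMap_e_self_new]
      · simp only [Module.End.mul_apply, genMap_arr_new d _ _ _ hk, genMap_e_new d hk, map_zero]
  | P1 j =>
    simp only [map_pow, FreeAlgebra.lift_ι_apply, map_zero]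
    refine d.hom_ext (fun m => ?_) fun u => ?_
    · by_cases hj : j = i
      · subst hj
        rw [genMap_eps_pow_self_old]
        split_ifs with h0
        · have := eps_pow_smul_zero (K := K) (C := C) (D := D) (Ω := Ω) j m
          rw [h0, pow_zero, one_smul] at this
          rw [this, map_zero]; rfl
        · rfl
      · rw [genMap_eps_pow_old d, eps_pow_smul_zero, map_zero]; rfl
    · by_cases hj : j = i
      · subst hj
        rw [genMap_eps_pow_self_new, d.eps_pow]; simp
      · rw [genMap_eps_pow_new d hj]
        rw [if_neg (d.D_pos j)]; rfl
  | P2 j k h g =>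
    simp only [map_mul, map_pow, FreeAlgebra.lift_ι_apply]
    have hjk := d.orient.ne h
    have hf1 : fNum C j k ≠ 0 := (d.orient.fNum_pos (⟨j, h.symm⟩ : Nb Ω k)).ne'
    have hf2 : fNum C k j ≠ 0 := (d.orient.fNum_pos (⟨k, h⟩ : Nb Ω j)).ne'
    refine d.hom_ext (fun m => ?_) fun u => ?_
    · simp only [Module.End.mul_apply]
      by_cases hj : j = i
      · subst hj
        have hp : projV K C D Ω M k ((gen (.eps k) ^ fNum C j k : 𝒫) • m) =
            (epsEnd K C D Ω M k ^ fNum C j k) (projV K C D Ω M k m) :=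
          Subtype.ext (by rw [coe_epsEnd_pow, coe_projV, coe_projV, eps_pow_smul_e])
        rw [genMap_eps_pow_old d, genMap_arrIn_old, genMap_arrIn_old,
          genMap_eps_pow_self_new, hp]
        have := incX_eps (K := K) (D := D) d.orient (⟨k, h⟩ : Nb Ω j) g (projV K C D Ω M k m)
        rw [this, map_pow_apply d.inn_shift]
      · by_cases hk : k = i
        · subst hk
          rw [genMap_arrOut_old, genMap_eps_pow_self_old, if_neg hf1, map_zero, map_zero]
        · rw [genMap_eps_pow_old d, genMap_arr_old d hj _ _ _ hk,
            genMap_arr_old d hj _ _ _ hk, genMap_eps_pow_old d, eps_pow_smul_arr]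
    · simp only [Module.End.mul_apply]
      by_cases hk : k = i
      · subst hk
        rw [genMap_arrOut_new, genMap_eps_pow_self_new, genMap_arrOut_new, map_smul,
          genMap_eps_pow_old d, map_pow_apply d.out_eps]
        have := lastX_shiftX (K := K) (D := D) d.orient (⟨j, h.symm⟩ : Nb Ω k)
          (Fin.cast (gNum_comm C j k) g) (d.out u)
        rw [this, coe_epsEnd_pow]
      · rw [genMap_arr_new d _ _ _ hk, genMap_eps_pow_new d hk, if_neg hf1, map_zero, map_zero]
  | P3 j =>
    rw [map_zero]
    by_cases hj : j = i
    · subst hj; exact d.genMap_mesh_self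
    · exact d.genMap_mesh_ne hj

instance : Module 𝒫 d.Space := Module.compHom d.Space (Preproj.lift d.genMap d.genMap_rel).toRingHom

theorem smul_def (a : 𝒫) (z : d.Space) : a • z = Preproj.lift d.genMap d.genMap_rel a z := rfl

theorem gen_smul (x : Gen C Ω) (z : d.Space) : (gen x : 𝒫) • z = d.genMap x z := by
  rw [smul_def, Preproj.lift_gen]

instance : IsScalarTower K 𝒫 d.Space :=
  IsScalarTower.of_algebraMap_smul fun r z => by
    rw [smul_def, AlgHom.commutes, Module.algebraMap_end_apply]

end VertexData

end Replace

end FramedPreprojective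
end

noncomputable section

namespace FramedPreprojective

/-! ## Modules that agree away from a vertex -/

section SameOff

variable {K : Type u} [Field K] {I : Type w} [Fintype I] [DecidableEq I]
  {C : Matrix I I ℤ} {D : I → ℕ} {Ω : I → I → Prop}

local notation "𝒫" => Preproj K C D Ω

variable {M : Type*} [AddCommGroup M] [Module (Preproj K C D Ω) M]
  [Module K M] [IsScalarTower K (Preproj K C D Ω) M]
  {N : Type*} [AddCommGroup N] [Module (Preproj K C D Ω) N]
  [Module K N] [IsScalarTower K (Preproj K C D Ω) N]
  {L : Type*} [AddCommGroup L] [Module (Preproj K C D Ω) L]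
  [Module K L] [IsScalarTower K (Preproj K C D Ω) L]

variable (C D Ω) in
/-- The map induced on the spaces `⨁_j (_i H_j ⊗ e_j M)`. -/
def mapX (i : I) (F : M →ₗ[K] N) : XSp K C D Ω M i →ₗ[K] XSp K C D Ω N i where
  toFun x := fun j g f => projV K C D Ω N j.1 (F (x j g f))
  map_add' x y := by funext j g f; simp
  map_smul' r x := by funext j g f; simp

theorem coe_mapX {i : I} (F : M →ₗ[K] N) (x : XSp K C D Ω M i) (j : Nb Ω i)
    (g : Fin (gNum C i j.1)) (f : Fin (fNum C j.1 i)) :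
    (mapX C D Ω i F x j g f : N) = (gen (.e j.1) : 𝒫) • F (x j g f) := rfl

theorem mapX_incX (hΩ : IsOrientation C Ω) {i : I} {F : M →ₗ[K] N} (j : Nb Ω i)
    (g : Fin (gNum C i j.1)) (m : vsp K C D Ω M j.1) :
    mapX C D Ω i F (incX K C D Ω M hΩ j g m) =
      incX K C D Ω N hΩ j g (projV K C D Ω N j.1 (F m)) := by
  funext j' g' f
  refine Subtype.ext ?_
  rw [coe_mapX, incX_apply, incX_apply]
  by_cases hj : j' = j
  · subst hj
    by_cases hg : g' = g
    · subst hg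
      by_cases hf : f = ⟨0, hΩ.fNum_pos j'⟩
      · subst hf
        simp only [Pi.single_eq_same, coe_projV]
      · simp [Pi.single_eq_of_ne hf]
    · simp [Pi.single_eq_of_ne hg]
  · simp [Pi.single_eq_of_ne hj]

variable (C D Ω) in
/-- Linear maps compatible with the action of all generators not involving the vertex `i`, and with
the paths of length two through `i`. -/
structure OffHom (i : I) (F : M →ₗ[K] N) : Prop where
  e : ∀ j ≠ i, ∀ m, F ((gen (.e j) : 𝒫) • m) = (gen (.e j) : 𝒫) • F m
  e_self : ∀ m, F ((gen (.e i) : 𝒫) • m) = 0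
  eps : ∀ j ≠ i, ∀ m, F ((gen (.eps j) : 𝒫) • m) = (gen (.eps j) : 𝒫) • F m
  arr : ∀ j ≠ i, ∀ k ≠ i, ∀ h g m,
    F ((gen (.arr j k h g) : 𝒫) • m) = (gen (.arr j k h g) : 𝒫) • F m
  phi : ∀ x, mapX C D Ω i F (outX K C D Ω M i (inX K C D Ω M i x)) =
    outX K C D Ω N i (inX K C D Ω N i (mapX C D Ω i F x))

theorem OffHom.e_smul {i : I} {F : M →ₗ[K] N} (hF : OffHom C D Ω i F) (m : M) :
    (gen (.e i) : 𝒫) • F m = 0 := by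
  conv_lhs => rw [← sum_e_smul (K := K) (C := C) (D := D) (Ω := Ω) m, map_sum, Finset.smul_sum]
  refine Finset.sum_eq_zero fun j _ => ?_
  by_cases hj : j = i
  · subst hj; rw [hF.e_self, smul_zero]
  · rw [hF.e j hj, e_smul_e_ne (Ne.symm hj)]

theorem mapX_comp {i : I} (hΩ : IsOrientation C Ω) {F : M →ₗ[K] N} (G : N →ₗ[K] L)
    (hF : OffHom C D Ω i F) (x : XSp K C D Ω M i) :
    mapX C D Ω i (G ∘ₗ F) x = mapX C D Ω i G (mapX C D Ω i F x) := by
  funext j g f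
  refine Subtype.ext ?_
  rw [coe_mapX, coe_mapX, coe_mapX, ← hF.e _ (hΩ.ne j.2), e_smul_coe]
  rfl

theorem OffHom.comp {i : I} (hΩ : IsOrientation C Ω) {F : M →ₗ[K] N} {G : N →ₗ[K] L}
    (hF : OffHom C D Ω i F) (hG : OffHom C D Ω i G) : OffHom C D Ω i (G ∘ₗ F) where
  e j hj m := by simp [hF.e j hj, hG.e j hj]
  e_self m := by simp [hF.e_self]
  eps j hj m := by simp [hF.eps j hj, hG.eps j hj]
  arr j hj k hk h g m := by simp [hF.arr j hj k hk, hG.arr j hj k hk]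
  phi x := by rw [mapX_comp hΩ G hF, mapX_comp hΩ G hF, hF.phi, hG.phi]

variable (K C D Ω M N) in
/-- The modules `M` and `N` agree away from the vertex `i`. -/
def SameOff (i : I) : Prop :=
  ∃ (F : M →ₗ[K] N) (G : N →ₗ[K] M), OffHom C D Ω i F ∧ OffHom C D Ω i G ∧
    (∀ m, (gen (.e i) : 𝒫) • m = 0 → G (F m) = m) ∧
    (∀ n, (gen (.e i) : 𝒫) • n = 0 → F (G n) = n)

theorem SameOff.symm {i : I} (h : SameOff K C D Ω M N i) : SameOff K C D Ω N M i := by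
  obtain ⟨F, G, hF, hG, h1, h2⟩ := h
  exact ⟨G, F, hG, hF, h2, h1⟩

theorem SameOff.trans (hΩ : IsOrientation C Ω) {i : I} (h : SameOff K C D Ω M N i)
    (h' : SameOff K C D Ω N L i) : SameOff K C D Ω M L i := by
  obtain ⟨F, G, hF, hG, h1, h2⟩ := h
  obtain ⟨F', G', hF', hG', h1', h2'⟩ := h'
  exact ⟨F' ∘ₗ F, G ∘ₗ G', hF.comp hΩ hF', hG'.comp hΩ hG,
    fun m hm => by simp [h1' _ (hF.e_smul m), h1 _ hm],
    fun n hn => by simp [h2 _ (hG'.e_smul n), h2' _ hn]⟩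

/-! ### Homomorphisms of modules -/

theorem mapX_outX {i : I} (T : M →ₗ[K] N)
    (hT : ∀ (a : 𝒫) m, T (a • m) = a • T m) (m : M) :
    mapX C D Ω i T (outX K C D Ω M i m) = outX K C D Ω N i (T m) := by
  funext j g f
  refine Subtype.ext ?_
  rw [coe_mapX, ← hT, e_smul_coe, coe_outX, coe_outX, map_smul, hT, hT]

theorem inX_mapX {i : I} (T : M →ₗ[K] N)
    (hT : ∀ (a : 𝒫) m, T (a • m) = a • T m) (x : XSp K C D Ω M i) :
    inX K C D Ω N i (mapX C D Ω i T x) = T (inX K C D Ω M i x) := by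
  simp only [inX_apply, coe_mapX, map_sum, hT, arr_smul_e]

variable (C D Ω) in
/-- The linear map `m ↦ T ((1 - e_i) m)`. -/
def offMap (i : I) (T : M →ₗ[K] N) : M →ₗ[K] N :=
  T ∘ₗ (LinearMap.id - Algebra.lsmul K K M (gen (.e i) : 𝒫))

theorem offMap_apply (i : I) (T : M →ₗ[K] N) (m : M) :
    offMap C D Ω i T m = T (m - (gen (.e i) : 𝒫) • m) := rfl

theorem offHom_offMap {i : I} (hΩ : IsOrientation C Ω) (T : M →ₗ[K] N)
    (hT : ∀ (a : 𝒫) m, T (a • m) = a • T m) : OffHom C D Ω i (offMap C D Ω i T) := by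
  have hX : ∀ x, mapX C D Ω i (offMap C D Ω i T) x = mapX C D Ω i T x := fun x => by
    funext j g f
    refine Subtype.ext ?_
    rw [coe_mapX, coe_mapX, offMap_apply, e_smul_coe_ne (hΩ.ne j.2).symm, sub_zero]
  refine ⟨fun j hj m => ?_, fun m => ?_, fun j hj m => ?_, fun j hj k hk h g m => ?_, fun x => ?_⟩
  · simp only [offMap_apply, ← hT, smul_sub, e_smul_e_ne hj, e_smul_e_ne (Ne.symm hj)]
  · simp only [offMap_apply, e_smul_e, sub_self, map_zero]
  · simp only [offMap_apply, ← hT, smul_sub, eps_smul_e_ne hj, e_smul_eps_ne (Ne.symm hj)]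
  · simp only [offMap_apply, ← hT, smul_sub, arr_smul_e_ne _ hk, e_smul_arr_ne (Ne.symm hj)]
  · rw [hX, hX, mapX_outX T hT, inX_mapX T hT]

theorem sameOff_of_equiv (hΩ : IsOrientation C Ω) (i : I) (T : M ≃ₗ[𝒫] N) :
    SameOff K C D Ω M N i := by
  have hT : ∀ (r : K) m, T (r • m) = r • T m := fun r m => by
    rw [← algebraMap_smul 𝒫 r m, map_smul, algebraMap_smul]
  have hT' : ∀ (r : K) m, T.symm (r • m) = r • T.symm m := fun r m => by
    rw [← algebraMap_smul 𝒫 r m, map_smul, algebraMap_smul]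
  let T1 : M →ₗ[K] N := { T with map_smul' := hT }
  let T2 : N →ₗ[K] M := { T.symm with map_smul' := hT' }
  refine ⟨offMap C D Ω i T1, offMap C D Ω i T2, offHom_offMap hΩ _ fun a m => map_smul T a m,
    offHom_offMap hΩ _ fun a m => map_smul T.symm a m, fun m hm => ?_, fun m hm => ?_⟩
  · have : (gen (.e i) : 𝒫) • T m = 0 := by rw [← map_smul, hm, map_zero]
    rw [offMap_apply, offMap_apply, hm, sub_zero]
    change T.symm (T m - (gen (.e i) : 𝒫) • T m) = m
    rw [this, sub_zero, T.symm_apply_apply]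
  · have : (gen (.e i) : 𝒫) • T.symm m = 0 := by rw [← map_smul, hm, map_zero]
    rw [offMap_apply, offMap_apply, hm, sub_zero]
    change T (T.symm m - (gen (.e i) : 𝒫) • T.symm m) = m
    rw [this, sub_zero, T.apply_symm_apply]

/-! ### Extending a comparison away from a vertex to an isomorphism -/

/-- A comparison away from `i` which maps the image of `M` in `⨁_j (_i H_j ⊗ e_j M)` to the
corresponding image for `N` extends to a homomorphism of modules. -/
theorem OffHom.extend {i : I} (hΩ : IsOrientation C Ω) {F : M →ₗ[K] N} (hF : OffHom C D Ω i F)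
    (hN : NoSoc K C D Ω N i)
    (hr : ∀ m, ∃ n, outX K C D Ω N i n = mapX C D Ω i F (outX K C D Ω M i m)) :
    ∃ T : M →ₗ[𝒫] N, (∀ m, T m - (gen (.e i) : 𝒫) • T m = F m) ∧
      ∀ m, outX K C D Ω N i (T m) = mapX C D Ω i F (outX K C D Ω M i m) := by
  have hinj : Function.Injective (outX K C D Ω N i ∘ₗ (vsp K C D Ω N i).subtype) := by
    refine (injective_iff_map_eq_zero _).2 fun n hn => Subtype.ext ?_
    exact hN.outX_injective hΩ n.2 hn
  -- A linear left inverse of the outgoing map of N makes the solution of out(n) = F(out(m)) linear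
  -- in m. Solutions in e_iN are unique by injectivity, so compatibility with each generator can be
  -- tested after applying out.
  obtain ⟨S, hS⟩ := LinearMap.exists_leftInverse_of_injective _ (LinearMap.ker_eq_bot.2 hinj)
  have hS' : ∀ n : vsp K C D Ω N i, S (outX K C D Ω N i (n : N)) = n := fun n =>
    LinearMap.congr_fun hS n
  let A : M →ₗ[K] vsp K C D Ω N i := S ∘ₗ mapX C D Ω i F ∘ₗ outX K C D Ω M i
  have hA : ∀ m, outX K C D Ω N i (A m : N) = mapX C D Ω i F (outX K C D Ω M i m) := fun m => by
    obtain ⟨n, hn⟩ := hr m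
    have : A m = S (mapX C D Ω i F (outX K C D Ω M i m)) := rfl
    rw [this, ← hn, ← outX_e i n, ← coe_projV, hS']
  have hAu : ∀ (m : M) (n : N), (gen (.e i) : 𝒫) • n = n →
      outX K C D Ω N i n = mapX C D Ω i F (outX K C D Ω M i m) → (A m : N) = n :=
    fun m n hn h => by
      rw [← sub_eq_zero]
      refine hN.outX_injective hΩ ?_ (by rw [map_sub, hA, h, sub_self])
      rw [smul_sub, hn, e_smul_coe]
  let T : M →ₗ[K] N := F + (vsp K C D Ω N i).subtype ∘ₗ A
  have hTdef : ∀ m, T m = F m + A m := fun m => rfl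
  have hAz : ∀ m, outX K C D Ω M i m = 0 → (A m : N) = 0 := fun m hm =>
    hAu m 0 (smul_zero _) (by rw [hm, map_zero, map_zero])
  have hFo : ∀ m, outX K C D Ω N i (F m) = 0 := fun m => outX_eq_zero (hF.e_smul m)
  have hTo : ∀ m, outX K C D Ω N i (T m) = mapX C D Ω i F (outX K C D Ω M i m) := fun m => by
    rw [hTdef, map_add, hFo, zero_add, hA]
  have hgen : ∀ (x : Gen C Ω) (m : M), T ((gen x : 𝒫) • m) = (gen x : 𝒫) • T m := by
    intro x m
    rw [hTdef, hTdef, smul_add]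
    cases x with
    | e j =>
      by_cases hj : j = i
      · subst hj
        rw [hF.e_self, hF.e_smul, zero_add, zero_add, e_smul_coe]
        exact hAu _ _ (e_smul_coe _) (by rw [hA, outX_e])
      · rw [hF.e j hj, hAz _ (outX_eq_zero (e_smul_e_ne (Ne.symm hj) m)), e_smul_coe_ne hj]
    | eps j =>
      by_cases hj : j = i
      · subst hj
        have h1 : F ((gen (.eps j) : 𝒫) • m) = 0 := by rw [← e_smul_eps, hF.e_self]
        have h2 : (gen (.eps j) : 𝒫) • F m = 0 := by rw [← eps_smul_e, hF.e_smul, smul_zero]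
        rw [h1, h2, zero_add, zero_add]
        refine hAu _ _ (e_smul_eps _ _) ?_
        rw [outX_eps, outX_eps, hA]
        funext k g
        rw [shiftX_apply]
        funext f
        have hk := hΩ.ne k.2
        have hpow : ∀ (n : ℕ) (y : M), F ((gen (.eps k.1) ^ n : 𝒫) • y) =
            (gen (.eps k.1) ^ n : 𝒫) • F y := fun n y => by
          induction n generalizing y with
          | zero => simp
          | succ n ih => rw [pow_succ, mul_smul, ih, hF.eps _ hk, mul_smul]
        refine Subtype.ext ?_
        obtain ⟨f, hf⟩ := f
        rw [coe_mapX, shiftX_apply]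
        cases f with
        | zero =>
          rw [shiftEnd_zero, shiftEnd_zero, coe_epsEnd_pow, coe_epsEnd_pow, coe_mapX, hpow,
            eps_pow_smul_e]
        | succ f => rw [shiftEnd_succ _ _ _ hf, shiftEnd_succ _ _ _ hf, coe_mapX]
      · rw [hF.eps j hj, hAz _ (outX_eq_zero (e_smul_eps_ne (Ne.symm hj) m)), ← eps_smul_e j (A m : N),
          e_smul_coe_ne hj, smul_zero]
    | arr j k h g =>
      have hjk := hΩ.ne h
      by_cases hj : j = i
      · subst hj
        have h1 : F ((gen (.arr j k h g) : 𝒫) • m) = 0 := by rw [← e_smul_arr, hF.e_self]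
        have h2 : (gen (.arr j k h g) : 𝒫) • (A m : N) = 0 := by
          rw [← arr_smul_e, e_smul_coe_ne hjk, smul_zero]
        rw [h1, h2, zero_add, add_zero]
        refine hAu _ _ (e_smul_arr _ _ _ _ _) ?_
        -- For an arrow into the vertex, out of its value is out ∘ in of an elementary tensor, which
        -- F respects by `phi`.
        have h3 := inX_incX (K := K) (D := D) hΩ (⟨k, h⟩ : Nb Ω j) g (projV K C D Ω M k m)
        have h4 := inX_incX (K := K) (D := D) hΩ (⟨k, h⟩ : Nb Ω j) g (projV K C D Ω N k (F m))
        rw [coe_projV, arr_smul_e] at h3 h4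
        rw [← h3, ← h4, hF.phi]
        rw [mapX_incX]
        congr 3
        refine Subtype.ext ?_
        rw [coe_projV, coe_projV, coe_projV, hF.e k hjk, e_smul_e]
      · rw [hAz _ (outX_eq_zero (e_smul_arr_ne (Ne.symm hj) _ _ _ _)), add_zero]
        by_cases hk : k = i
        · subst hk
          have h1 : F ((gen (.arr j k h g) : 𝒫) • m) =
              (gen (.arr j k h g) : 𝒫) • (A m : N) := by
            have h3 := lastX_outX (K := K) (D := D) hΩ (⟨j, h.symm⟩ : Nb Ω k)
              (Fin.cast (gNum_comm C j k) g) m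
            have h4 := lastX_outX (K := K) (D := D) hΩ (⟨j, h.symm⟩ : Nb Ω k)
              (Fin.cast (gNum_comm C j k) g) (A m : N)
            rw [hA] at h4
            change (gen (.e j) : 𝒫) • F (lastX K C D Ω M hΩ (⟨j, h.symm⟩ : Nb Ω k)
              (Fin.cast (gNum_comm C j k) g) (outX K C D Ω M k m) : M) = _ at h4
            rw [h3, ← hF.e j hj, smul_comm, e_smul_arr, map_smul] at h4
            have h5 := congrArg (fun y => sgn K Ω k j • y) h4
            simp only [smul_smul, sgn_mul_self, one_smul] at h5
            exact h5
          have h2 : (gen (.arr j k h g) : 𝒫) • F m = 0 := by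
            rw [← arr_smul_e, hF.e_smul, smul_zero]
          rw [h1, h2, zero_add]
        · rw [hF.arr j hj k hk, ← arr_smul_e j k h g (A m : N), e_smul_coe_ne hk, smul_zero,
            add_zero]
  refine ⟨{ T with map_smul' := fun a m => map_smul_of_gen T hgen a m }, fun m => ?_, hTo⟩
  change F m + A m - (gen (.e i) : 𝒫) • (F m + A m) = F m
  rw [smul_add, hF.e_smul, e_smul_coe, zero_add, add_sub_cancel_right]

/-- If T m = 0, then F m = 0 and G ∘ F = 1 away from i put m in e_iM. Its image under out is mapped
to zero by F, hence is zero, and out is injective on e_iM. -/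
theorem OffHom.injective_of_extend {i : I} (hΩ : IsOrientation C Ω) {F : M →ₗ[K] N}
    {G : N →ₗ[K] M} (hF : OffHom C D Ω i F)
    (hGF : ∀ m, (gen (.e i) : 𝒫) • m = 0 → G (F m) = m) (hM : NoSoc K C D Ω M i)
    {T : M →ₗ[𝒫] N} (h1 : ∀ m, T m - (gen (.e i) : 𝒫) • T m = F m)
    (h2 : ∀ m, outX K C D Ω N i (T m) = mapX C D Ω i F (outX K C D Ω M i m)) :
    Function.Injective T := by
  refine (injective_iff_map_eq_zero _).2 fun m hm => ?_
  have hFm : F m = 0 := by rw [← h1, hm, smul_zero, sub_zero]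
  have he : m - (gen (.e i) : 𝒫) • m = 0 := by
    rw [← hGF (m - (gen (.e i) : 𝒫) • m) (by rw [smul_sub, e_smul_e, sub_self]), map_sub, hF.e_self,
      hFm, sub_zero, map_zero]
  refine hM.outX_injective hΩ (sub_eq_zero.1 he).symm ?_
  have h3 := h2 m
  rw [hm, map_zero] at h3
  funext j g f
  refine Subtype.ext ?_
  have h4 : (gen (.e j.1) : 𝒫) • F (outX K C D Ω M i m j g f) = 0 := by
    rw [← coe_mapX, ← h3]; rfl
  rw [← hF.e _ (hΩ.ne j.2), e_smul_coe] at h4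
  have h5 := hGF (outX K C D Ω M i m j g f) (e_smul_coe_ne (hΩ.ne j.2).symm _)
  rw [h4, map_zero] at h5
  exact h5.symm

/-- Both comparisons extend to injective homomorphisms, in opposite directions, so dimensions agree
and each is bijective. They need not be checked to be mutually inverse. -/
theorem nonempty_equiv_of_offHom [FiniteDimensional K M] [FiniteDimensional K N] {i : I}
    (hΩ : IsOrientation C Ω) {F : M →ₗ[K] N} {G : N →ₗ[K] M}
    (hF : OffHom C D Ω i F) (hG : OffHom C D Ω i G)
    (hGF : ∀ m, (gen (.e i) : 𝒫) • m = 0 → G (F m) = m)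
    (hFG : ∀ n, (gen (.e i) : 𝒫) • n = 0 → F (G n) = n)
    (hM : NoSoc K C D Ω M i) (hN : NoSoc K C D Ω N i)
    (hFr : ∀ m, ∃ n, outX K C D Ω N i n = mapX C D Ω i F (outX K C D Ω M i m))
    (hGr : ∀ n, ∃ m, outX K C D Ω M i m = mapX C D Ω i G (outX K C D Ω N i n)) :
    Nonempty (M ≃ₗ[𝒫] N) := by
  obtain ⟨T, hT1, hT2⟩ := hF.extend hΩ hN hFr
  obtain ⟨S, hS1, hS2⟩ := hG.extend hΩ hM hGr
  have hT := hF.injective_of_extend hΩ hGF hM hT1 hT2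
  have hS := hG.injective_of_extend hΩ hFG hN hS1 hS2
  have h1 := LinearMap.finrank_le_finrank_of_injective (f := T.restrictScalars K) hT
  have h2 := LinearMap.finrank_le_finrank_of_injective (f := S.restrictScalars K) hS
  have h3 := (LinearMap.injective_iff_surjective_of_finrank_eq_finrank
    (f := T.restrictScalars K) (le_antisymm h1 h2)).1 hT
  exact ⟨LinearEquiv.ofBijective T ⟨hT, h3⟩⟩

variable (K C D Ω M) in
/-- The vertex `i` does not belong to the top of `M`. -/
def InSurj (i : I) : Prop :=
  ∀ m : M, (gen (.e i) : 𝒫) • m = m → ∃ x, inX K C D Ω M i x = m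

variable (K C D Ω M) in
/-- Exactness of `e_i M → ⨁_j (_i H_j ⊗ e_j M) → e_i M`. -/
def ExactX (i : I) : Prop :=
  ∀ x, inX K C D Ω M i x = 0 → ∃ m, outX K C D Ω M i m = x

/-- When in is surjective, im(out) = im(out ∘ in), which is visible away from i. -/
theorem OffHom.outX_of_inSurj {i : I} {F : M →ₗ[K] N} (hF : OffHom C D Ω i F)
    (hM : InSurj K C D Ω M i) (m : M) :
    ∃ n, outX K C D Ω N i n = mapX C D Ω i F (outX K C D Ω M i m) := by
  obtain ⟨x, hx⟩ := hM _ (e_smul_e i m)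
  exact ⟨_, by rw [← outX_e i m, ← hx, hF.phi]⟩

/-- In N, im(out) = ker(in) = ker(out ∘ in) because out is injective, and the last kernel is visible
away from i. -/
theorem OffHom.outX_of_exactX {i : I} (hΩ : IsOrientation C Ω) {F : M →ₗ[K] N}
    (hF : OffHom C D Ω i F) (hN : NoSoc K C D Ω N i) (hN' : ExactX K C D Ω N i) (m : M) :
    ∃ n, outX K C D Ω N i n = mapX C D Ω i F (outX K C D Ω M i m) := by
  refine hN' _ (hN.outX_injective hΩ (e_smul_inX _) ?_)
  rw [← hF.phi, inX_outX, map_zero, map_zero]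

theorem SameOff.nonempty_equiv [FiniteDimensional K M] [FiniteDimensional K N] {i : I}
    (hΩ : IsOrientation C Ω) (h : SameOff K C D Ω M N i)
    (hM : NoSoc K C D Ω M i) (hN : NoSoc K C D Ω N i)
    (h' : (InSurj K C D Ω M i ∧ InSurj K C D Ω N i) ∨ (ExactX K C D Ω M i ∧ ExactX K C D Ω N i)) :
    Nonempty (M ≃ₗ[𝒫] N) := by
  obtain ⟨F, G, hF, hG, h1, h2⟩ := h
  rcases h' with ⟨h3, h4⟩ | ⟨h3, h4⟩
  · exact nonempty_equiv_of_offHom hΩ hF hG h1 h2 hM hN (hF.outX_of_inSurj h3)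
      (hG.outX_of_inSurj h4)
  · exact nonempty_equiv_of_offHom hΩ hF hG h1 h2 hM hN (hF.outX_of_exactX hΩ hN h4)
      (hG.outX_of_exactX hΩ hM h3)

end SameOff

/-! ### Socles, dimensions and local freeness after a replacement -/

section ReplaceProperties

variable {K : Type u} [Field K] {I : Type w} [Fintype I] [DecidableEq I]
  {C : Matrix I I ℤ} {D : I → ℕ} {Ω : I → I → Prop}

local notation "𝒫" => Preproj K C D Ω

variable {M : Type*} [AddCommGroup M] [Module (Preproj K C D Ω) M]
  [Module K M] [IsScalarTower K (Preproj K C D Ω) M] {i : I}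
  {U : Type*} [AddCommGroup U] [Module K U] (d : VertexData K C D Ω M i U)

namespace VertexData

theorem eps_pow_smul_ofNew (n : ℕ) (u : U) :
    (gen (.eps i) ^ n : 𝒫) • d.ofNew u = d.ofNew ((d.eps ^ n) u) := by
  induction n generalizing u with
  | zero => simp
  | succ n ih =>
    rw [pow_succ, mul_smul, gen_smul, genMap_eps_self_new, ih, pow_succ, Module.End.mul_apply]

theorem inX_mapX_ofOld (x : XSp K C D Ω M i) :
    inX K C D Ω d.Space i (mapX C D Ω i d.ofOld x) = d.ofNew (d.inn x) := by
  have key : ∀ (j : Nb Ω i) (g : Fin (gNum C i j.1)) (f : Fin (fNum C j.1 i)),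
      (gen (.eps i) ^ (f : ℕ) : 𝒫) • (gen (.arr i j.1 j.2 g) : 𝒫) •
        (mapX C D Ω i d.ofOld x j g f : d.Space) =
      d.ofNew (d.inn ((shiftX K C D Ω M i ^ (f : ℕ)) (incX K C D Ω M d.orient j g (x j g f)))) := by
    intro j g f
    have hp : projV K C D Ω M j.1 (x j g f) = x j g f := Subtype.ext (e_smul_coe _)
    rw [coe_mapX, arr_smul_e, gen_smul _ (.arr _ _ _ _), genMap_arrIn_old, hp, eps_pow_smul_ofNew,
      map_pow_apply d.inn_shift]
  rw [inX_apply]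
  simp only [key, ← map_sum]
  rw [sum_shiftX_incX]

theorem outX_ofNew (u : U) :
    outX K C D Ω d.Space i (d.ofNew u) = mapX C D Ω i d.ofOld (d.out u) := by
  funext j g f
  refine Subtype.ext ?_
  rw [coe_outX, coe_mapX, eps_pow_smul_ofNew, gen_smul, genMap_arrOut_new, smul_smul,
    sgn_mul_self, one_smul, gen_smul, genMap_e_old, e_smul_coe, map_pow_apply d.out_eps]
  exact congrArg (fun y : vsp K C D Ω M j.1 => d.ofOld (y : M))
    (lastX_shiftX_pow d.orient (d.out u) j g f)

theorem offHom_ofOld : OffHom C D Ω i d.ofOld where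
  e j _ m := by rw [gen_smul, genMap_e_old]
  e_self m := d.ofOld_e m
  eps j _ m := by rw [gen_smul, genMap_eps_old]
  arr j hj k hk h g m := by rw [gen_smul, genMap_arr_old d hj _ _ _ hk]
  phi x := by rw [inX_mapX_ofOld, outX_ofNew, d.out_inn]

theorem old_e_smul (j : I) (hj : j ≠ i) (z : d.Space) :
    d.old ((gen (.e j) : 𝒫) • z) = (gen (.e j) : 𝒫) • d.old z := by
  conv_lhs => rw [← d.ofOld_old_add_ofNew_new z]
  rw [gen_smul, map_add, genMap_e_old, genMap_e_new d hj, add_zero, old_ofOld,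
    e_smul_e_ne (Ne.symm hj), sub_zero]

theorem old_e_self_smul (z : d.Space) : d.old ((gen (.e i) : 𝒫) • z) = 0 := by
  conv_lhs => rw [← d.ofOld_old_add_ofNew_new z]
  rw [gen_smul, map_add, genMap_e_old, genMap_e_self_new, ofOld_e, zero_add, old_ofNew]

theorem ofOld_old {z : d.Space} (hz : (gen (.e i) : 𝒫) • z = 0) : d.ofOld (d.old z) = z := by
  rw [← d.ofOld_old_add_ofNew_new z, gen_smul, map_add, genMap_e_old, ofOld_e, zero_add,
    genMap_e_self_new] at hz
  conv_rhs => rw [← d.ofOld_old_add_ofNew_new z, hz, add_zero]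

theorem mapX_ofOld_mapX_old (y : XSp K C D Ω d.Space i) :
    mapX C D Ω i d.ofOld (mapX C D Ω i d.old y) = y := by
  funext j g f
  refine Subtype.ext ?_
  have hj := d.orient.ne j.2
  rw [coe_mapX, coe_mapX, ← d.old_e_smul _ hj, e_smul_coe, ofOld_old _ (e_smul_coe_ne hj.symm _),
    e_smul_coe]

theorem mapX_old_mapX_ofOld (x : XSp K C D Ω M i) :
    mapX C D Ω i d.old (mapX C D Ω i d.ofOld x) = x := by
  funext j g f
  refine Subtype.ext ?_
  have hj := d.orient.ne j.2
  rw [coe_mapX, coe_mapX, ← d.offHom_ofOld.e _ hj, e_smul_coe, old_ofOld,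
    e_smul_coe_ne hj.symm, sub_zero, e_smul_coe]

theorem offHom_old : OffHom C D Ω i d.old where
  e := d.old_e_smul
  e_self := d.old_e_self_smul
  eps j hj z := by
    conv_lhs => rw [← d.ofOld_old_add_ofNew_new z]
    rw [gen_smul, map_add, genMap_eps_old, genMap_eps_new d hj, add_zero, old_ofOld,
      e_smul_eps_ne (Ne.symm hj), sub_zero]
  arr j hj k hk h g z := by
    conv_lhs => rw [← d.ofOld_old_add_ofNew_new z]
    rw [gen_smul, map_add, genMap_arr_old d hj _ _ _ hk, genMap_arr_new d _ _ _ hk, add_zero,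
      old_ofOld, e_smul_arr_ne (Ne.symm hj), sub_zero]
  phi y := by
    conv_lhs => rw [← d.mapX_ofOld_mapX_old y, ← d.offHom_ofOld.phi, mapX_old_mapX_ofOld]

/-- Replacing the space at the vertex `i` does not change the module away from `i`. -/
theorem sameOff : SameOff K C D Ω M d.Space i :=
  ⟨d.ofOld, d.old, d.offHom_ofOld, d.offHom_old,
    fun m hm => by rw [old_ofOld, hm, sub_zero], fun _ hz => d.ofOld_old hz⟩

theorem mem_vsp_self {z : d.Space} (hz : (gen (.e i) : 𝒫) • z = z) : d.ofNew (d.new z) = z := by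
  conv_rhs => rw [← hz, ← d.ofOld_old_add_ofNew_new z]
  rw [gen_smul, map_add, genMap_e_old, ofOld_e, zero_add, genMap_e_self_new]

/-- The new space at the vertex. -/
def vspEquiv : U ≃ₗ[K] vsp K C D Ω d.Space i where
  toFun u := ⟨d.ofNew u, by rw [mem_vsp, gen_smul, genMap_e_self_new]⟩
  map_add' u v := Subtype.ext (map_add _ _ _)
  map_smul' r u := Subtype.ext (map_smul _ _ _)
  invFun z := d.new z
  left_inv u := rfl
  right_inv z := Subtype.ext (d.mem_vsp_self z.2)

theorem vspEquiv_eps (u : U) :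
    d.vspEquiv (d.eps u) = epsEnd K C D Ω d.Space i (d.vspEquiv u) := by
  refine Subtype.ext ?_
  rw [coe_epsEnd]
  change d.ofNew (d.eps u) = (gen (.eps i) : 𝒫) • d.ofNew u
  rw [gen_smul, genMap_eps_self_new]

/-- A socle vector at i has zero last coefficients under the outgoing map because the arrows kill
it, and the other coefficients are last coefficients of shifts, which vanish because ε_i kills it.
-/
theorem noSoc_self (h : Function.Injective d.out) : NoSoc K C D Ω d.Space i := by
  intro z h1 h2 h3
  have hz := d.mem_vsp_self h1
  have h0 : outX K C D Ω d.Space i z = 0 := by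
    have hs : shiftX K C D Ω d.Space i (outX K C D Ω d.Space i z) = 0 := by
      rw [← outX_eps, h2, map_zero]
    funext j g f
    rw [← lastX_shiftX_pow d.orient (outX K C D Ω d.Space i z) j g f]
    obtain ⟨n, hn⟩ : ∃ n, fNum C j.1 i - 1 - f = n := ⟨_, rfl⟩
    rw [hn]
    cases n with
    | zero =>
      refine Subtype.ext ?_
      rw [pow_zero, Module.End.one_apply, lastX_outX, h3, smul_zero]
      rfl
    | succ n => rw [pow_succ, Module.End.mul_apply, hs, map_zero, map_zero]; rfl
  rw [← hz, outX_ofNew] at h0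
  have h4 : d.out (d.new z) = 0 := by
    rw [← d.mapX_old_mapX_ofOld (d.out (d.new z)), h0, map_zero]
  rw [← hz, h (h4.trans (map_zero _).symm), map_zero]

end VertexData

variable {N : Type*} [AddCommGroup N] [Module (Preproj K C D Ω) N]
  [Module K N] [IsScalarTower K (Preproj K C D Ω) N]

/-- The vertices other than `i` cannot enter the socle if `i` does not belong to it. -/
theorem SameOff.noSoc (hΩ : IsOrientation C Ω) {i j : I} (h : SameOff K C D Ω M N i)
    (hi : NoSoc K C D Ω M i) (hj : NoSoc K C D Ω M j) (hji : j ≠ i) : NoSoc K C D Ω N j := by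
  obtain ⟨F, G, hF, hG, h1, h2⟩ := h
  intro y hy1 hy2 hy3
  have hy0 : (gen (.e i) : 𝒫) • y = 0 := by rw [← hy1, e_smul_e_ne (Ne.symm hji)]
  have hGe : (gen (.e j) : 𝒫) • G y = G y := by rw [← hG.e j hji, hy1]
  have hx : G y = 0 := by
    refine hj _ hGe (by rw [← hG.eps j hji, hy2, map_zero]) ?_
    intro k hk g
    by_cases hki : k = i
    · subst hki
      -- Arrows from j into i are not transported by G. But out of the value is given by out ∘ in,
      -- which is transported, and out is injective at i in M.
      refine hi.outX_injective hΩ (e_smul_arr _ _ _ _ _) ?_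
      have h3 := inX_incX (K := K) (D := D) hΩ (⟨j, hk⟩ : Nb Ω k) g ⟨y, hy1⟩
      have h4 := inX_incX (K := K) (D := D) hΩ (⟨j, hk⟩ : Nb Ω k) g ⟨G y, hGe⟩
      have h5 : projV K C D Ω M j (G y) = ⟨G y, hGe⟩ := Subtype.ext hGe
      have h6 := mapX_incX (K := K) (D := D) hΩ (F := G) (⟨j, hk⟩ : Nb Ω k) g ⟨y, hy1⟩
      rw [h5] at h6
      have h7 := hG.phi (incX K C D Ω N hΩ (⟨j, hk⟩ : Nb Ω k) g ⟨y, hy1⟩)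
      rw [h3, hy3, map_zero, map_zero, h6, h4] at h7
      exact h7.symm
    · rw [← hG.arr k hki j hji, hy3, map_zero]
  rw [← h2 y hy0, hx, map_zero]

theorem SameOff.exists_vspEquiv {i j : I} (h : SameOff K C D Ω M N i) (hj : j ≠ i) :
    ∃ f : vsp K C D Ω M j ≃ₗ[K] vsp K C D Ω N j,
      ∀ m, f (epsEnd K C D Ω M j m) = epsEnd K C D Ω N j (f m) := by
  obtain ⟨F, G, hF, hG, h1, h2⟩ := h
  refine ⟨LinearEquiv.ofLinearMap (F.restrict (p := vsp K C D Ω M j) (q := vsp K C D Ω N j)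
      fun m hm => by rw [mem_vsp, ← hF.e j hj, hm])
    (G.restrict (p := vsp K C D Ω N j) (q := vsp K C D Ω M j)
      fun m hm => by rw [mem_vsp, ← hG.e j hj, hm])
    (LinearMap.ext fun n => Subtype.ext (h2 _ (e_smul_coe_ne (Ne.symm hj) n)))
    (LinearMap.ext fun n => Subtype.ext (h1 _ (e_smul_coe_ne (Ne.symm hj) n))), fun m => ?_⟩
  exact Subtype.ext (hF.eps j hj m)

theorem SameOff.finrank_vsp {i j : I} (h : SameOff K C D Ω M N i) (hj : j ≠ i) :
    Module.finrank K (vsp K C D Ω N j) = Module.finrank K (vsp K C D Ω M j) := by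
  obtain ⟨f, -⟩ := h.exists_vspEquiv hj
  exact f.finrank_eq.symm

theorem SameOff.isFreeNil {i j : I} (h : SameOff K C D Ω M N i) (hj : j ≠ i)
    (hM : IsFreeNil (D j) (epsEnd K C D Ω M j)) : IsFreeNil (D j) (epsEnd K C D Ω N j) := by
  obtain ⟨f, hf⟩ := h.exists_vspEquiv hj
  exact hM.of_equiv f hf

/-! ### Invariance under isomorphisms -/

theorem exists_vspEquiv_of_equiv (T : M ≃ₗ[𝒫] N) (j : I) :
    ∃ f : vsp K C D Ω M j ≃ₗ[K] vsp K C D Ω N j,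
      ∀ m, f (epsEnd K C D Ω M j m) = epsEnd K C D Ω N j (f m) := by
  let T' := T.restrictScalars K
  refine ⟨LinearEquiv.ofLinearMap (T'.toLinearMap.restrict (p := vsp K C D Ω M j)
      (q := vsp K C D Ω N j) fun m hm => by
        rw [mem_vsp]; exact (map_smul T _ _).symm.trans (congrArg T hm))
    (T'.symm.toLinearMap.restrict (p := vsp K C D Ω N j) (q := vsp K C D Ω M j)
      fun m hm => by
        rw [mem_vsp]; exact (map_smul T.symm _ _).symm.trans (congrArg T.symm hm))
    (LinearMap.ext fun n => Subtype.ext (T.apply_symm_apply _))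
    (LinearMap.ext fun n => Subtype.ext (T.symm_apply_apply _)), fun m => ?_⟩
  exact Subtype.ext (map_smul T _ _)

theorem noSoc_of_equiv (T : M ≃ₗ[𝒫] N) {j : I} (h : NoSoc K C D Ω M j) : NoSoc K C D Ω N j := by
  intro x h1 h2 h3
  have h0 := h (T.symm x) (by rw [← map_smul, h1]) (by rw [← map_smul, h2, map_zero])
    fun k hk g => by rw [← map_smul, h3, map_zero]
  simpa using h0

end ReplaceProperties

end FramedPreprojective
end

noncomputable section

namespace FramedPreprojective

/-! ### Ranks, socles and largest factors in terms of linear algebra -/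

section Conditions

variable {K : Type u} [Field K] {I : Type w} [Fintype I] [DecidableEq I]
  {C : Matrix I I ℤ} {D : I → ℕ} {Ω : I → I → Prop}

local notation "𝒫" => Preproj K C D Ω

variable {M : Type*} [AddCommGroup M] [Module (Preproj K C D Ω) M]
  [Module K M] [IsScalarTower K (Preproj K C D Ω) M]
  {N : Type*} [AddCommGroup N] [Module (Preproj K C D Ω) N]
  [Module K N] [IsScalarTower K (Preproj K C D Ω) N]

/-! ### Ranks -/

open Polynomial in
theorem coe_aeval_epsEnd (i : I) (p : K[X]) (m : vsp K C D Ω M i) :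
    (aeval (epsEnd K C D Ω M i) p m : M) = (aeval (gen (.eps i) : 𝒫) p) • (m : M) := by
  induction p using Polynomial.induction_on' with
  | add p q hp hq => simp only [map_add, LinearMap.add_apply, Submodule.coe_add, hp, hq, add_smul]
  | monomial n r =>
    rw [aeval_monomial, aeval_monomial, Module.End.mul_apply, Module.algebraMap_end_apply,
      Submodule.coe_smul, coe_epsEnd_pow, mul_smul, algebraMap_smul]

open Polynomial in
/-- Local freeness at a vertex in terms of linear algebra. -/
theorem hasRankAt_iff {i : I} (hi : 0 < D i) (a : ℕ) :
    HasRankAt (K := K) (C := C) (D := D) (Ω := Ω) M i a ↔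
      IsFreeNil (D i) (epsEnd K C D Ω M i) ∧ FiniteDimensional K (vsp K C D Ω M i) ∧
        Module.finrank K (vsp K C D Ω M i) = D i * a := by
  constructor
  · rintro ⟨φ, hφ⟩
    let Φ : (Fin a → Hring K D i) ≃ₗ[K] vsp K C D Ω M i :=
      { toFun := fun x => ⟨φ x, (φ x).2⟩
        map_add' := fun x y => Subtype.ext (by simp)
        map_smul' := fun r x => Subtype.ext (by
          have h := hφ (Polynomial.C r) x
          have hr : Ideal.Quotient.mk (Ideal.span {(X : K[X]) ^ D i}) (Polynomial.C r) • x = r • x :=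
            algebraMap_smul (Hring K D i) r x
          rw [aeval_C, algebraMap_smul, hr] at h
          exact h)
        invFun := fun m => φ.symm ⟨m, m.2⟩
        left_inv := fun x => φ.symm_apply_apply x
        right_inv := fun m => by simp }
    refine isFreeNil_of_freeEquiv Φ fun p x => Subtype.ext ?_
    rw [coe_aeval_epsEnd]
    exact hφ p x
  · rintro ⟨h1, h2, h3⟩
    obtain ⟨Φ, hΦ⟩ := h1.exists_freeEquiv hi (epsEnd_pow_eq_zero i) h3
    refine ⟨{ toFun := fun x => ⟨Φ x, (Φ x).2⟩
              map_add' := fun x y => Subtype.ext (by simp)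
              invFun := fun m => Φ.symm ⟨m, m.2⟩
              left_inv := fun x => Φ.symm_apply_apply x
              right_inv := fun m => by simp }, fun p x => ?_⟩
    have := congrArg Subtype.val (hΦ p x)
    rw [coe_aeval_epsEnd] at this
    exact this

theorem hasRankAt_of_equiv (T : M ≃ₗ[𝒫] N) {i : I} (hi : 0 < D i) {a : ℕ}
    (h : HasRankAt (K := K) (C := C) (D := D) (Ω := Ω) M i a) :
    HasRankAt (K := K) (C := C) (D := D) (Ω := Ω) N i a := by
  rw [hasRankAt_iff hi] at h ⊢
  obtain ⟨f, hf⟩ := exists_vspEquiv_of_equiv T i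
  obtain ⟨h1, h2, h3⟩ := h
  exact ⟨h1.of_equiv f hf, Module.Finite.equiv f, by rw [← f.finrank_eq, h3]⟩

theorem iSup_vsp : ⨆ i, vsp K C D Ω M i = ⊤ := by
  refine eq_top_iff.2 fun m _ => ?_
  rw [← sum_e_smul (K := K) (C := C) (D := D) (Ω := Ω) m]
  exact Submodule.sum_mem _ fun i _ => Submodule.mem_iSup_of_mem i (e_smul_e i m)

theorem finiteDimensional_of_vsp (h : ∀ i, FiniteDimensional K (vsp K C D Ω M i)) :
    FiniteDimensional K M := by
  have := Submodule.finiteDimensional_iSup (fun i => vsp K C D Ω M i)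
  rw [iSup_vsp] at this
  exact Module.Finite.equiv (Submodule.topEquiv (R := K) (M := M))

/-! ### Modules concentrated at a vertex -/

theorem gen_arr_smul_eq_zero (hΩ : IsOrientation C Ω) {i : I}
    (h : ∀ m : M, (gen (.e i) : 𝒫) • m = m) (j k : I) (hjk : Ω j k ∨ Ω k j)
    (g : Fin (gNum C j k)) (m : M) : (gen (.arr j k hjk g) : 𝒫) • m = 0 := by
  by_cases hj : j = i
  · subst hj
    rw [← h m, arr_smul_e_ne _ (hΩ.ne hjk)]
  · rw [← h ((gen (.arr j k hjk g) : 𝒫) • m), e_smul_arr_ne (Ne.symm hj)]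

/-- On a module concentrated at i no arrow acts, so ε_i is an endomorphism. By Schur's lemma and
nilpotency it is zero; then the whole algebra acts by scalars and a simple module is a line. -/
theorem isVertexSimple_of_isSimpleModule (hΩ : IsOrientation C Ω) {i : I}
    (h : ∀ m : M, (gen (.e i) : 𝒫) • m = m) [IsSimpleModule 𝒫 M] :
    IsVertexSimple K C D Ω M i := by
  have he : ∀ j ≠ i, ∀ m : M, (gen (.e j) : 𝒫) • m = 0 := fun j hj m => by
    rw [← h m, e_smul_e_ne hj]
  have heps : ∀ j ≠ i, ∀ m : M, (gen (.eps j) : 𝒫) • m = 0 := fun j hj m => by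
    rw [← h m, eps_smul_e_ne hj]
  have harr := gen_arr_smul_eq_zero (M := M) hΩ h
  have hcomm : ∀ (a : 𝒫) (m : M), (gen (.eps i) : 𝒫) • a • m = a • (gen (.eps i) : 𝒫) • m := by
    intro a
    induction a using preproj_induction with
    | hK r => intro m; rw [algebraMap_smul, algebraMap_smul, smul_comm]
    | hg x =>
      intro m
      cases x with
      | e j =>
        by_cases hj : j = i
        · subst hj; rw [h, h]
        · rw [he j hj, he j hj, smul_zero]
      | eps j =>
        by_cases hj : j = i
        · subst hj; rfl
        · rw [heps j hj, heps j hj, smul_zero]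
      | arr j k hjk g => rw [harr, harr, smul_zero]
    | hadd a b ha hb => intro m; rw [add_smul, smul_add, ha, hb, add_smul]
    | hmul a b ha hb => intro m; rw [mul_smul, ha, hb, mul_smul]
  let ε : M →ₗ[𝒫] M :=
    { toFun := fun m => (gen (.eps i) : 𝒫) • m
      map_add' := fun m n => smul_add _ _ _
      map_smul' := fun a m => hcomm a m }
  have hεpow : ∀ (n : ℕ) (m : M), (ε ^ n) m = (gen (.eps i) ^ n : 𝒫) • m := fun n m => by
    induction n generalizing m with
    | zero => simp
    | succ n ih => rw [pow_succ, Module.End.mul_apply, ih, pow_succ, mul_smul]; rfl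
  have := IsSimpleModule.nontrivial 𝒫 M
  have hε : ε = 0 := by
    rcases LinearMap.bijective_or_eq_zero ε with hb | h0
    · obtain ⟨x, hx⟩ := exists_ne (0 : M)
      have hinj : Function.Injective (ε ^ D i) := by
        rw [Module.End.coe_pow]; exact hb.1.iterate _
      exact absurd (hinj (a₁ := x) (a₂ := 0) (by
        rw [hεpow, eps_pow_smul_zero, map_zero])) hx
    · exact h0
  have hε' : ∀ m : M, (gen (.eps i) : 𝒫) • m = 0 := fun m => LinearMap.congr_fun hε m
  have hscalar : ∀ a : 𝒫, ∃ c : K, ∀ m : M, a • m = algebraMap K 𝒫 c • m := by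
    intro a
    induction a using preproj_induction with
    | hK r => exact ⟨r, fun m => rfl⟩
    | hg x =>
      cases x with
      | e j =>
        by_cases hj : j = i
        · subst hj; exact ⟨1, fun m => by rw [h, map_one, one_smul]⟩
        · exact ⟨0, fun m => by rw [he j hj, map_zero, zero_smul]⟩
      | eps j =>
        refine ⟨0, fun m => ?_⟩
        rw [map_zero, zero_smul]
        by_cases hj : j = i
        · subst hj; exact hε' m
        · exact heps j hj m
      | arr j k hjk g => exact ⟨0, fun m => by rw [harr, map_zero, zero_smul]⟩
    | hadd a b ha hb =>
      obtain ⟨c, hc⟩ := ha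
      obtain ⟨d, hd⟩ := hb
      exact ⟨c + d, fun m => by rw [add_smul, hc, hd, map_add, add_smul]⟩
    | hmul a b ha hb =>
      obtain ⟨c, hc⟩ := ha
      obtain ⟨d, hd⟩ := hb
      exact ⟨c * d, fun m => by rw [mul_smul, hd, hc, map_mul, mul_smul]⟩
  obtain ⟨x, hx⟩ := exists_ne (0 : M)
  refine ⟨x, hx, fun y => ?_, h x, fun j => ?_, fun j k hjk g => harr j k hjk g x⟩
  · obtain ⟨a, ha⟩ := Submodule.mem_span_singleton.1
      ((IsSimpleModule.span_singleton_eq_top 𝒫 hx).symm ▸ Submodule.mem_top (x := y))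
    obtain ⟨c, hc⟩ := hscalar a
    exact ⟨c, by rw [← ha, hc]⟩
  · by_cases hj : j = i
    · subst hj; exact hε' x
    · exact heps j hj x

/-- All composition factors of a module concentrated at the vertex `i` are isomorphic to `S_i`. -/
theorem allFactorsSimpleAt_of_e_smul (hΩ : IsOrientation C Ω) {i : I}
    (h : ∀ m : M, (gen (.e i) : 𝒫) • m = m) : AllFactorsSimpleAt K C D Ω M i := by
  intro A B hAB
  have : IsSimpleModule 𝒫 (B ⧸ A.submoduleOf B) := (covBy_iff_quot_is_simple hAB.le).1 hAB
  refine isVertexSimple_of_isSimpleModule hΩ fun m => ?_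
  obtain ⟨b, rfl⟩ := Submodule.Quotient.mk_surjective _ m
  rw [← Submodule.Quotient.mk_smul]
  congr 1
  exact Subtype.ext (h b)

/-- The algebra acts by scalars on a socle vector at i, so its span is concentrated at i and lies in
sub_i M. -/
theorem noSoc_of_subAt (hΩ : IsOrientation C Ω) {i : I} (h : subAt K C D Ω M i = ⊥) :
    NoSoc K C D Ω M i := by
  intro x h1 h2 h3
  have hscalar : ∀ a : 𝒫, ∃ c : K, a • x = algebraMap K 𝒫 c • x := by
    intro a
    induction a using preproj_induction with
    | hK r => exact ⟨r, rfl⟩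
    | hg y =>
      cases y with
      | e j =>
        by_cases hj : j = i
        · subst hj; exact ⟨1, by rw [h1, map_one, one_smul]⟩
        · exact ⟨0, by rw [← h1, e_smul_e_ne hj, map_zero, zero_smul]⟩
      | eps j =>
        refine ⟨0, ?_⟩
        rw [map_zero, zero_smul]
        by_cases hj : j = i
        · subst hj; exact h2
        · rw [← h1, eps_smul_e_ne hj]
      | arr j k hjk g =>
        refine ⟨0, ?_⟩
        rw [map_zero, zero_smul]
        by_cases hk : k = i
        · subst hk; exact h3 j hjk g
        · rw [← h1, arr_smul_e_ne _ hk]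
    | hadd a b ha hb =>
      obtain ⟨c, hc⟩ := ha
      obtain ⟨d, hd⟩ := hb
      exact ⟨c + d, by rw [add_smul, hc, hd, map_add, add_smul]⟩
    | hmul a b ha hb =>
      obtain ⟨c, hc⟩ := ha
      obtain ⟨d, hd⟩ := hb
      refine ⟨c * d, ?_⟩
      rw [mul_smul, hd, ← mul_smul, ← Algebra.commutes, mul_smul, hc, ← mul_smul, ← map_mul,
        mul_comm]
  have hle : Submodule.span 𝒫 {x} ≤ subAt K C D Ω M i := by
    refine le_sSup ?_
    refine allFactorsSimpleAt_of_e_smul hΩ fun m => Subtype.ext ?_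
    obtain ⟨a, ha⟩ := Submodule.mem_span_singleton.1 m.2
    obtain ⟨c, hc⟩ := hscalar a
    rw [Submodule.coe_smul, ← ha, hc, algebraMap_smul, smul_comm, h1]
  rw [h] at hle
  exact (Submodule.mem_bot 𝒫).1 (hle (Submodule.mem_span_singleton_self x))

/-- A nonzero submodule with all composition factors S_i contains a minimal nonzero submodule,
itself a copy of S_i. The proof applies to each submodule in the supremum separately. -/
theorem subAt_eq_bot [FiniteDimensional K M] {i : I} (h : NoSoc K C D Ω M i) :
    subAt K C D Ω M i = ⊥ := by
  have hA : IsArtinian 𝒫 M := isArtinian_of_tower K inferInstance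
  refine eq_bot_iff.2 (sSup_le fun N hN => ?_)
  by_contra hne
  have hnt : Nontrivial N := Submodule.nontrivial_iff_ne_bot.2 fun h0 => hne (h0 ▸ le_rfl)
  obtain ⟨B, hB⟩ := exists_covBy_of_wellFoundedLT (a := (⊥ : Submodule 𝒫 N))
    (by rw [isMax_iff_eq_top]; exact bot_ne_top)
  obtain ⟨x, hx0, -, hx1, hx2, hx3⟩ := hN ⊥ B hB
  obtain ⟨b, rfl⟩ := Submodule.Quotient.mk_surjective _ x
  have hinj : ∀ c : B, (Submodule.Quotient.mk c : B ⧸ (⊥ : Submodule 𝒫 N).submoduleOf B) = 0 →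
      ((c : N) : M) = 0 := fun c hc => by
    have : (c : N) = 0 := (Submodule.mem_bot 𝒫).1 ((Submodule.Quotient.mk_eq_zero (Submodule.submoduleOf ⊥ B)).1 hc)
    rw [this]; rfl
  refine hx0 ?_
  have h0 : ((b : N) : M) = 0 := by
    refine h _ ?_ ?_ fun j hj g => ?_
    · rw [← sub_eq_zero]
      refine hinj ((gen (.e i) : 𝒫) • b - b) ?_
      rw [Submodule.Quotient.mk_sub, Submodule.Quotient.mk_smul, hx1, sub_self]
    · exact hinj ((gen (.eps i) : 𝒫) • b) (by rw [Submodule.Quotient.mk_smul, hx2])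
    · exact hinj ((gen (.arr j i hj g) : 𝒫) • b) (by rw [Submodule.Quotient.mk_smul, hx3])
  have : b = 0 := Subtype.ext (Subtype.ext h0)
  rw [this, Submodule.Quotient.mk_zero]

/-! ### The largest factor module at a vertex -/

variable (K D M) in
/-- The kernel of the projection onto the largest factor module concentrated at `i`. -/
def facKer (hΩ : IsOrientation C Ω) (i : I) : Submodule 𝒫 M where
  carrier := {m | ∃ x, inX K C D Ω M i x = (gen (.e i) : 𝒫) • m}
  zero_mem' := ⟨0, by rw [map_zero, smul_zero]⟩
  add_mem' := by
    rintro m n ⟨x, hx⟩ ⟨y, hy⟩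
    exact ⟨x + y, by rw [map_add, hx, hy, smul_add]⟩
  smul_mem' a m hm := by
    induction a using preproj_induction generalizing m with
    | hK r =>
      obtain ⟨x, hx⟩ := hm
      exact ⟨r • x, by rw [map_smul, hx, algebraMap_smul, smul_comm]⟩
    | hg y =>
      obtain ⟨x, hx⟩ := hm
      cases y with
      | e j =>
        by_cases hj : j = i
        · subst hj; exact ⟨x, by rw [hx, e_smul_e]⟩
        · exact ⟨0, by rw [e_smul_e_ne (Ne.symm hj), map_zero]⟩
      | eps j =>
        by_cases hj : j = i
        · subst hj
          exact ⟨shiftX K C D Ω M j x, by rw [inX_shiftX, hx, eps_smul_e, e_smul_eps]⟩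
        · exact ⟨0, by rw [e_smul_eps_ne (Ne.symm hj), map_zero]⟩
      | arr j k h g =>
        by_cases hj : j = i
        · subst hj
          exact ⟨incX K C D Ω M hΩ ⟨k, h⟩ g (projV K C D Ω M k m), by
            rw [inX_incX, coe_projV, arr_smul_e, e_smul_arr]⟩
        · exact ⟨0, by rw [e_smul_arr_ne (Ne.symm hj), map_zero]⟩
    | hadd a b ha hb =>
      obtain ⟨x, hx⟩ := ha m hm
      obtain ⟨y, hy⟩ := hb m hm
      exact ⟨x + y, by rw [map_add, hx, hy, add_smul, smul_add]⟩
    | hmul a b ha hb => rw [mul_smul]; exact ha _ (hb _ hm)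

theorem mem_facKer (hΩ : IsOrientation C Ω) {i : I} {m : M} :
    m ∈ facKer K D M hΩ i ↔ ∃ x, inX K C D Ω M i x = (gen (.e i) : 𝒫) • m := Iff.rfl

theorem e_smul_quotient_facKer (hΩ : IsOrientation C Ω) (i : I) (q : M ⧸ facKer K D M hΩ i) :
    (gen (.e i) : 𝒫) • q = q := by
  obtain ⟨m, rfl⟩ := Submodule.Quotient.mk_surjective _ q
  rw [← Submodule.Quotient.mk_smul, Submodule.Quotient.eq, mem_facKer]
  exact ⟨0, by rw [smul_sub, e_smul_e, sub_self, map_zero]⟩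

/-- Identifies fac_i M at the vertex i with e_iM / im(in). A quotient with only factors S_i has
nothing at other vertices, so its kernel contains every e_jM with j ≠ i, and therefore the image of
in. -/
theorem sInf_eq_facKer [FiniteDimensional K M] (hΩ : IsOrientation C Ω) (i : I) :
    (sInf {N | AllFactorsSimpleAt K C D Ω (M ⧸ N) i} : Submodule 𝒫 M) = facKer K D M hΩ i := by
  refine le_antisymm (sInf_le (allFactorsSimpleAt_of_e_smul hΩ (e_smul_quotient_facKer hΩ i)))
    (le_sInf fun N hN => ?_)
  have hNoeth : IsNoetherian 𝒫 (M ⧸ N) := isNoetherian_of_tower K inferInstance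
  have he : ∀ j ≠ i, ∀ m : M, (gen (.e j) : 𝒫) • m ∈ N := by
    intro j hj m
    rw [← Submodule.Quotient.mk_eq_zero]
    by_contra hne
    set q : M ⧸ N := Submodule.Quotient.mk ((gen (.e j) : 𝒫) • m) with hq
    have hqe : (gen (.e j) : 𝒫) • q = q := by rw [hq, ← Submodule.Quotient.mk_smul, e_smul_e]
    -- A maximal proper submodule A of the cyclic module generated by q = e_j q: the simple top is
    -- S_i, where e_j acts as zero, so q would lie in A.
    obtain ⟨A, hA⟩ := exists_covBy_of_wellFoundedGT (a := Submodule.span 𝒫 {q}) (by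
      rw [isMin_iff_eq_bot, Submodule.span_singleton_eq_bot]; exact hne)
    obtain ⟨x, -, hx, hxe, -⟩ := hN A _ hA
    let b : Submodule.span 𝒫 {q} := ⟨q, Submodule.mem_span_singleton_self q⟩
    obtain ⟨c, hc⟩ := hx (Submodule.Quotient.mk b)
    have h0 : (Submodule.Quotient.mk b :
        Submodule.span 𝒫 {q} ⧸ A.submoduleOf (Submodule.span 𝒫 {q})) = 0 := by
      have hb : (gen (.e j) : 𝒫) • b = b := Subtype.ext hqe
      rw [← hb, Submodule.Quotient.mk_smul, hc, ← hxe, ← mul_smul, ← Algebra.commutes, mul_smul,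
        e_smul_e_ne hj, smul_zero]
    have hqA : q ∈ A := (Submodule.Quotient.mk_eq_zero (A.submoduleOf _)).1 h0
    exact hA.lt.not_ge ((Submodule.span_singleton_le_iff_mem _ _).2 hqA)
  rintro m ⟨x, hx⟩
  rw [← sum_e_smul (K := K) (C := C) (D := D) (Ω := Ω) m]
  refine Submodule.sum_mem _ fun j _ => ?_
  by_cases hj : j = i
  · subst hj
    rw [← hx, inX_apply]
    refine Submodule.sum_mem _ fun k _ => Submodule.sum_mem _ fun g _ =>
      Submodule.sum_mem _ fun f _ => Submodule.smul_mem _ _ (Submodule.smul_mem _ _ ?_)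
    rw [← e_smul_coe (x k g f)]
    exact he _ (hΩ.ne k.2) _
  · exact he j hj m

variable (K C D Ω M) in
/-- The action of `ε_i` on the image of `⨁_j (_i H_j ⊗ e_j M) → e_i M`. -/
def epsIm (i : I) : Module.End K (LinearMap.range (inX K C D Ω M i)) :=
  (Algebra.lsmul K K M (gen (.eps i) : 𝒫)).restrict fun m hm => by
    obtain ⟨x, rfl⟩ := hm
    exact ⟨_, inX_shiftX x⟩

theorem epsIm_pow_eq_zero (i : I) : epsIm K C D Ω M i ^ D i = 0 := by
  refine LinearMap.ext fun m => Subtype.ext ?_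
  have h : ∀ (n : ℕ) (m : LinearMap.range (inX K C D Ω M i)),
      ((epsIm K C D Ω M i ^ n) m : M) = (gen (.eps i) ^ n : 𝒫) • (m : M) := fun n m => by
    induction n generalizing m with
    | zero => simp
    | succ n ih => rw [pow_succ, Module.End.mul_apply, ih, pow_succ, mul_smul]; rfl
  rw [h, eps_pow_smul_zero]
  rfl

/-- Exactness and injectivity of out give 0 → e_iM → X → im(in) → 0 with the first two terms free
over H_i. -/
theorem isFreeNil_epsIm (hΩ : IsOrientation C Ω) (hD : IsSymmetrizer C D) {i : I}
    (hM : ∀ j, IsFreeNil (D j) (epsEnd K C D Ω M j)) (hs : NoSoc K C D Ω M i)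
    (h : ExactX K C D Ω M i) : IsFreeNil (D i) (epsIm K C D Ω M i) := by
  refine IsFreeNil.quotient (ε := epsEnd K C D Ω M i) (ε' := shiftX K C D Ω M i)
    (f := outX K C D Ω M i ∘ₗ (vsp K C D Ω M i).subtype) (g := (inX K C D Ω M i).rangeRestrict)
    (fun v => outX_eps _) (fun x => Subtype.ext (inX_shiftX x))
    (LinearMap.surjective_rangeRestrict _) (fun x => ?_) ?_ (shiftX_pow_eq_zero hΩ hD i) (hM i)
    (isFreeNil_shiftX hΩ hD fun j _ => hM j)
  · constructor
    · intro hx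
      obtain ⟨m, rfl⟩ := h x (congrArg Subtype.val hx)
      exact ⟨projV K C D Ω M i m, outX_e i m⟩
    · rintro ⟨u, rfl⟩
      exact Subtype.ext (inX_outX i _)
  · refine (injective_iff_map_eq_zero _).2 fun n hn => Subtype.ext ?_
    exact hs.outX_injective hΩ n.2 hn

variable (K D M) in
/-- The projection of `e_i M` onto the largest factor module at `i`. -/
def toFac (hΩ : IsOrientation C Ω) (i : I) :
    vsp K C D Ω M i →ₗ[K] vsp K C D Ω (M ⧸ facKer K D M hΩ i) i :=
  ((facKer K D M hΩ i).mkQ.restrictScalars K).restrict fun _ _ => e_smul_quotient_facKer hΩ i _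

theorem toFac_surjective (hΩ : IsOrientation C Ω) (i : I) :
    Function.Surjective (toFac K D M hΩ i) := by
  rintro ⟨q, hq⟩
  obtain ⟨m, rfl⟩ := Submodule.Quotient.mk_surjective _ q
  exact ⟨projV K C D Ω M i m, Subtype.ext hq⟩

theorem toFac_eq_zero (hΩ : IsOrientation C Ω) {i : I} (m : vsp K C D Ω M i) :
    toFac K D M hΩ i m = 0 ↔ (m : M) ∈ LinearMap.range (inX K C D Ω M i) := by
  have h1 : toFac K D M hΩ i m = 0 ↔ (m : M) ∈ facKer K D M hΩ i := by
    rw [← Submodule.Quotient.mk_eq_zero, Subtype.ext_iff]; rfl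
  rw [h1, mem_facKer, e_smul_coe]
  rfl

theorem range_inX_le (i : I) : LinearMap.range (inX K C D Ω M i) ≤ vsp K C D Ω M i := by
  rintro _ ⟨x, rfl⟩
  exact e_smul_inX x

theorem finrank_vsp_fac [FiniteDimensional K M] (hΩ : IsOrientation C Ω) (i : I) :
    Module.finrank K (vsp K C D Ω (M ⧸ facKer K D M hΩ i) i) +
      Module.finrank K (LinearMap.range (inX K C D Ω M i)) =
        Module.finrank K (vsp K C D Ω M i) := by
  have h := LinearMap.finrank_range_add_finrank_ker (toFac K D M hΩ i)
  have hk : LinearMap.ker (toFac K D M hΩ i) =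
      (LinearMap.range (inX K C D Ω M i)).submoduleOf (vsp K C D Ω M i) := by
    ext m
    rw [LinearMap.mem_ker, toFac_eq_zero]; rfl
  rw [LinearMap.range_eq_top.2 (toFac_surjective hΩ i), finrank_top, hk,
    (Submodule.submoduleOfEquivOfLe (range_inX_le i)).finrank_eq] at h
  exact h

/-- The factor is e_iM / im(in): zero if in is surjective, and a quotient of a free module by a free
submodule if the sequence is exact. -/
theorem isFreeNil_fac (hΩ : IsOrientation C Ω) (hD : IsSymmetrizer C D) {i : I}
    (hM : ∀ j, IsFreeNil (D j) (epsEnd K C D Ω M j)) (hs : NoSoc K C D Ω M i)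
    (h : InSurj K C D Ω M i ∨ ExactX K C D Ω M i) :
    IsFreeNil (D i) (epsEnd K C D Ω (M ⧸ facKer K D M hΩ i) i) := by
  rcases h with h | h
  · intro k _ v _
    have hz : ∀ v : vsp K C D Ω (M ⧸ facKer K D M hΩ i) i, v = 0 := fun v => by
      obtain ⟨m, rfl⟩ := toFac_surjective hΩ i v
      rw [toFac_eq_zero]
      exact h m (e_smul_coe m)
    exact ⟨0, by rw [map_zero, hz v]⟩
  · refine IsFreeNil.quotient (ε := epsIm K C D Ω M i) (ε' := epsEnd K C D Ω M i)
      (f := Submodule.inclusion (range_inX_le i)) (g := toFac K D M hΩ i)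
      (fun _ => rfl) (fun _ => rfl) (toFac_surjective hΩ i) (fun v => ?_)
      (Submodule.inclusion_injective _) (epsEnd_pow_eq_zero i)
      (isFreeNil_epsIm hΩ hD hM hs h) (hM i)
    rw [toFac_eq_zero]
    exact ⟨fun hv => ⟨⟨v, hv⟩, rfl⟩, fun ⟨u, hu⟩ => hu ▸ u.2⟩

theorem hasRankAt_facAt [FiniteDimensional K M] (hΩ : IsOrientation C Ω) (hD : IsSymmetrizer C D)
    {i : I} (hM : ∀ j, IsFreeNil (D j) (epsEnd K C D Ω M j)) (hs : NoSoc K C D Ω M i)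
    (h : InSurj K C D Ω M i ∨ ExactX K C D Ω M i) {a : ℕ}
    (ha : D i * a + Module.finrank K (LinearMap.range (inX K C D Ω M i)) =
        Module.finrank K (vsp K C D Ω M i)) :
    HasRankAt (K := K) (C := C) (D := D) (Ω := Ω) (facAt K C D Ω M i) i a := by
  refine hasRankAt_of_equiv (Submodule.quotEquivOfEq _ _ (sInf_eq_facKer hΩ i).symm) (hD.pos i)
    ((hasRankAt_iff (hD.pos i) a).2 ⟨isFreeNil_fac hΩ hD hM hs h, inferInstance, ?_⟩)
  have := finrank_vsp_fac (M := M) (K := K) (D := D) hΩ i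
  omega

end Conditions

end FramedPreprojective
end

noncomputable section

namespace FramedPreprojective

/-! ## Reflections of dimension vectors -/

section Vectors

variable {I : Type w} [Fintype I] [DecidableEq I] {C : Matrix I I ℤ}

variable (C) in
/-- The pairing of a dimension vector with a simple coroot. -/
def pairing (i : I) : (I → ℤ) →ₗ[ℤ] ℤ where
  toFun n := ∑ j, C j i * n j
  map_add' m n := by simp [mul_add, Finset.sum_add_distrib]
  map_smul' r n := by
    simp only [Pi.smul_apply, smul_eq_mul, RingHom.id_apply, Finset.mul_sum]
    exact Finset.sum_congr rfl fun j _ => by ring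

theorem pairing_apply (i : I) (n : I → ℤ) : pairing C i n = ∑ j, C j i * n j := rfl

variable (C) in
/-- The simple reflection on dimension vectors. -/
def refl (i : I) : (I → ℤ) →ₗ[ℤ] (I → ℤ) :=
  LinearMap.id - LinearMap.single ℤ (fun _ : I => ℤ) i ∘ₗ pairing C i

theorem refl_apply (i : I) (n : I → ℤ) : refl C i n = n - Pi.single i (pairing C i n) := rfl

theorem pairing_single_self (hC : IsGCM C) (i : I) (r : ℤ) :
    pairing C i (Pi.single i r) = 2 * r := by
  rw [pairing_apply, Finset.sum_eq_single i]
  · rw [hC.diag, Pi.single_eq_same]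
  · intro j _ hj; rw [Pi.single_eq_of_ne hj, mul_zero]
  · simp

theorem refl_single_self (hC : IsGCM C) (i : I) (r : ℤ) :
    refl C i (Pi.single i r) = Pi.single i (-r) := by
  rw [refl_apply, pairing_single_self hC, ← Pi.single_sub]
  congr 1; ring

theorem refl_refl (hC : IsGCM C) (i : I) (n : I → ℤ) : refl C i (refl C i n) = n := by
  conv_lhs => rw [refl_apply i n]
  rw [map_sub, refl_single_self hC, refl_apply, Pi.single_neg]
  abel

theorem refl_of_ne {i j : I} (h : j ≠ i) (n : I → ℤ) : refl C i n j = n j := by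
  rw [refl_apply, Pi.sub_apply, Pi.single_eq_of_ne h, sub_zero]

variable (C) in
/-- The action of a word in the simple reflections, the first letter acting first. -/
def wordAct : List I → (I → ℤ) →ₗ[ℤ] (I → ℤ)
  | [] => LinearMap.id
  | i :: l => wordAct l ∘ₗ refl C i

@[simp] theorem wordAct_nil (n : I → ℤ) : wordAct C [] n = n := rfl

@[simp] theorem wordAct_cons (i : I) (l : List I) (n : I → ℤ) :
    wordAct C (i :: l) n = wordAct C l (refl C i n) := rfl

theorem wordAct_append (l l' : List I) (n : I → ℤ) :
    wordAct C (l ++ l') n = wordAct C l' (wordAct C l n) := by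
  induction l generalizing n with
  | nil => rfl
  | cons i l ih => exact ih _

theorem wordAct_reverse (hC : IsGCM C) (l : List I) (n : I → ℤ) :
    wordAct C l.reverse (wordAct C l n) = n := by
  induction l generalizing n with
  | nil => rfl
  | cons i l ih =>
    rw [List.reverse_cons, wordAct_append, wordAct_cons i l n, ih, wordAct_cons, wordAct_nil,
      refl_refl hC]

theorem wordAct_injective (hC : IsGCM C) (l : List I) : Function.Injective (wordAct C l) :=
  Function.LeftInverse.injective (wordAct_reverse hC l)

theorem wordAct_of_notMem {l : List I} {j : I} (h : j ∉ l) (n : I → ℤ) :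
    wordAct C l n j = n j := by
  induction l generalizing n with
  | nil => rfl
  | cons i l ih =>
    rw [List.mem_cons, not_or] at h
    rw [wordAct_cons, ih h.2, refl_of_ne h.1]

/-- The set of dimension vectors `S` is a union of strings of reflections at the vertices of `T`,
up to convexity. -/
def IsStringClosed (C : Matrix I I ℤ) (T : Set I) (S : Set (I → ℤ)) : Prop :=
  ∀ n ∈ S, ∀ i ∈ T, ∃ n' ∈ S, refl C i n' ∈ S ∧ ∃ r q : ℤ, 0 ≤ r ∧ r ≤ q ∧
    n = n' + Pi.single i r ∧ refl C i n' = n' + Pi.single i q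

/-- The reflected vector need not be in S, but it lies between two members n' and s_i n' of S.
Positivity of the remaining word at these ends, known by induction, passes to the convex
combination. -/
theorem IsStringClosed.wordAct_nonneg (hC : IsGCM C) {T : Set I} {S : Set (I → ℤ)}
    (hS : IsStringClosed C T S) (h0 : ∀ n ∈ S, 0 ≤ n) {l : List I} (hl : ∀ i ∈ l, i ∈ T)
    {n : I → ℤ} (hn : n ∈ S) : 0 ≤ wordAct C l n := by
  induction l generalizing n with
  | nil => exact h0 n hn
  | cons i l ih =>
    have hl' : ∀ i ∈ l, i ∈ T := fun j hj => hl j (List.mem_cons_of_mem _ hj)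
    obtain ⟨n', hn', hr, r, q, hr0, hrq, h1, h2⟩ := hS n hn i (hl i List.mem_cons_self)
    rw [wordAct_cons]
    have h3 : refl C i n = n' + Pi.single i (q - r) := by
      rw [h1, map_add, h2, refl_single_self hC, add_assoc, ← Pi.single_add]
      rfl
    -- The convex combination with denominators cleared. It is empty for q = 0, the case where n
    -- equals n', treated separately below.
    have h4 : q • refl C i n = (q - r) • refl C i n' + r • n' := by
      rw [h3, h2, smul_add, smul_add, sub_smul, ← Pi.single_smul, ← Pi.single_smul]
      have : q • (q - r) = (q - r) • q := by simp only [smul_eq_mul]; ring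
      rw [this]; abel
    have h5 := congrArg (wordAct C l) h4
    rw [map_add, map_smul, map_smul, map_smul] at h5
    intro j
    rcases (hr0.trans hrq).eq_or_lt with hq | hq
    · have hr' : r = 0 := by omega
      have : n = n' := by rw [h1, hr', Pi.single_zero, add_zero]
      rw [this]
      exact ih hl' hr j
    · have h6 := congrFun h5 j
      simp only [Pi.add_apply, Pi.smul_apply, smul_eq_mul] at h6
      have h7 := ih hl' hr j
      have h8 := ih hl' hn' j
      simp only [Pi.zero_apply] at h7 h8 ⊢
      have h9 : 0 ≤ q * wordAct C l (refl C i n) j := by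
        rw [h6]
        exact add_nonneg (mul_nonneg (by omega) h7) (mul_nonneg hr0 h8)
      exact nonneg_of_mul_nonneg_right h9 hq

/-- A dimension vector conjugate to one vanishing on `T` lies at an end of each string. -/
theorem IsStringClosed.extremal (hC : IsGCM C) {T : Set I} {S : Set (I → ℤ)}
    (hS : IsStringClosed C T S) (h0 : ∀ n ∈ S, 0 ≤ n) {l : List I} (hl : ∀ i ∈ l, i ∈ T)
    {n n' : I → ℤ} (hn : ∀ j ∈ T, wordAct C l n j = 0) {i : I} (hi : i ∈ T)
    (hn' : n' ∈ S) (hn'' : refl C i n' ∈ S) {r q : ℤ} (hr : 0 ≤ r) (hrq : r ≤ q)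
    (h1 : n = n' + Pi.single i r) (h2 : refl C i n' = n' + Pi.single i q) : r = 0 ∨ r = q := by
  by_contra hcon
  rw [not_or] at hcon
  have hr0 : 0 < r := lt_of_le_of_ne hr (Ne.symm hcon.1)
  have hrq' : 0 < q - r := by have := lt_of_le_of_ne hrq hcon.2; omega
  have h3 : q • n = (q - r) • n' + r • refl C i n' := by
    rw [h1, h2, smul_add, smul_add, sub_smul, ← Pi.single_smul, ← Pi.single_smul]
    have : q • r = r • q := by simp only [smul_eq_mul]; ring
    rw [this]; abel
  have h4 := congrArg (wordAct C l) h3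
  rw [map_add, map_smul, map_smul, map_smul] at h4
  -- On T a sum of two nonnegative terms with positive coefficients vanishes, so both terms do. Off
  -- T the word and s_i act trivially. Injectivity of the word then forces q = 0.
  have h5 : wordAct C l n' = wordAct C l (refl C i n') := by
    funext j
    by_cases hj : j ∈ T
    · have h6 := congrFun h4 j
      simp only [Pi.add_apply, Pi.smul_apply, smul_eq_mul, hn j hj, mul_zero] at h6
      have h7 := hS.wordAct_nonneg hC h0 hl hn' j
      have h8 := hS.wordAct_nonneg hC h0 hl hn'' j
      simp only [Pi.zero_apply] at h7 h8
      have h9 := mul_nonneg hrq'.le h7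
      have h10 := mul_nonneg hr0.le h8
      have h11 : (q - r) * wordAct C l n' j = 0 := by linarith
      have h12 : r * wordAct C l (refl C i n') j = 0 := by linarith
      rw [(mul_eq_zero.1 h11).resolve_left hrq'.ne', (mul_eq_zero.1 h12).resolve_left hr0.ne']
    · have hjl : j ∉ l := fun h => hj (hl j h)
      have hji : j ≠ i := fun h => hj (h ▸ hi)
      rw [wordAct_of_notMem hjl, wordAct_of_notMem hjl, refl_of_ne hji]
  have h6 := congrFun (wordAct_injective hC l h5) i
  rw [h2, Pi.add_apply, Pi.single_eq_same] at h6
  omega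

end Vectors

/-! ## Reflections of modules -/

section Modules

variable {K : Type u} [Field K] {I : Type w} [Fintype I] [DecidableEq I]
  {C : Matrix I I ℤ} {D : I → ℕ} {Ω : I → I → Prop}

local notation "𝒫" => Preproj K C D Ω

variable (K C D Ω) in
/-- Finite-dimensional modules. -/
structure FDMod where
  carrier : Type u
  [addCommGroup : AddCommGroup carrier]
  [moduleK : Module K carrier]
  [module : Module (Preproj K C D Ω) carrier]
  [tower : IsScalarTower K (Preproj K C D Ω) carrier]
  [finite : FiniteDimensional K carrier]

attribute [instance] FDMod.addCommGroup FDMod.moduleK FDMod.module FDMod.tower FDMod.finite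

instance : CoeSort (FDMod K C D Ω) (Type u) := ⟨FDMod.carrier⟩

variable {M : Type*} [AddCommGroup M] [Module (Preproj K C D Ω) M]
  [Module K M] [IsScalarTower K (Preproj K C D Ω) M]

variable (M) in
-- Transport of structure to K^d. It keeps all modules in one universe, so that replacements can be
-- iterated and `stableDims` contains the dimension vectors of modules from any universe.
theorem exists_fdMod_equiv [FiniteDimensional K M] :
    ∃ X : FDMod K C D Ω, Nonempty (M ≃ₗ[𝒫] X) := by
  let e : M ≃ₗ[K] (Fin (Module.finrank K M) → K) := (Module.finBasis K M).equivFun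
  let ψ : 𝒫 →ₐ[K] Module.End K (Fin (Module.finrank K M) → K) :=
    (e.conjAlgEquiv K).toAlgHom.comp (Algebra.lsmul K K M)
  let inst : Module 𝒫 (Fin (Module.finrank K M) → K) := Module.compHom _ ψ.toRingHom
  have hsmul : ∀ (a : 𝒫) (x : Fin (Module.finrank K M) → K), a • x = e (a • e.symm x) :=
    fun a x => rfl
  have tower : IsScalarTower K 𝒫 (Fin (Module.finrank K M) → K) :=
    IsScalarTower.of_algebraMap_smul fun r x => by
      rw [hsmul, algebraMap_smul, map_smul, e.apply_symm_apply]
  refine ⟨⟨Fin (Module.finrank K M) → K⟩, ⟨{ e with map_smul' := fun a m => ?_ }⟩⟩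
  exact ((hsmul a (e m)).trans (by rw [e.symm_apply_apply]; rfl)).symm

variable (K C D Ω M) in
/-- The dimension vector of a module. -/
def dimVec (i : I) : ℤ := Module.finrank K (vsp K C D Ω M i)

theorem dimVec_of_equiv {N : Type*} [AddCommGroup N] [Module (Preproj K C D Ω) N]
    [Module K N] [IsScalarTower K (Preproj K C D Ω) N] (T : M ≃ₗ[𝒫] N) :
    dimVec K C D Ω N = dimVec K C D Ω M := by
  funext i
  obtain ⟨f, -⟩ := exists_vspEquiv_of_equiv T i
  rw [dimVec, dimVec, f.finrank_eq]

/-- The diagonal entry 2 gives the first term and the negative entries |c_ji| of the column count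
the dimension of X. -/
theorem pairing_dimVec [FiniteDimensional K M] (hC : IsGCM C) (hΩ : IsOrientation C Ω) (i : I) :
    pairing C i (dimVec K C D Ω M) =
      2 * Module.finrank K (vsp K C D Ω M i) - Module.finrank K (XSp K C D Ω M i) := by
  classical
  have h1 : (Module.finrank K (XSp K C D Ω M i) : ℤ) =
      ∑ j : I, if Ω i j ∨ Ω j i then - (C j i) * dimVec K C D Ω M j else 0 := by
    rw [finrank_XSp]
    have := sum_dite_eq_sum_nb (Ω := Ω) i (fun j _ => - (C j i) * dimVec K C D Ω M j)
    simp only [dite_eq_ite] at this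
    rw [this]
    push_cast
    refine Finset.sum_congr rfl fun j _ => ?_
    rw [abs_of_neg (hΩ.neg j.2.symm)]
    rfl
  have h2 : ∀ j, C j i * dimVec K C D Ω M j = (if j = i then 2 * dimVec K C D Ω M i else 0) -
      if Ω i j ∨ Ω j i then - (C j i) * dimVec K C D Ω M j else 0 := by
    intro j
    by_cases hj : j = i
    · subst hj
      have : ¬ (Ω j j ∨ Ω j j) := fun h => hΩ.ne h rfl
      rw [if_pos rfl, if_neg this, hC.diag, sub_zero]
    · rw [if_neg hj]
      by_cases h : Ω i j ∨ Ω j i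
      · rw [if_pos h]; ring
      · have : C j i = 0 := by
          refine le_antisymm (hC.nonpos j i hj) (not_lt.1 fun hlt => h ?_)
          exact ((hΩ.edge_iff j i hj).2 hlt).symm
        rw [if_neg h, this]; ring
  rw [pairing_apply, Finset.sum_congr rfl fun j _ => h2 j, Finset.sum_sub_distrib, ← h1]
  simp [dimVec]

/-! ### The two modules obtained from the ends of a string -/

/-- The data for replacing `e_i M` with the image of `⨁_j (_i H_j ⊗ e_j M)`. -/
def downData (hΩ : IsOrientation C Ω) (hD : IsSymmetrizer C D) (i : I) :
    VertexData K C D Ω M i (LinearMap.range (inX K C D Ω M i)) where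
  orient := hΩ
  D_pos j := Nat.one_le_iff_ne_zero.1 (hD.pos j)
  eps := epsIm K C D Ω M i
  inn := (inX K C D Ω M i).rangeRestrict
  out := outX K C D Ω M i ∘ₗ Submodule.subtype _
  eps_pow := epsIm_pow_eq_zero i
  inn_shift m := Subtype.ext (inX_shiftX m)
  out_eps _ := outX_eps _
  inn_out _ := Subtype.ext (inX_outX i _)
  out_inn _ := rfl

variable (K C D Ω M) in
/-- The action of `ε_i` on the kernel of `⨁_j (_i H_j ⊗ e_j M) → e_i M`. -/
def epsKer (i : I) : Module.End K (LinearMap.ker (inX K C D Ω M i)) :=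
  (shiftX K C D Ω M i).restrict fun x hx => by
    rw [LinearMap.mem_ker] at hx ⊢
    rw [inX_shiftX, hx, smul_zero]

/-- The data for replacing `e_i M` with the kernel of `⨁_j (_i H_j ⊗ e_j M) → e_i M`. -/
def upData (hΩ : IsOrientation C Ω) (hD : IsSymmetrizer C D) (i : I) :
    VertexData K C D Ω M i (LinearMap.ker (inX K C D Ω M i)) where
  orient := hΩ
  D_pos j := Nat.one_le_iff_ne_zero.1 (hD.pos j)
  eps := epsKer K C D Ω M i
  inn := LinearMap.codRestrict _ (outX K C D Ω M i ∘ₗ inX K C D Ω M i) fun x => inX_outX i _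
  out := Submodule.subtype _
  eps_pow := by
    refine LinearMap.ext fun x => Subtype.ext ?_
    have h := map_pow_apply (ε := epsKer K C D Ω M i) (ε' := shiftX K C D Ω M i)
      (f := Submodule.subtype _) (fun v => rfl) (D i) x
    rw [shiftX_pow_eq_zero hΩ hD] at h
    exact h
  inn_shift x := Subtype.ext (by
    change outX K C D Ω M i (inX K C D Ω M i (shiftX K C D Ω M i x)) = _
    rw [inX_shiftX, outX_eps]
    rfl)
  out_eps _ := rfl
  inn_out u := Subtype.ext (by
    change outX K C D Ω M i (inX K C D Ω M i u) = 0
    rw [LinearMap.mem_ker.1 u.2, map_zero])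
  out_inn _ := rfl

variable (hΩ : IsOrientation C Ω) (hD : IsSymmetrizer C D)

theorem downData_out_injective {i : I} (h : NoSoc K C D Ω M i) :
    Function.Injective (downData (K := K) (M := M) hΩ hD i).out := by
  refine (injective_iff_map_eq_zero _).2 fun u hu => Subtype.ext ?_
  exact h.outX_injective hΩ (range_inX_le i u.2) hu

theorem VertexData.noSoc {i : I} {U : Type*} [AddCommGroup U] [Module K U]
    (d : VertexData K C D Ω M i U) (hd : Function.Injective d.out) {T : Set I}
    (hi : i ∈ T) (h : ∀ j ∈ T, NoSoc K C D Ω M j) : ∀ j ∈ T, NoSoc K C D Ω d.Space j := by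
  intro j hj
  by_cases hji : j = i
  · subst hji; exact d.noSoc_self hd
  · exact d.sameOff.noSoc d.orient (h i hi) (h j hj) hji

theorem VertexData.dimVec_space {i : I} {U : Type*} [AddCommGroup U] [Module K U]
    (d : VertexData K C D Ω M i U) :
    dimVec K C D Ω d.Space = dimVec K C D Ω M +
      Pi.single i ((Module.finrank K U : ℤ) - dimVec K C D Ω M i) := by
  funext j
  by_cases hji : j = i
  · subst hji
    rw [Pi.add_apply, Pi.single_eq_same, dimVec, ← d.vspEquiv.finrank_eq]; ring
  · rw [Pi.add_apply, Pi.single_eq_of_ne hji, add_zero, dimVec, d.sameOff.finrank_vsp hji, dimVec]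

theorem VertexData.isFreeNil_space {i : I} {U : Type*} [AddCommGroup U] [Module K U]
    (d : VertexData K C D Ω M i U) (hd : IsFreeNil (D i) d.eps)
    (h : ∀ j, IsFreeNil (D j) (epsEnd K C D Ω M j)) (j : I) :
    IsFreeNil (D j) (epsEnd K C D Ω d.Space j) := by
  by_cases hji : j = i
  · subst hji; exact hd.of_equiv d.vspEquiv d.vspEquiv_eps
  · exact d.sameOff.isFreeNil hji (h j)

variable (K C D Ω) in
/-- The dimension vectors of the modules without socle at the vertices in `T`. -/
def stableDims (T : Set I) : Set (I → ℤ) :=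
  {n | ∃ X : FDMod K C D Ω, (∀ j ∈ T, NoSoc K C D Ω X j) ∧ dimVec K C D Ω X = n}

theorem dimVec_mem_stableDims [FiniteDimensional K M] {T : Set I}
    (h : ∀ j ∈ T, NoSoc K C D Ω M j) : dimVec K C D Ω M ∈ stableDims K C D Ω T := by
  obtain ⟨X, ⟨e⟩⟩ := exists_fdMod_equiv (K := K) (C := C) (D := D) (Ω := Ω) M
  exact ⟨X, fun j hj => noSoc_of_equiv e (h j hj), dimVec_of_equiv e⟩

theorem stableDims_nonneg {T : Set I} : ∀ n ∈ stableDims K C D Ω T, 0 ≤ n := by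
  rintro _ ⟨X, -, rfl⟩ j
  exact Int.natCast_nonneg _

include hΩ in
theorem finrank_vsp_le_finrank_ker [FiniteDimensional K M] {i : I} (h : NoSoc K C D Ω M i) :
    Module.finrank K (vsp K C D Ω M i) ≤ Module.finrank K (LinearMap.ker (inX K C D Ω M i)) := by
  refine LinearMap.finrank_le_finrank_of_injective (f := LinearMap.codRestrict _
    (outX K C D Ω M i ∘ₗ (vsp K C D Ω M i).subtype) fun m => inX_outX i _) ?_
  refine (injective_iff_map_eq_zero _).2 fun u hu => Subtype.ext ?_
  exact h.outX_injective hΩ u.2 (congrArg Subtype.val hu)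

theorem finrank_range_inX_le [FiniteDimensional K M] (i : I) :
    Module.finrank K (LinearMap.range (inX K C D Ω M i)) ≤ Module.finrank K (vsp K C D Ω M i) :=
  Submodule.finrank_mono (range_inX_le i)

theorem inSurj_of_finrank [FiniteDimensional K M] {i : I}
    (h : Module.finrank K (LinearMap.range (inX K C D Ω M i)) =
      Module.finrank K (vsp K C D Ω M i)) : InSurj K C D Ω M i := by
  have := Submodule.eq_of_le_of_finrank_eq (range_inX_le i) h
  intro m hm
  have hm' : m ∈ LinearMap.range (inX K C D Ω M i) := by rw [this]; exact hm
  exact hm'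

theorem InSurj.finrank {i : I} (h : InSurj K C D Ω M i) :
    Module.finrank K (LinearMap.range (inX K C D Ω M i)) =
      Module.finrank K (vsp K C D Ω M i) := by
  rw [le_antisymm (range_inX_le i) fun m hm => h m hm]

include hΩ in
theorem exactX_of_finrank [FiniteDimensional K M] {i : I} (hs : NoSoc K C D Ω M i)
    (h : Module.finrank K (vsp K C D Ω M i) =
      Module.finrank K (LinearMap.ker (inX K C D Ω M i))) : ExactX K C D Ω M i := by
  let f : vsp K C D Ω M i →ₗ[K] LinearMap.ker (inX K C D Ω M i) := LinearMap.codRestrict _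
    (outX K C D Ω M i ∘ₗ (vsp K C D Ω M i).subtype) fun m => inX_outX i _
  have hf : Function.Injective f := by
    refine (injective_iff_map_eq_zero _).2 fun u hu => Subtype.ext ?_
    exact hs.outX_injective hΩ u.2 (congrArg Subtype.val hu)
  intro x hx
  obtain ⟨m, hm⟩ := (LinearMap.injective_iff_surjective_of_finrank_eq_finrank h).1 hf ⟨x, hx⟩
  exact ⟨m, congrArg Subtype.val hm⟩

include hΩ in
theorem ExactX.finrank [FiniteDimensional K M] {i : I} (hs : NoSoc K C D Ω M i)
    (h : ExactX K C D Ω M i) : Module.finrank K (vsp K C D Ω M i) =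
      Module.finrank K (LinearMap.ker (inX K C D Ω M i)) := by
  refine le_antisymm (finrank_vsp_le_finrank_ker hΩ hs) ?_
  refine LinearMap.finrank_le_finrank_of_surjective (f := LinearMap.codRestrict _
    (outX K C D Ω M i ∘ₗ (vsp K C D Ω M i).subtype) fun m => inX_outX i _) ?_
  rintro ⟨x, hx⟩
  obtain ⟨m, rfl⟩ := h x hx
  exact ⟨projV K C D Ω M i m, Subtype.ext (outX_e i m)⟩

variable (hC : IsGCM C)
include hΩ hD hC

/-- The string of dimension vectors through the dimension vector of a module. -/
theorem exists_string [FiniteDimensional K M] {T : Set I} (h : ∀ j ∈ T, NoSoc K C D Ω M j)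
    {i : I} (hi : i ∈ T) :
    ∃ n' ∈ stableDims K C D Ω T, refl C i n' ∈ stableDims K C D Ω T ∧
      ∃ r q : ℤ, 0 ≤ r ∧ r ≤ q ∧
      dimVec K C D Ω M = n' + Pi.single i r ∧ refl C i n' = n' + Pi.single i q ∧
      r + Module.finrank K (LinearMap.range (inX K C D Ω M i)) =
        Module.finrank K (vsp K C D Ω M i) ∧
      q + Module.finrank K (LinearMap.range (inX K C D Ω M i)) =
        Module.finrank K (LinearMap.ker (inX K C D Ω M i)) := by
  have h1 := (downData (K := K) (M := M) hΩ hD i).dimVec_space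
  have h2 := (upData (K := K) (M := M) hΩ hD i).dimVec_space
  have h3 := dimVec_mem_stableDims ((downData (K := K) (M := M) hΩ hD i).noSoc
    (downData_out_injective hΩ hD (h i hi)) hi h)
  have h4 := dimVec_mem_stableDims ((upData (K := K) (M := M) hΩ hD i).noSoc
    (Submodule.subtype_injective _) hi h)
  have h5 := finrank_vsp_le_finrank_ker hΩ (h i hi)
  have h6 := finrank_range_inX_le (K := K) (C := C) (D := D) (Ω := Ω) (M := M) i
  have h7 := LinearMap.finrank_range_add_finrank_ker (inX K C D Ω M i)
  have h8 := pairing_dimVec (K := K) (D := D) (M := M) hC hΩ i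
  set a := ((Module.finrank K (LinearMap.range (inX K C D Ω M i)) : ℕ) : ℤ) with ha
  set b := ((Module.finrank K (LinearMap.ker (inX K C D Ω M i)) : ℕ) : ℤ) with hb
  set n := dimVec K C D Ω M with hn
  have hni : n i = Module.finrank K (vsp K C D Ω M i) := rfl
  have hX : (Module.finrank K (XSp K C D Ω M i) : ℤ) = a + b := by rw [ha, hb, ← h7]; push_cast; rfl
  -- With a = dim im(in) and b = dim ker(in), the pairing is 2 n_i - a - b; so s_i exchanges the
  -- values a and b at the vertex i. Hence r = n_i - a and q = b - a.
  have hrefl : refl C i (n + Pi.single i (a - n i)) = n + Pi.single i (b - n i) := by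
    rw [map_add, refl_single_self hC, refl_apply, h8, hX, ← hni, sub_add, ← Pi.single_sub,
      sub_eq_add_neg n, ← Pi.single_neg]
    congr 2; ring
  refine ⟨_, h1 ▸ h3, ?_, n i - a, b - a, by omega, by omega, ?_, ?_, by omega, by omega⟩
  · rw [hrefl]; exact h2 ▸ h4
  · rw [add_assoc, ← Pi.single_add]; simp
  · rw [hrefl, add_assoc, ← Pi.single_add]; congr 2; ring

theorem isStringClosed_stableDims (T : Set I) :
    IsStringClosed C T (stableDims K C D Ω T) := by
  rintro _ ⟨X, hX, rfl⟩ i hi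
  obtain ⟨n', h1, h2, r, q, h3, h4, h5, h6, -⟩ := exists_string hΩ hD hC hX hi
  exact ⟨n', h1, h2, r, q, h3, h4, h5, h6⟩

/-- Modules whose dimension vector is conjugate to one vanishing on `T`. -/
theorem inSurj_or_exactX [FiniteDimensional K M] {T : Set I} (h : ∀ j ∈ T, NoSoc K C D Ω M j)
    {l : List I} (hl : ∀ i ∈ l, i ∈ T)
    (hn : ∀ j ∈ T, wordAct C l (dimVec K C D Ω M) j = 0) {i : I} (hi : i ∈ T) :
    (pairing C i (dimVec K C D Ω M) ≤ 0 → InSurj K C D Ω M i) ∧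
    (0 ≤ pairing C i (dimVec K C D Ω M) → ExactX K C D Ω M i) ∧
    max 0 (pairing C i (dimVec K C D Ω M)) +
      Module.finrank K (LinearMap.range (inX K C D Ω M i)) =
        Module.finrank K (vsp K C D Ω M i) := by
  obtain ⟨n', h1, h2, r, q, h3, h4, h5, h6, h7, h8⟩ := exists_string hΩ hD hC h hi
  have h9 := (isStringClosed_stableDims (K := K) hΩ hD hC T).extremal hC stableDims_nonneg hl hn
    hi h1 h2 h3 h4 h5 h6
  -- In the notation of the string the pairing is 2r - q. It equals -q when r = 0 and q when r = q,
  -- so in both cases r is its positive part.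
  have h10 := pairing_dimVec (K := K) (D := D) (M := M) hC hΩ i
  have h11 := LinearMap.finrank_range_add_finrank_ker (inX K C D Ω M i)
  refine ⟨fun hp => inSurj_of_finrank ?_, fun hp => exactX_of_finrank hΩ (h i hi) ?_, ?_⟩
  · omega
  · omega
  · omega

/-! ### The reflection of a module -/

variable (K C D Ω) in
omit hΩ hD hC in
/-- Locally free modules without socle at the vertices in `T`. -/
structure IsGood (T : Set I) (n : I → ℤ) (M : Type*) [AddCommGroup M]
    [Module (Preproj K C D Ω) M] [Module K M] [IsScalarTower K (Preproj K C D Ω) M] : Prop where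
  noSoc : ∀ j ∈ T, NoSoc K C D Ω M j
  free : ∀ j, IsFreeNil (D j) (epsEnd K C D Ω M j)
  dim : dimVec K C D Ω M = n

omit hΩ hD hC in
theorem IsGood.of_equiv {T : Set I} {n : I → ℤ} {N : Type*} [AddCommGroup N]
    [Module (Preproj K C D Ω) N] [Module K N] [IsScalarTower K (Preproj K C D Ω) N]
    (h : IsGood K C D Ω T n M) (e : M ≃ₗ[𝒫] N) : IsGood K C D Ω T n N where
  noSoc j hj := noSoc_of_equiv e (h.noSoc j hj)
  free j := by
    obtain ⟨f, hf⟩ := exists_vspEquiv_of_equiv e j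
    exact (h.free j).of_equiv f hf
  dim := (dimVec_of_equiv e).trans h.dim

omit hC in
-- The kernel of the epimorphism in : X → e_iM between free H_i-modules.
theorem isFreeNil_epsKer {i : I} (hM : ∀ j, IsFreeNil (D j) (epsEnd K C D Ω M j))
    (h : InSurj K C D Ω M i) : IsFreeNil (D i) (epsKer K C D Ω M i) := by
  refine IsFreeNil.kernel (ε' := shiftX K C D Ω M i) (ε'' := epsEnd K C D Ω M i)
    (f := Submodule.subtype _) (g := LinearMap.codRestrict _ (inX K C D Ω M i)
      fun x => e_smul_inX x) (fun _ => rfl) (fun x => Subtype.ext (inX_shiftX x)) ?_ (fun x => ?_)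
    (Submodule.subtype_injective _) (shiftX_pow_eq_zero hΩ hD i)
    (isFreeNil_shiftX hΩ hD fun j _ => hM j) (hM i)
  · rintro ⟨m, hm⟩
    obtain ⟨x, rfl⟩ := h m hm
    exact ⟨x, rfl⟩
  · constructor
    · intro hx
      exact ⟨⟨x, congrArg Subtype.val hx⟩, rfl⟩
    · rintro ⟨u, rfl⟩
      exact Subtype.ext u.2

/-- When in is surjective, dim ker(in) = dim X - dim e_iM, so the replacement realizes s_i exactly.
-/
theorem isGood_up [FiniteDimensional K M] {T : Set I} {n : I → ℤ} (h : IsGood K C D Ω T n M)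
    {i : I} (hi : i ∈ T) (h' : InSurj K C D Ω M i) :
    IsGood K C D Ω T (refl C i n) (upData (K := K) (M := M) hΩ hD i).Space where
  noSoc := (upData (K := K) (M := M) hΩ hD i).noSoc (Submodule.subtype_injective _) hi h.noSoc
  free := (upData (K := K) (M := M) hΩ hD i).isFreeNil_space (isFreeNil_epsKer hΩ hD h.free h')
    h.free
  dim := by
    rw [VertexData.dimVec_space, refl_apply, ← h.dim, pairing_dimVec hC hΩ,
      sub_eq_add_neg (dimVec K C D Ω M), ← Pi.single_neg]
    have h1 := LinearMap.finrank_range_add_finrank_ker (inX K C D Ω M i)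
    have h2 := h'.finrank
    congr 2
    rw [dimVec]
    omega

/-- Under exactness, dim im(in) = dim X - dim e_iM, so the replacement realizes s_i exactly. -/
theorem isGood_down [FiniteDimensional K M] {T : Set I} {n : I → ℤ} (h : IsGood K C D Ω T n M)
    {i : I} (hi : i ∈ T) (h' : ExactX K C D Ω M i) :
    IsGood K C D Ω T (refl C i n) (downData (K := K) (M := M) hΩ hD i).Space where
  noSoc := (downData (K := K) (M := M) hΩ hD i).noSoc
    (downData_out_injective hΩ hD (h.noSoc i hi)) hi h.noSoc
  free := (downData (K := K) (M := M) hΩ hD i).isFreeNil_space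
    (isFreeNil_epsIm hΩ hD h.free (h.noSoc i hi) h') h.free
  dim := by
    rw [VertexData.dimVec_space, refl_apply, ← h.dim, pairing_dimVec hC hΩ,
      sub_eq_add_neg (dimVec K C D Ω M), ← Pi.single_neg]
    have h1 := LinearMap.finrank_range_add_finrank_ker (inX K C D Ω M i)
    have h2 := h'.finrank hΩ (h.noSoc i hi)
    congr 2
    rw [dimVec]
    omega

/-- Extremality places M at an end of its i-string; the sign of the pairing says which, and the
other end is the reflected module. -/
theorem exists_reflection [FiniteDimensional K M] {T : Set I} {n : I → ℤ}
    (h : IsGood K C D Ω T n M) {l : List I} (hl : ∀ i ∈ l, i ∈ T)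
    (hn : ∀ j ∈ T, wordAct C l n j = 0) {i : I} (hi : i ∈ T) :
    ∃ X : FDMod K C D Ω, IsGood K C D Ω T (refl C i n) X ∧ SameOff K C D Ω M X i := by
  have h1 := inSurj_or_exactX hΩ hD hC h.noSoc hl (by rw [h.dim]; exact hn) hi
  rcases le_total (pairing C i (dimVec K C D Ω M)) 0 with hp | hp
  · obtain ⟨X, ⟨e⟩⟩ := exists_fdMod_equiv (K := K) (C := C) (D := D) (Ω := Ω)
      (upData (K := K) (M := M) hΩ hD i).Space
    exact ⟨X, (isGood_up hΩ hD hC h hi (h1.1 hp)).of_equiv e,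
      (VertexData.sameOff _).trans hΩ (sameOff_of_equiv hΩ i e)⟩
  · obtain ⟨X, ⟨e⟩⟩ := exists_fdMod_equiv (K := K) (C := C) (D := D) (Ω := Ω)
      (downData (K := K) (M := M) hΩ hD i).Space
    exact ⟨X, (isGood_down hΩ hD hC h hi (h1.2.1 hp)).of_equiv e,
      (VertexData.sameOff _).trans hΩ (sameOff_of_equiv hΩ i e)⟩

/-- Starting from the module at n₀, the letters are undone from the last to the first. The remaining
word certifies extremality at each stage. -/
theorem exists_isGood {T : Set I} {n₀ : I → ℤ} (h₀ : ∀ j ∈ T, n₀ j = 0)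
    (hex : ∃ X : FDMod K C D Ω, IsGood K C D Ω T n₀ X) {l : List I} (hl : ∀ i ∈ l, i ∈ T)
    {n : I → ℤ} (hn : wordAct C l n = n₀) : ∃ X : FDMod K C D Ω, IsGood K C D Ω T n X := by
  induction l generalizing n with
  | nil => exact (show n = n₀ from hn) ▸ hex
  | cons i l ih =>
    have hl' : ∀ i ∈ l, i ∈ T := fun j hj => hl j (List.mem_cons_of_mem _ hj)
    obtain ⟨X, hX⟩ := ih hl' hn
    obtain ⟨Y, hY, -⟩ := exists_reflection hΩ hD hC hX hl'
      (fun j hj => (congrFun hn j).trans (h₀ j hj)) (hl i List.mem_cons_self)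
    rw [refl_refl hC] at hY
    exact ⟨Y, hY⟩

/-- Reflect both modules along the first letter. The results are isomorphic by induction, so X and Y
agree away from i; as they lie at the same end of the string, the space at i is determined too. -/
theorem nonempty_equiv_of_isGood {T : Set I} {n₀ : I → ℤ} (h₀ : ∀ j ∈ T, n₀ j = 0)
    (huniq : ∀ X Y : FDMod K C D Ω, IsGood K C D Ω T n₀ X → IsGood K C D Ω T n₀ Y →
      Nonempty (X ≃ₗ[𝒫] Y)) {l : List I} (hl : ∀ i ∈ l, i ∈ T)
    {n : I → ℤ} (hn : wordAct C l n = n₀) (X Y : FDMod K C D Ω) (hX : IsGood K C D Ω T n X)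
    (hY : IsGood K C D Ω T n Y) : Nonempty (X ≃ₗ[𝒫] Y) := by
  induction l generalizing n X Y with
  | nil =>
    obtain rfl : n = n₀ := hn
    exact huniq X Y hX hY
  | cons i l ih =>
    have hl' : ∀ i ∈ l, i ∈ T := fun j hj => hl j (List.mem_cons_of_mem _ hj)
    have hi : i ∈ T := hl i List.mem_cons_self
    have hn' : ∀ j ∈ T, wordAct C (i :: l) n j = 0 := fun j hj => (congrFun hn j).trans (h₀ j hj)
    obtain ⟨X', hX', hs⟩ := exists_reflection hΩ hD hC hX hl hn' hi
    obtain ⟨Y', hY', ht⟩ := exists_reflection hΩ hD hC hY hl hn' hi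
    obtain ⟨e⟩ := ih hl' hn X' Y' hX' hY'
    have hst := (hs.trans hΩ (sameOff_of_equiv hΩ i e)).trans hΩ ht.symm
    refine hst.nonempty_equiv hΩ (hX.noSoc i hi) (hY.noSoc i hi) ?_
    have h1 := inSurj_or_exactX hΩ hD hC hX.noSoc hl (by rw [hX.dim]; exact hn') hi
    have h2 := inSurj_or_exactX hΩ hD hC hY.noSoc hl (by rw [hY.dim]; exact hn') hi
    rw [hX.dim] at h1
    rw [hY.dim] at h2
    rcases le_total (pairing C i n) 0 with hp | hp
    · exact Or.inl ⟨h1.1 hp, h2.1 hp⟩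
    · exact Or.inr ⟨h1.2.1 hp, h2.2.1 hp⟩

end Modules

end FramedPreprojective
end

noncomputable section

namespace FramedPreprojective

/-! ## Modules on which all arrows vanish -/

section ZeroArrows

variable {K : Type u} [Field K] {I : Type w} [Fintype I] [DecidableEq I]
  {C : Matrix I I ℤ} {D : I → ℕ} {Ω : I → I → Prop}

local notation "𝒫" => Preproj K C D Ω

variable (K C D Ω) in
/-- All arrows act as zero. -/
def ZeroArrows (M : Type*) [AddCommGroup M] [Module (Preproj K C D Ω) M] : Prop :=
  ∀ i j h g, ∀ m : M, (gen (.arr i j h g) : 𝒫) • m = 0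

section Construction

variable {V : I → Type*} [∀ i, AddCommGroup (V i)] [∀ i, Module K (V i)]

/-- The endomorphism of a product acting on one factor only. -/
def endAt (i : I) : Module.End K (V i) →ₗ[K] Module.End K (∀ i, V i) where
  toFun f := LinearMap.single K V i ∘ₗ f ∘ₗ LinearMap.proj i
  map_add' f g := by ext; simp [LinearMap.add_comp, LinearMap.comp_add]
  map_smul' r f := by ext; simp [LinearMap.smul_comp, LinearMap.comp_smul]

theorem endAt_apply (i : I) (f : Module.End K (V i)) (x : ∀ i, V i) :
    endAt i f x = Pi.single i (f (x i)) := rfl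

theorem endAt_mul (i : I) (f g : Module.End K (V i)) :
    endAt i f * endAt i g = endAt i (f * g) := by
  refine LinearMap.ext fun x => ?_
  rw [Module.End.mul_apply, endAt_apply, endAt_apply, endAt_apply, Pi.single_eq_same]
  rfl

theorem endAt_mul_ne {i j : I} (h : i ≠ j) (f : Module.End K (V i)) (g : Module.End K (V j)) :
    endAt i f * endAt j g = 0 := by
  refine LinearMap.ext fun x => ?_
  rw [Module.End.mul_apply, endAt_apply, endAt_apply, Pi.single_eq_of_ne h, map_zero,
    Pi.single_zero]
  rfl

theorem endAt_pow (i : I) (f : Module.End K (V i)) (n : ℕ) :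
    endAt i f ^ (n + 1) = endAt i (f ^ (n + 1)) := by
  induction n with
  | zero => simp
  | succ n ih => rw [pow_succ, ih, endAt_mul, ← pow_succ]

/-- The action of the generators when all arrows vanish. -/
def zeroArrowMap (ε : ∀ i, Module.End K (V i)) : Gen C Ω → Module.End K (∀ i, V i)
  | .e i => endAt i 1
  | .eps i => endAt i (ε i)
  | .arr _ _ _ _ => 0

theorem zeroArrowMap_rel (hD : ∀ i, 1 ≤ D i) (ε : ∀ i, Module.End K (V i))
    (hε : ∀ i, ε i ^ D i = 0) ⦃x y : FreeAlgebra K (Gen C Ω)⦄ (h : Rel K C D Ω x y) :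
    FreeAlgebra.lift K (zeroArrowMap ε) x = FreeAlgebra.lift K (zeroArrowMap ε) y := by
  cases h with
  | e_mul_self i => simp [zeroArrowMap, endAt_mul]
  | e_mul_ne i j h => simp [zeroArrowMap, endAt_mul_ne h]
  | e_sum =>
    simp only [map_sum, FreeAlgebra.lift_ι_apply, map_one, zeroArrowMap]
    refine LinearMap.ext fun x => ?_
    rw [LinearMap.sum_apply]
    simp only [endAt_apply, Module.End.one_apply]
    exact Finset.univ_sum_single x
  | e_eps i => simp [zeroArrowMap, endAt_mul]
  | eps_e i => simp [zeroArrowMap, endAt_mul]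
  | e_arr i j h g => simp [zeroArrowMap]
  | arr_e i j h g => simp [zeroArrowMap]
  | P1 i =>
    obtain ⟨n, hn⟩ := Nat.exists_eq_add_of_le' (hD i)
    have := hε i
    rw [hn] at this
    rw [map_pow, map_zero, FreeAlgebra.lift_ι_apply, hn, zeroArrowMap, endAt_pow, this, map_zero]
  | P2 i j h g => simp [zeroArrowMap]
  | P3 i =>
    rw [mesh, map_sum, map_zero]
    refine Finset.sum_eq_zero fun j _ => ?_
    split_ifs <;> simp [zeroArrowMap]

theorem exists_zeroArrows_of_eps {V : I → Type u} [∀ i, AddCommGroup (V i)] [∀ i, Module K (V i)]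
    [∀ i, FiniteDimensional K (V i)] (hD : ∀ i, 1 ≤ D i) (ε : ∀ i, Module.End K (V i))
    (hε : ∀ i, ε i ^ D i = 0) :
    ∃ X : FDMod K C D Ω, ZeroArrows K C D Ω X ∧ ∀ i, ∃ f : V i ≃ₗ[K] vsp K C D Ω X i,
      ∀ v, f (ε i v) = epsEnd K C D Ω X i (f v) := by
  let ψ := Preproj.lift (zeroArrowMap (C := C) (Ω := Ω) ε) (zeroArrowMap_rel hD ε hε)
  let inst : Module 𝒫 (∀ i, V i) := Module.compHom _ ψ.toRingHom
  have hgen : ∀ (x : Gen C Ω) (z : ∀ i, V i), (gen x : 𝒫) • z = zeroArrowMap ε x z := fun x z => by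
    change ψ (gen x) z = _
    rw [Preproj.lift_gen]
  have tower : IsScalarTower K 𝒫 (∀ i, V i) := IsScalarTower.of_algebraMap_smul fun r z => by
    change ψ (algebraMap K 𝒫 r) z = _
    rw [AlgHom.commutes, Module.algebraMap_end_apply]
  obtain ⟨X, ⟨T⟩⟩ := exists_fdMod_equiv (K := K) (C := C) (D := D) (Ω := Ω) (∀ i, V i)
  refine ⟨X, fun i j h g m => ?_, fun i => ?_⟩
  · obtain ⟨z, rfl⟩ := T.surjective m
    rw [← map_smul, hgen]
    exact map_zero T
  · let f : V i ≃ₗ[K] vsp K C D Ω (∀ i, V i) i :=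
      { toFun := fun v => ⟨Pi.single i v, by
          rw [mem_vsp, hgen]
          change endAt i 1 _ = _
          rw [endAt_apply, Pi.single_eq_same]; rfl⟩
        map_add' := fun v v' => Subtype.ext (Pi.single_add i v v')
        map_smul' := fun r v => Subtype.ext (Pi.single_smul i r v)
        invFun := fun z => (z : ∀ i, V i) i
        left_inv := fun v => Pi.single_eq_same i v
        right_inv := fun z => Subtype.ext (by
          have h := e_smul_coe z
          rw [hgen] at h
          exact h) }
    have hf : ∀ v, f (ε i v) = epsEnd K C D Ω (∀ i, V i) i (f v) := fun v => Subtype.ext (by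
      rw [coe_epsEnd, hgen]
      change Pi.single i _ = endAt i (ε i) (Pi.single i v)
      rw [endAt_apply, Pi.single_eq_same])
    obtain ⟨f', hf'⟩ := exists_vspEquiv_of_equiv T i
    exact ⟨f.trans f', fun v => by rw [LinearEquiv.trans_apply, hf, hf', LinearEquiv.trans_apply]⟩

end Construction

variable {M : Type*} [AddCommGroup M] [Module (Preproj K C D Ω) M]
  [Module K M] [IsScalarTower K (Preproj K C D Ω) M]
  {N : Type*} [AddCommGroup N] [Module (Preproj K C D Ω) N]
  [Module K N] [IsScalarTower K (Preproj K C D Ω) N]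

variable (K C Ω) in
/-- Locally free modules of any rank on which all arrows vanish. -/
theorem exists_zeroArrows (hD : ∀ i, 1 ≤ D i) (a : I → ℕ) :
    ∃ X : FDMod K C D Ω, ZeroArrows K C D Ω X ∧
      ∀ i, HasRankAt (K := K) (C := C) (D := D) (Ω := Ω) X i (a i) := by
  let V : I → Type u := fun i => Fin (a i) → Hring K D i
  let ε : ∀ i, Module.End K (V i) := fun i => Algebra.lsmul K K (V i)
    (Ideal.Quotient.mk (Ideal.span {(Polynomial.X : Polynomial K) ^ D i}) Polynomial.X)
  have hε : ∀ i, ε i ^ D i = 0 := fun i => by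
    rw [← map_pow, ← map_pow, Ideal.Quotient.eq_zero_iff_mem.2 (Ideal.mem_span_singleton_self _),
      map_zero]
  have hfin : ∀ i, Module.Finite K (Hring K D i) := fun i =>
    Polynomial.Monic.finite_quotient (Polynomial.monic_X_pow (D i))
  have hV : ∀ i, IsFreeNil (D i) (ε i) ∧ FiniteDimensional K (V i) ∧
      Module.finrank K (V i) = D i * a i := fun i => by
    refine isFreeNil_of_freeEquiv (LinearEquiv.refl K (V i)) fun p x => ?_
    have : Polynomial.aeval (ε i) p = Algebra.lsmul K K (V i)
        (Ideal.Quotient.mk (Ideal.span {(Polynomial.X : Polynomial K) ^ D i}) p) := by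
      rw [Polynomial.aeval_algHom_apply]
      congr 1
      exact (Polynomial.aeval_algHom_apply (Ideal.Quotient.mkₐ K
        (Ideal.span {(Polynomial.X : Polynomial K) ^ D i})) Polynomial.X p).trans (by
          rw [Polynomial.aeval_X_left_apply]; rfl)
    rw [this]
    rfl
  have hVfin : ∀ i, FiniteDimensional K (V i) := fun i => (hV i).2.1
  obtain ⟨X, hX, h⟩ := exists_zeroArrows_of_eps (C := C) (Ω := Ω) hD ε hε
  refine ⟨X, hX, fun i => ?_⟩
  obtain ⟨f, hf⟩ := h i
  rw [hasRankAt_iff (hD i)]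
  exact ⟨(hV i).1.of_equiv f hf, inferInstance, by rw [← f.finrank_eq, (hV i).2.2]⟩

/-- Locally free modules on which all arrows vanish are determined by their ranks. -/
theorem ZeroArrows.nonempty_equiv [FiniteDimensional K M] [FiniteDimensional K N]
    (hD : ∀ i, 1 ≤ D i) (hM : ZeroArrows K C D Ω M)
    (hN : ZeroArrows K C D Ω N) (hM' : ∀ j, IsFreeNil (D j) (epsEnd K C D Ω M j))
    (hN' : ∀ j, IsFreeNil (D j) (epsEnd K C D Ω N j))
    (h : dimVec K C D Ω M = dimVec K C D Ω N) : Nonempty (M ≃ₗ[𝒫] N) := by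
  have hex : ∀ j, ∃ f : vsp K C D Ω M j ≃ₗ[K] vsp K C D Ω N j,
      ∀ m, f (epsEnd K C D Ω M j m) = epsEnd K C D Ω N j (f m) := by
    intro j
    have h1 := isFreeNil_finrank (epsEnd_pow_eq_zero j) (hM' j)
    have hj : Module.finrank K (vsp K C D Ω M j) = Module.finrank K (vsp K C D Ω N j) :=
  Int.ofNat_inj.1 (congrFun h j)
    obtain ⟨Φ, hΦ⟩ := (hM' j).exists_freeEquiv (hD j) (epsEnd_pow_eq_zero j) h1
    obtain ⟨Ψ, hΨ⟩ := (hN' j).exists_freeEquiv (hD j) (epsEnd_pow_eq_zero j) (hj.symm.trans h1)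
    refine ⟨Φ.symm.trans Ψ, fun m => ?_⟩
    obtain ⟨x, rfl⟩ := Φ.surjective m
    have h2 := hΦ Polynomial.X x
    have h3 := hΨ Polynomial.X x
    rw [Polynomial.aeval_X] at h2 h3
    rw [← h2, LinearEquiv.trans_apply, LinearEquiv.trans_apply, Φ.symm_apply_apply,
      Φ.symm_apply_apply, h3]
  choose f hf using hex
  let T : M →ₗ[K] N := ∑ j, (vsp K C D Ω N j).subtype ∘ₗ (f j).toLinearMap ∘ₗ projV K C D Ω M j
  let S : N →ₗ[K] M := ∑ j, (vsp K C D Ω M j).subtype ∘ₗ (f j).symm.toLinearMap ∘ₗ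
    projV K C D Ω N j
  have hT : ∀ m, T m = ∑ j, (f j (projV K C D Ω M j m) : N) := fun m => by
    simp [T, LinearMap.sum_apply]
  have hS : ∀ m, S m = ∑ j, ((f j).symm (projV K C D Ω N j m) : M) := fun m => by
    simp [S, LinearMap.sum_apply]
  have hpT : ∀ j m, projV K C D Ω N j (T m) = f j (projV K C D Ω M j m) := fun j m => by
    refine Subtype.ext ?_
    rw [coe_projV, hT, Finset.smul_sum, Finset.sum_eq_single j, e_smul_coe]
    · exact fun k _ hk => e_smul_coe_ne hk.symm _
    · exact fun hj => absurd (Finset.mem_univ j) hj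
  have hpS : ∀ j m, projV K C D Ω M j (S m) = (f j).symm (projV K C D Ω N j m) := fun j m => by
    refine Subtype.ext ?_
    rw [coe_projV, hS, Finset.smul_sum, Finset.sum_eq_single j, e_smul_coe]
    · exact fun k _ hk => e_smul_coe_ne hk.symm _
    · exact fun hj => absurd (Finset.mem_univ j) hj
  have hgen : ∀ (x : Gen C Ω) (m : M), T ((gen x : 𝒫) • m) = (gen x : 𝒫) • T m := by
    intro x m
    cases x with
    | e i =>
      rw [← coe_projV i (T m), hpT, hT, Finset.sum_eq_single i]
      · have : projV K C D Ω M i ((gen (.e i) : 𝒫) • m) = projV K C D Ω M i m :=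
          Subtype.ext (e_smul_e i m)
        rw [this]
      · intro k _ hk
        have : projV K C D Ω M k ((gen (.e i) : 𝒫) • m) = 0 := Subtype.ext (e_smul_e_ne hk m)
        rw [this, map_zero]; rfl
      · exact fun hj => absurd (Finset.mem_univ i) hj
    | eps i =>
      rw [← eps_smul_e i (T m), ← coe_projV i (T m), hpT, hT, Finset.sum_eq_single i]
      · rw [← coe_epsEnd, ← hf]
        have : projV K C D Ω M i ((gen (.eps i) : 𝒫) • m) =
            epsEnd K C D Ω M i (projV K C D Ω M i m) :=
          Subtype.ext ((e_smul_eps i m).trans (eps_smul_e i m).symm)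
        rw [this]
      · intro k _ hk
        have : projV K C D Ω M k ((gen (.eps i) : 𝒫) • m) = 0 := Subtype.ext (e_smul_eps_ne hk m)
        rw [this, map_zero]; rfl
      · exact fun hj => absurd (Finset.mem_univ i) hj
    | arr i j h g => rw [hM, hN, map_zero]
  refine ⟨{ T with
    map_smul' := fun a m => map_smul_of_gen T hgen a m
    invFun := S
    left_inv := fun m => ?_
    right_inv := fun n => ?_ }⟩
  · change S (T m) = m
    rw [hS]
    simp only [hpT, LinearEquiv.symm_apply_apply, coe_projV]
    exact sum_e_smul m
  · change T (S n) = n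
    rw [hT]
    simp only [hpS, LinearEquiv.apply_symm_apply, coe_projV]
    exact sum_e_smul n

end ZeroArrows

/-! ## Filtrations by generalized simple modules -/

section Filtrations

variable {K : Type u} [Field K] {I : Type w} [Fintype I] [DecidableEq I]
  {C : Matrix I I ℤ} {D : I → ℕ} {Ω : I → I → Prop}

local notation "𝒫" => Preproj K C D Ω

variable {M : Type*} [AddCommGroup M] [Module (Preproj K C D Ω) M]
  [Module K M] [IsScalarTower K (Preproj K C D Ω) M]
  {N : Type*} [AddCommGroup N] [Module (Preproj K C D Ω) N]
  [Module K N] [IsScalarTower K (Preproj K C D Ω) N]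

variable (K C D Ω M) in
/-- One step of a filtration by generalized simple modules. -/
def GenStep (A B : Submodule (Preproj K C D Ω) M) : Prop :=
  A < B ∧ ∃ j : I, IsGenSimple K C D Ω (B ⧸ A.submoduleOf B) j

theorem isGenSimple_of_equiv (hD : ∀ i, 1 ≤ D i) (T : M ≃ₗ[𝒫] N) {j : I}
    (h : IsGenSimple K C D Ω M j) : IsGenSimple K C D Ω N j :=
  fun i => hasRankAt_of_equiv T (hD i) (h i)

omit [Module K M] [IsScalarTower K (Preproj K C D Ω) M] [Module K N]
  [IsScalarTower K (Preproj K C D Ω) N] in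
theorem nonempty_subquotient_equiv (f : M →ₗ[𝒫] N) {A B : Submodule 𝒫 M} {A' B' : Submodule 𝒫 N}
    (hB : B.map f = B') (hA : ∀ x ∈ B, f x ∈ A' ↔ x ∈ A) :
    Nonempty ((B ⧸ A.submoduleOf B) ≃ₗ[𝒫] (B' ⧸ A'.submoduleOf B')) := by
  let h : B →ₗ[𝒫] B' ⧸ A'.submoduleOf B' := (A'.submoduleOf B').mkQ ∘ₗ
    (f.restrict fun x hx => hB ▸ Submodule.mem_map_of_mem hx)
  have hs : Function.Surjective h := by
    intro q
    obtain ⟨⟨y, hy⟩, rfl⟩ := Submodule.Quotient.mk_surjective _ q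
    obtain ⟨x, hx, rfl⟩ : y ∈ B.map f := hB ▸ hy
    exact ⟨⟨x, hx⟩, rfl⟩
  have hk : LinearMap.ker h = A.submoduleOf B := by
    ext x
    rw [LinearMap.mem_ker]
    change (Submodule.Quotient.mk _ : B' ⧸ A'.submoduleOf B') = 0 ↔ _
    rw [Submodule.Quotient.mk_eq_zero]
    exact hA x x.2
  exact ⟨(Submodule.quotEquivOfEq _ _ hk.symm).trans (h.quotKerEquivOfSurjective hs)⟩

theorem GenStep.map (hD : ∀ i, 1 ≤ D i) {f : M →ₗ[𝒫] N} (hf : Function.Injective f)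
    {A B : Submodule 𝒫 M} (h : GenStep K C D Ω M A B) :
    GenStep K C D Ω N (A.map f) (B.map f) := by
  obtain ⟨h1, j, h2⟩ := h
  obtain ⟨T⟩ := nonempty_subquotient_equiv f (A := A) (A' := A.map f) (B := B) rfl fun x _ => by
    exact ⟨fun ⟨y, hy, hxy⟩ => hf hxy ▸ hy, fun hx => ⟨x, hx, rfl⟩⟩
  exact ⟨Submodule.map_strictMono_of_injective hf h1, j, isGenSimple_of_equiv hD T h2⟩

theorem GenStep.comap (hD : ∀ i, 1 ≤ D i) {f : M →ₗ[𝒫] N} (hf : Function.Surjective f)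
    {A B : Submodule 𝒫 N} (h : GenStep K C D Ω N A B) :
    GenStep K C D Ω M (A.comap f) (B.comap f) := by
  obtain ⟨h1, j, h2⟩ := h
  obtain ⟨T⟩ := nonempty_subquotient_equiv f (A := A.comap f) (A' := A)
    (Submodule.map_comap_eq_of_surjective hf B) fun x _ => Iff.rfl
  exact ⟨Submodule.comap_strictMono_of_surjective hf h1, j, isGenSimple_of_equiv hD T.symm h2⟩

/-- Filtrations as chains of a relation between submodules, so that they can be concatenated and
carried along homomorphisms without bookkeeping of indices. -/
theorem isEFiltered_iff : IsEFiltered K C D Ω M ↔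
    IsLocallyFree K C D Ω M ∧ Relation.ReflTransGen (GenStep K C D Ω M) ⊥ ⊤ := by
  refine and_congr_right fun _ => ⟨?_, fun h => ?_⟩
  · rintro ⟨n, F, h0, hn, hF⟩
    have : ∀ k : Fin (n + 1), Relation.ReflTransGen (GenStep K C D Ω M) ⊥ (F k) := by
      intro k
      induction k using Fin.induction with
      | zero => rw [h0]
      | succ k ih => exact ih.tail (hF k)
    exact hn ▸ this (Fin.last n)
  · obtain ⟨n, F, h0, hn, hF⟩ : ∃ (n : ℕ) (F : Fin (n + 1) → Submodule 𝒫 M), F 0 = ⊥ ∧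
        F (Fin.last n) = ⊤ ∧ ∀ k : Fin n, GenStep K C D Ω M (F k.castSucc) (F k.succ) := by
      generalize (⊤ : Submodule 𝒫 M) = B at h
      induction h with
      | refl => exact ⟨0, fun _ => ⊥, rfl, rfl, fun k => k.elim0⟩
      | tail _ h ih =>
        obtain ⟨n, F, h0, hn, hF⟩ := ih
        refine ⟨n + 1, Fin.snoc F _, ?_, Fin.snoc_last _ _, fun k => ?_⟩
        · rw [← Fin.castSucc_zero, Fin.snoc_castSucc, h0]
        · induction k using Fin.lastCases with
          | last => rw [Fin.snoc_castSucc, Fin.succ_last, Fin.snoc_last, hn]; exact h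
          | cast k => rw [Fin.snoc_castSucc, Fin.succ_castSucc, Fin.snoc_castSucc]; exact hF k
    exact ⟨n, F, h0, hn, hF⟩

/-- The filtration of N is pushed forward and that of the quotient is pulled back; they meet at the
range of f. -/
theorem reflTransGen_of_quotient (hD : ∀ i, 1 ≤ D i) {f : N →ₗ[𝒫] M} (hf : Function.Injective f)
    (h1 : Relation.ReflTransGen (GenStep K C D Ω N) ⊥ ⊤)
    (h2 : Relation.ReflTransGen (GenStep K C D Ω (M ⧸ LinearMap.range f)) ⊥ ⊤) :
    Relation.ReflTransGen (GenStep K C D Ω M) ⊥ ⊤ := by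
  have h3 := h1.lift (Submodule.map f) fun A B h => GenStep.map hD hf h
  have h4 := h2.lift (Submodule.comap (LinearMap.range f).mkQ) fun A B h =>
    GenStep.comap hD (Submodule.mkQ_surjective _) h
  rw [Function.onFun, Submodule.map_bot, Submodule.map_top] at h3
  rw [Function.onFun, Submodule.comap_bot, Submodule.ker_mkQ, Submodule.comap_top] at h4
  exact h3.trans h4

end Filtrations

end FramedPreprojective
end

noncomputable section

namespace FramedPreprojective

open Polynomial in
-- The annihilator of x is an ideal containing X^c, hence generated by a power of X. It omits
-- X^(c-1), so it is generated by X^c, and V is K[X]/(X^c).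
theorem isFreeNil_of_cyclic {K : Type u} [Field K] {V : Type*} [AddCommGroup V] [Module K V]
    {ε : Module.End K V} {c : ℕ} (hc : 0 < c) (hε : ε ^ c = 0) {x : V} (hx : (ε ^ (c - 1)) x ≠ 0)
    (hspan : ∀ y, ∃ p : K[X], aeval ε p x = y) :
    IsFreeNil c ε ∧ FiniteDimensional K V ∧ Module.finrank K V = c * 1 := by
  let J : Ideal K[X] :=
    { carrier := {p | aeval ε p x = 0}
      zero_mem' := by simp
      add_mem' := fun {p q} hp hq => by
        simp only [Set.mem_ofPred_eq] at *
        rw [map_add, LinearMap.add_apply, hp, hq, add_zero]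
      smul_mem' := fun r p hp => by
        simp only [Set.mem_ofPred_eq] at *
        rw [smul_eq_mul, map_mul, Module.End.mul_apply, hp, map_zero] }
  have hmem : ∀ p, p ∈ J ↔ aeval ε p x = 0 := fun p => Iff.rfl
  have hJ : J = Ideal.span {X ^ c} := by
    obtain ⟨g, hg⟩ : ∃ g, J = Ideal.span {g} := (IsPrincipalIdealRing.principal J).principal
    have h1 : g ∣ X ^ c := Ideal.mem_span_singleton.1 (hg ▸ (hmem _).2 (by
      rw [map_pow, aeval_X, hε, LinearMap.zero_apply]))
    obtain ⟨k, hk, hgk⟩ := (dvd_prime_pow prime_X c).1 h1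
    obtain rfl : k = c := by
      by_contra hne
      refine hx ?_
      have h2 : X ^ (c - 1) ∈ J := by
        rw [hg, Ideal.mem_span_singleton]
        exact hgk.dvd.trans (pow_dvd_pow _ (by omega))
      rw [hmem, map_pow, aeval_X] at h2
      exact h2
    rw [hg]
    exact Ideal.span_singleton_eq_span_singleton.2 hgk
  let L : K[X] →ₗ[K] V := LinearMap.applyₗ x ∘ₗ (aeval ε).toLinearMap
  have hker : LinearMap.ker L = (Ideal.span {(X : K[X]) ^ c}).restrictScalars K := by
    rw [← hJ]; rfl
  let e := (Submodule.Quotient.restrictScalarsEquiv K (Ideal.span {(X : K[X]) ^ c})).symm.trans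
    ((Submodule.quotEquivOfEq _ _ hker.symm).trans (L.quotKerEquivOfSurjective hspan))
  have hfin : Module.Finite K (K[X] ⧸ Ideal.span {(X : K[X]) ^ c}) :=
    Polynomial.Monic.finite_quotient (monic_X_pow c)
  have hV : FiniteDimensional K V := Module.Finite.equiv e
  have hdim : Module.finrank K V = c * 1 := by
    rw [← e.finrank_eq, finrank_truncated, mul_one]
  obtain ⟨Φ, hΦ⟩ := exists_freeEquiv_of_span hε hdim (fun _ => x) fun y => by
    obtain ⟨p, rfl⟩ := hspan y
    refine ⟨fun _ => p.coeff 0, aeval ε p.divX x, ?_⟩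
    have h : aeval ε (X * p.divX + C (p.coeff 0)) x = aeval ε p x := by
      rw [mul_comm, divX_mul_X_add]
    rw [← h, map_add, map_mul, aeval_X, aeval_C]
    simp [add_comm]
  exact isFreeNil_of_freeEquiv Φ hΦ

/-! ### Existence of filtrations by generalized simple modules -/

section Filtrations

variable {K : Type u} [Field K] {I : Type w} [Fintype I] [DecidableEq I]
  {C : Matrix I I ℤ} {D : I → ℕ} {Ω : I → I → Prop}

local notation "𝒫" => Preproj K C D Ω

section

variable {M : Type*} [AddCommGroup M] [Module (Preproj K C D Ω) M]
  [Module K M] [IsScalarTower K (Preproj K C D Ω) M]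
  {N : Type*} [AddCommGroup N] [Module (Preproj K C D Ω) N]
  [Module K N] [IsScalarTower K (Preproj K C D Ω) N]

theorem isFreeNil_quotient (B : Submodule 𝒫 M) {i : I}
    (hB : IsFreeNil (D i) (epsEnd K C D Ω B i)) (hM : IsFreeNil (D i) (epsEnd K C D Ω M i)) :
    IsFreeNil (D i) (epsEnd K C D Ω (M ⧸ B) i) := by
  let f : vsp K C D Ω B i →ₗ[K] vsp K C D Ω M i :=
    (B.subtype.restrictScalars K).restrict fun m hm => congrArg Subtype.val hm
  let g : vsp K C D Ω M i →ₗ[K] vsp K C D Ω (M ⧸ B) i :=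
    (B.mkQ.restrictScalars K).restrict fun m hm => by
      rw [mem_vsp]; exact (map_smul B.mkQ _ _).symm.trans (congrArg B.mkQ hm)
  have hg : ∀ v, g v = 0 ↔ (v : M) ∈ B := fun v => by
    rw [← Submodule.Quotient.mk_eq_zero, Subtype.ext_iff]; rfl
  refine IsFreeNil.quotient (f := f) (g := g) (fun _ => rfl) (fun _ => rfl) ?_ (fun v => ?_)
    (fun u v h => by
      have h0 := congrArg Subtype.val h
      exact Subtype.ext (Subtype.ext h0)) (epsEnd_pow_eq_zero i) hB hM
  · rintro ⟨q, hq⟩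
    obtain ⟨m, rfl⟩ := Submodule.Quotient.mk_surjective _ q
    exact ⟨projV K C D Ω M i m, Subtype.ext hq⟩
  · rw [hg]
    exact ⟨fun hv => ⟨⟨⟨v, hv⟩, Subtype.ext v.2⟩, rfl⟩, fun ⟨u, hu⟩ => hu ▸ (u : B).2⟩

theorem hasRankAt_zero (hD : ∀ i, 1 ≤ D i) {i : I}
    (h : ∀ m : M, (gen (.e i) : 𝒫) • m = m → m = 0) :
    HasRankAt (K := K) (C := C) (D := D) (Ω := Ω) M i 0 := by
  have hs : Subsingleton (vsp K C D Ω M i) :=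
    subsingleton_of_forall_eq 0 fun m => Subtype.ext (h m m.2)
  rw [hasRankAt_iff (hD i)]
  exact ⟨fun k _ v _ => ⟨0, Subsingleton.elim _ _⟩, inferInstance, by
    rw [Module.finrank_zero_of_subsingleton, mul_zero]⟩

/-- With no arrows acting, the submodule generated by x consists of the polynomials in ε_j applied
to x, and `isFreeNil_of_cyclic` applies. -/
theorem isGenSimple_span (hD : ∀ i, 1 ≤ D i) (hM : ZeroArrows K C D Ω M) {j : I} {x : M}
    (hx : (gen (.e j) : 𝒫) • x = x) (hx' : (gen (.eps j) ^ (D j - 1) : 𝒫) • x ≠ 0) :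
    IsGenSimple K C D Ω (Submodule.span 𝒫 {x}) j := by
  have hcyc : ∀ (a : 𝒫) (p : Polynomial K), ∃ q : Polynomial K,
      a • (Polynomial.aeval (epsEnd K C D Ω M j) p ⟨x, hx⟩ : M) =
        Polynomial.aeval (epsEnd K C D Ω M j) q ⟨x, hx⟩ := by
    intro a
    induction a using preproj_induction with
    | hK r => exact fun p => ⟨r • p, by rw [map_smul, algebraMap_smul]; rfl⟩
    | hg y =>
      intro p
      cases y with
      | e i =>
        by_cases hi : i = j
        · subst hi; exact ⟨p, e_smul_coe _⟩
        · exact ⟨0, by rw [e_smul_coe_ne hi, map_zero]; rfl⟩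
      | eps i =>
        by_cases hi : i = j
        · subst hi
          exact ⟨Polynomial.X * p, by rw [map_mul, Polynomial.aeval_X]; rfl⟩
        · exact ⟨0, by rw [← e_smul_coe, eps_smul_e_ne hi, map_zero]; rfl⟩
      | arr i k h g => exact ⟨0, by rw [hM, map_zero]; rfl⟩
    | hadd a b ha hb =>
      intro p
      obtain ⟨q, hq⟩ := ha p
      obtain ⟨q', hq'⟩ := hb p
      exact ⟨q + q', by rw [add_smul, hq, hq', map_add]; rfl⟩
    | hmul a b ha hb =>
      intro p
      obtain ⟨q, hq⟩ := hb p
      obtain ⟨q', hq'⟩ := ha q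
      exact ⟨q', by rw [mul_smul, hq, hq']⟩
  have hspan : ∀ y : Submodule.span 𝒫 {x}, ∃ p : Polynomial K,
      (Polynomial.aeval (epsEnd K C D Ω M j) p ⟨x, hx⟩ : M) = y := by
    rintro ⟨y, hy⟩
    obtain ⟨a, rfl⟩ := Submodule.mem_span_singleton.1 hy
    obtain ⟨q, hq⟩ := hcyc a 1
    rw [map_one] at hq
    exact ⟨q, hq.symm⟩
  intro i
  split_ifs with hi
  · subst hi
    rw [hasRankAt_iff (hD i)]
    let x' : vsp K C D Ω (Submodule.span 𝒫 {x}) i :=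
      ⟨⟨x, Submodule.mem_span_singleton_self x⟩, Subtype.ext hx⟩
    refine isFreeNil_of_cyclic (hD i) (epsEnd_pow_eq_zero i) (x := x') ?_ fun y => ?_
    · intro h0
      have h1 := congrArg Subtype.val h0
      rw [coe_epsEnd_pow] at h1
      exact hx' (congrArg Subtype.val h1)
    · obtain ⟨p, hp⟩ := hspan y
      refine ⟨p, Subtype.ext (Subtype.ext ?_)⟩
      rw [coe_aeval_epsEnd, ← hp, coe_aeval_epsEnd]
      rfl
  · refine hasRankAt_zero hD fun m hm => Subtype.ext ?_
    obtain ⟨p, hp⟩ := hspan m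
    rw [← hm, Submodule.coe_smul, ← hp, e_smul_coe_ne hi]
    rfl

theorem genStep_bot_top (hD : ∀ i, 1 ≤ D i) [Nontrivial M] {j : I}
    (h : IsGenSimple K C D Ω M j) : GenStep K C D Ω M ⊥ ⊤ := by
  refine ⟨bot_lt_top, j, isGenSimple_of_equiv hD (Submodule.topEquiv.symm.trans
    (Submodule.quotEquivOfEqBot ((⊥ : Submodule 𝒫 M).submoduleOf ⊤) ?_).symm) h⟩
  rw [Submodule.submoduleOf, Submodule.comap_bot, Submodule.ker_subtype]

theorem reflTransGen_of_equiv (hD : ∀ i, 1 ≤ D i) (e : M ≃ₗ[𝒫] N)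
    (h : Relation.ReflTransGen (GenStep K C D Ω M) ⊥ ⊤) :
    Relation.ReflTransGen (GenStep K C D Ω N) ⊥ ⊤ := by
  have h1 := h.lift (Submodule.map e.toLinearMap) fun A B h => GenStep.map hD e.injective h
  rw [Function.onFun, Submodule.map_bot, Submodule.map_top, LinearEquiv.range] at h1
  exact h1

end

/-- Locally free modules on which all arrows vanish have a filtration by generalized simple
modules. -/
theorem ZeroArrows.reflTransGen (hD : ∀ i, 1 ≤ D i) {M : Type v} [AddCommGroup M] [Module 𝒫 M]
    [Module K M] [IsScalarTower K 𝒫 M] [FiniteDimensional K M]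
    (hM : ZeroArrows K C D Ω M) (hM' : ∀ j, IsFreeNil (D j) (epsEnd K C D Ω M j)) :
    Relation.ReflTransGen (GenStep K C D Ω M) ⊥ ⊤ := by
  suffices ∀ (n : ℕ) (M : Type v) [AddCommGroup M] [Module 𝒫 M] [Module K M]
      [IsScalarTower K 𝒫 M] [FiniteDimensional K M], Module.finrank K M = n →
      ZeroArrows K C D Ω M → (∀ j, IsFreeNil (D j) (epsEnd K C D Ω M j)) →
      Relation.ReflTransGen (GenStep K C D Ω M) ⊥ ⊤ from this _ M rfl hM hM'
  intro n
  induction n using Nat.strong_induction_on with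
  | _ n ih =>
    intro M _ _ _ _ _ hn hM hM'
    rcases subsingleton_or_nontrivial M with hs | hs
    · rw [Subsingleton.elim (⊥ : Submodule 𝒫 M) ⊤]
    obtain ⟨m, hm⟩ := exists_ne (0 : M)
    obtain ⟨j, hj⟩ : ∃ j, (gen (.e j) : 𝒫) • m ≠ 0 := by
      by_contra! h
      refine hm ?_
      rw [← sum_e_smul (K := K) (C := C) (D := D) (Ω := Ω) m]
      exact Finset.sum_eq_zero fun j _ => h j
    -- If the top power of ε_j vanished on e_jM, freeness would make ε_j injective, hence e_jM = 0
    -- by nilpotency. Such an x generates a free rank one submodule, and the quotient by it is again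
    -- locally free and smaller.
    obtain ⟨x, hx⟩ : ∃ x : vsp K C D Ω M j, (epsEnd K C D Ω M j ^ (D j - 1)) x ≠ 0 := by
      by_contra! h
      have hker : ∀ v, epsEnd K C D Ω M j v = 0 → v = 0 := fun v hv => by
        obtain ⟨w, hw⟩ := hM' j 1 (hD j) v (by rw [pow_one, hv])
        rw [← hw, h]
      have hinj : Function.Injective (epsEnd K C D Ω M j ^ D j) := by
        rw [Module.End.coe_pow]
        exact ((injective_iff_map_eq_zero _).2 hker).iterate _
      refine hj (congrArg Subtype.val (hinj (a₁ := projV K C D Ω M j m) (a₂ := 0) ?_))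
      rw [epsEnd_pow_eq_zero, LinearMap.zero_apply, LinearMap.zero_apply]
    have hx0 : (gen (.eps j) ^ (D j - 1) : 𝒫) • (x : M) ≠ 0 := fun h0 =>
      hx (Subtype.ext (by rw [coe_epsEnd_pow, h0]; rfl))
    set B := Submodule.span 𝒫 {(x : M)} with hB
    have hgs : IsGenSimple K C D Ω B j := isGenSimple_span hD hM x.2 hx0
    have hxB : (x : M) ∈ B := Submodule.mem_span_singleton_self _
    have hxne : (⟨x, hxB⟩ : B) ≠ 0 := fun h0 => hx0 (by
      rw [show (x : M) = 0 from congrArg Subtype.val h0, smul_zero])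
    have hnt : Nontrivial B := ⟨_, _, hxne⟩
    have hlt : Module.finrank K (M ⧸ B) < n := by
      have h1 := LinearMap.finrank_range_add_finrank_ker (B.mkQ.restrictScalars K)
      have h2 : 0 < Module.finrank K (LinearMap.ker (B.mkQ.restrictScalars K)) := by
        have : Nontrivial (LinearMap.ker (B.mkQ.restrictScalars K)) :=
          ⟨⟨x, (Submodule.Quotient.mk_eq_zero B).2 hxB⟩, 0, fun h0 => by
            have h3 := congrArg Subtype.val h0
            exact hxne (Subtype.ext h3)⟩
        exact Module.finrank_pos
      rw [LinearMap.range_eq_top.2 (show Function.Surjective (B.mkQ.restrictScalars K) from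
        Submodule.mkQ_surjective B), finrank_top] at h1
      omega
    have hquot := ih _ hlt (M ⧸ B) rfl (fun i k h g q => by
      obtain ⟨m, rfl⟩ := Submodule.Quotient.mk_surjective _ q
      rw [← Submodule.Quotient.mk_smul, hM, Submodule.Quotient.mk_zero]) fun i =>
        isFreeNil_quotient B ((hasRankAt_iff (hD i) _).1 (hgs i)).1 (hM' i)
    refine reflTransGen_of_quotient hD (f := B.subtype) (Submodule.subtype_injective B)
      (Relation.ReflTransGen.single (genStep_bot_top hD hgs)) ?_
    rw [Submodule.range_subtype]
    exact hquot

section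

variable {M : Type*} [AddCommGroup M] [Module (Preproj K C D Ω) M]
  [Module K M] [IsScalarTower K (Preproj K C D Ω) M]

/-- Filtrations by generalized simple modules extend along reflections. -/
theorem reflTransGen_up [FiniteDimensional K M] (hΩ : IsOrientation C Ω) (hD : IsSymmetrizer C D)
    (hC : IsGCM C) {T : Set I} {n : I → ℤ} (h : IsGood K C D Ω T n M) {i : I} (hi : i ∈ T)
    (h' : InSurj K C D Ω M i) (hM : Relation.ReflTransGen (GenStep K C D Ω M) ⊥ ⊤) :
    Relation.ReflTransGen (GenStep K C D Ω (upData (K := K) (M := M) hΩ hD i).Space) ⊥ ⊤ := by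
  set d := upData (K := K) (M := M) hΩ hD i with hd
  have hgood := isGood_up hΩ hD hC h hi h'
  -- M embeds in the enlarged module: out maps e_iM into the new space ker(in), compatibly with the
  -- identity away from i. The image contains everything away from i, so the quotient is
  -- concentrated at i, without arrows, and locally free.
  obtain ⟨F, h1, h2⟩ := d.offHom_ofOld.extend hΩ (hgood.noSoc i hi)
    (d.offHom_ofOld.outX_of_inSurj h')
  have hF : Function.Injective F := d.offHom_ofOld.injective_of_extend hΩ
    (G := d.old) (fun m hm => by rw [d.old_ofOld, hm, sub_zero]) (h.noSoc i hi) h1 h2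
  have he : ∀ j ≠ i, ∀ z : d.Space, (gen (.e j) : 𝒫) • z ∈ LinearMap.range F := by
    intro j hj z
    rw [← d.ofOld_old (e_smul_e_ne (Ne.symm hj) z), ← h1]
    exact Submodule.sub_mem _ (LinearMap.mem_range_self F _)
      (Submodule.smul_mem _ _ (LinearMap.mem_range_self F _))
  have hq : ∀ q : d.Space ⧸ LinearMap.range F, (gen (.e i) : 𝒫) • q = q := by
    intro q
    conv_rhs => rw [← sum_e_smul (K := K) (C := C) (D := D) (Ω := Ω) q]
    rw [Finset.sum_eq_single i (fun j _ hj => ?_) fun hi => absurd (Finset.mem_univ i) hi]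
    obtain ⟨z, rfl⟩ := Submodule.Quotient.mk_surjective _ q
    rw [← Submodule.Quotient.mk_smul, Submodule.Quotient.mk_eq_zero]
    exact he j hj z
  refine reflTransGen_of_quotient hD.pos hF hM (ZeroArrows.reflTransGen hD.pos
    (gen_arr_smul_eq_zero hΩ hq) fun j => isFreeNil_quotient _ ?_ (hgood.free j))
  obtain ⟨f, hf⟩ := exists_vspEquiv_of_equiv (LinearEquiv.ofInjective F hF) j
  exact (h.free j).of_equiv f hf

end

end Filtrations

end FramedPreprojective
end

noncomputable section

namespace FramedPreprojective

/-! ## More on reflections of dimension vectors -/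

section Vectors

variable {I : Type w} [Fintype I] [DecidableEq I] {C : Matrix I I ℤ}

theorem pairing_refl_self (hC : IsGCM C) (i : I) (n : I → ℤ) :
    pairing C i (refl C i n) = - pairing C i n := by
  rw [refl_apply, map_sub, pairing_single_self hC]
  ring

/-- The difference `w n - n` is determined by the pairings of `n`. -/
theorem wordAct_sub_eq {T : Set I} {l : List I} (hl : ∀ i ∈ l, i ∈ T) {m n : I → ℤ}
    (h : ∀ i ∈ T, pairing C i m = pairing C i n) : wordAct C l m - m = wordAct C l n - n := by
  induction l generalizing m n with
  | nil => rw [wordAct_nil, wordAct_nil, sub_self, sub_self]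
  | cons i l ih =>
    have hi := h i (hl i List.mem_cons_self)
    have h1 := ih (fun j hj => hl j (List.mem_cons_of_mem _ hj)) (m := refl C i m)
      (n := refl C i n) fun j hj => by
        rw [refl_apply, refl_apply, map_sub, map_sub, h j hj, hi]
    have h2 : refl C i m - m = refl C i n - n := by
      rw [refl_apply, refl_apply, hi]; abel
    rw [wordAct_cons, wordAct_cons, ← sub_add_sub_cancel _ (refl C i m) m, h1, h2,
      sub_add_sub_cancel]

end Vectors

/-! ## The framed situation -/

section Framed

variable {ι : Type w} [Fintype ι] [DecidableEq ι] {C : Matrix ι ι ℤ} {D : ι → ℕ}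

theorem framedMatrix_inl_inr (i j : ι) :
    framedMatrix C (Sum.inl i) (Sum.inr j) = if i = j then -1 else 0 := by
  change -(1 : Matrix ι ι ℤ) i j = _
  rw [Matrix.one_apply]
  split_ifs <;> rfl

theorem framedMatrix_inr_inl (i j : ι) :
    framedMatrix C (Sum.inr i) (Sum.inl j) = if i = j then -1 else 0 :=
  framedMatrix_inl_inr (C := C) i j

theorem framedMatrix_inr_inr (i j : ι) :
    framedMatrix C (Sum.inr i) (Sum.inr j) = if i = j then 2 else 0 := by
  change 2 • (1 : Matrix ι ι ℤ) i j = _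
  rw [Matrix.one_apply]
  split_ifs <;> rfl

theorem isGCM_framedMatrix (hC : IsGCM C) : IsGCM (framedMatrix C) where
  diag i := by
    rcases i with i | i
    · exact hC.diag i
    · rw [framedMatrix_inr_inr, if_pos rfl]
  nonpos i j h := by
    rcases i with i | i <;> rcases j with j | j
    · exact hC.nonpos i j fun h' => h (h' ▸ rfl)
    · rw [framedMatrix_inl_inr]; split_ifs <;> decide
    · rw [framedMatrix_inr_inl]; split_ifs <;> decide
    · rw [framedMatrix_inr_inr, if_neg fun h' : i = j => h (h' ▸ rfl)]
  zero_iff i j := by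
    rcases i with i | i <;> rcases j with j | j
    · exact hC.zero_iff i j
    all_goals
      simp only [framedMatrix_inl_inr, framedMatrix_inr_inl, framedMatrix_inr_inr,
        eq_comm (a := j)]

theorem isSymmetrizer_framedSymmetrizer (hD : IsSymmetrizer C D) :
    IsSymmetrizer (framedMatrix C) (framedSymmetrizer D) where
  pos i := by rcases i with i | i <;> exact hD.pos i
  symm i j := by
    rcases i with i | i <;> rcases j with j | j
    · exact hD.symm i j
    all_goals
      simp only [framedMatrix_inl_inr, framedMatrix_inr_inl, framedMatrix_inr_inr,
        framedSymmetrizer, Sum.elim_inl, Sum.elim_inr, eq_comm (a := j)]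
      split_ifs with hij
      · rw [hij]
      · rw [mul_zero, mul_zero]

theorem pairing_framedMatrix (i : ι) (n : ι ⊕ ι → ℤ) :
    pairing (framedMatrix C) (Sum.inl i) n = ∑ j, C j i * n (Sum.inl j) - n (Sum.inr i) := by
  rw [pairing_apply, Fintype.sum_sum_type, sub_eq_add_neg]
  congr 1
  simp [framedMatrix, Matrix.one_apply]

variable (D) in
/-- The dimension vector of a locally free module of a given rank vector. -/
def framedDim (x : WeightLattice ι) : ι ⊕ ι → ℤ :=
  Sum.elim (fun i => D i * x.1 i) (fun i => -(D i * x.2 i))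

theorem framedDim_zero (lam : ι → ℤ) :
    ∀ j ∈ Set.range Sum.inl, framedDim D (0, lam) j = 0 := by
  rintro _ ⟨j, rfl⟩
  exact mul_zero _

theorem coroot_apply (i : ι) (x : WeightLattice ι) :
    coroot C i x = ∑ j, C i j * x.1 j + x.2 i := by
  simp [coroot, Matrix.mulVec, dotProduct]

/-- The pairing on dimension vectors uses column i of C and the coroot uses row i on ranks. The
symmetrizer c_j c_ji = c_i c_ij reconciles them, and the framing edge contributes the fundamental
weight coordinate. -/
theorem pairing_framedDim (hD : IsSymmetrizer C D) (i : ι) (x : WeightLattice ι) :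
    pairing (framedMatrix C) (Sum.inl i) (framedDim D x) = D i * coroot C i x := by
  rw [pairing_framedMatrix, coroot_apply, mul_add, Finset.mul_sum]
  simp only [framedDim, Sum.elim_inl, Sum.elim_inr, sub_neg_eq_add]
  congr 1
  refine Finset.sum_congr rfl fun j _ => ?_
  rw [← mul_assoc, ← mul_assoc, hD.symm, mul_comm (C j i)]

theorem framedDim_simpleReflection (hC : IsGCM C) (hD : IsSymmetrizer C D) (i : ι)
    (x : WeightLattice ι) : framedDim D (simpleReflection hC i x) =
      refl (framedMatrix C) (Sum.inl i) (framedDim D x) := by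
  have h : simpleReflection hC i x = x - coroot C i x • simpleRoot i :=
    Module.reflection_apply _ _
  rw [refl_apply, pairing_framedDim hD, h]
  funext j
  rcases j with j | j
  · by_cases hj : j = i
    · subst hj
      simp [framedDim, simpleRoot, mul_sub]
    · simp [framedDim, simpleRoot, hj]
  · simp [framedDim, simpleRoot]

/-- A product becomes a concatenation in reversed order because the first letter of a word acts
first; an inverse becomes the reversed word. -/
theorem exists_word (hC : IsGCM C) (hD : IsSymmetrizer C D)
    {w : WeightLattice ι ≃ₗ[ℤ] WeightLattice ι} (hw : w ∈ weylGroup hC) :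
    ∃ l : List (ι ⊕ ι), (∀ i ∈ l, i ∈ Set.range Sum.inl) ∧
      ∀ x, framedDim D (w x) = wordAct (framedMatrix C) l (framedDim D x) := by
  induction hw using Subgroup.closure_induction with
  | mem w h =>
    obtain ⟨i, rfl⟩ := h
    exact ⟨[Sum.inl i], by simp, fun x => framedDim_simpleReflection hC hD i x⟩
  | one => exact ⟨[], by simp, fun x => rfl⟩
  | mul w w' _ _ h h' =>
    obtain ⟨l, hl, h⟩ := h
    obtain ⟨l', hl', h'⟩ := h'
    refine ⟨l' ++ l, fun i hi => (List.mem_append.1 hi).elim (hl' i) (hl i), fun x => ?_⟩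
    rw [wordAct_append, ← h', ← h]
    rfl
  | inv w _ h =>
    obtain ⟨l, hl, h⟩ := h
    refine ⟨l.reverse, fun i hi => hl i (List.mem_reverse.1 hi), fun x => ?_⟩
    have h1 := h (w⁻¹ x)
    rw [show w (w⁻¹ x) = x from w.apply_symm_apply x] at h1
    rw [h1, wordAct_reverse (isGCM_framedMatrix hC)]

variable {K : Type u} [Field K] {Ω : ι ⊕ ι → ι ⊕ ι → Prop}

local notation "𝒫" => FramedPreproj K C D Ω

section

variable {M : Type*} [AddCommGroup M] [Module (FramedPreproj K C D Ω) M] [Module K M]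
  [IsScalarTower K (FramedPreproj K C D Ω) M]

theorem IsGood.e_smul_eq_zero {I : Type w} [Fintype I] [DecidableEq I]
    {C : Matrix I I ℤ} {D : I → ℕ} {Ω : I → I → Prop} {M : Type*} [AddCommGroup M]
    [Module (Preproj K C D Ω) M] [Module K M] [IsScalarTower K (Preproj K C D Ω) M]
    [FiniteDimensional K M] {T : Set I} {n : I → ℤ} (h : IsGood K C D Ω T n M) {i : I}
    (hi : n i = 0) (m : M) : (gen (.e i) : Preproj K C D Ω) • m = 0 := by
  have h0 : Module.finrank K (vsp K C D Ω M i) = 0 :=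
    Int.ofNat_inj.1 ((congrFun h.dim i).trans hi)
  have := Module.finrank_zero_iff.1 h0
  exact congrArg Subtype.val (Subsingleton.elim (projV K C D Ω M i m) 0)

theorem IsGood.exists_rank {I : Type w} [Fintype I] [DecidableEq I]
    {C : Matrix I I ℤ} {D : I → ℕ} {Ω : I → I → Prop} {M : Type*} [AddCommGroup M]
    [Module (Preproj K C D Ω) M] [Module K M] [IsScalarTower K (Preproj K C D Ω) M]
    [FiniteDimensional K M] (hD : ∀ i, 1 ≤ D i) {T : Set I} {n : I → ℤ}
    (h : IsGood K C D Ω T n M) (i : I) :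
    ∃ a : ℕ, n i = D i * a ∧ HasRankAt (K := K) (C := C) (D := D) (Ω := Ω) M i a := by
  have h1 := isFreeNil_finrank (epsEnd_pow_eq_zero i) (h.free i)
  refine ⟨_, ?_, (hasRankAt_iff (hD i) _).2 ⟨h.free i, inferInstance, h1⟩⟩
  rw [← congrFun h.dim i, dimVec, h1, Nat.cast_mul]

/-- Without the vertices of `C` there are no arrows. -/
theorem IsGood.zeroArrows [FiniteDimensional K M] (hΩ : IsOrientation (framedMatrix C) Ω)
    {T : Set (ι ⊕ ι)} {n : ι ⊕ ι → ℤ}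
    (h : IsGood K (framedMatrix C) (framedSymmetrizer D) Ω T n M)
    (hn : ∀ i, n (Sum.inl i) = 0) : ZeroArrows K (framedMatrix C) (framedSymmetrizer D) Ω M := by
  intro i j hij g m
  rcases i with i | i
  · rw [← e_smul_arr, h.e_smul_eq_zero (hn i)]
  · rcases j with j | j
    · rw [← arr_smul_e, h.e_smul_eq_zero (hn j), smul_zero]
    · have h1 := hΩ.neg hij
      have h2 : i ≠ j := fun h2 => hΩ.ne hij (h2 ▸ rfl)
      rw [framedMatrix_inr_inr, if_neg h2] at h1
      exact absurd h1 (lt_irrefl 0)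

variable (C Ω K) in
-- The module lives at the framing vertices only, so the socle condition is vacuous. Anti-dominance
-- makes the ranks -λ_i nonnegative.
theorem exists_isGood_base (hD : IsSymmetrizer C D) {lam : ι → ℤ} (hlam : ∀ i, lam i ≤ 0) :
    ∃ X : FDMod K (framedMatrix C) (framedSymmetrizer D) Ω,
      IsGood K (framedMatrix C) (framedSymmetrizer D) Ω (Set.range Sum.inl)
        (framedDim D (0, lam)) X := by
  have hD' := (isSymmetrizer_framedSymmetrizer hD).pos
  obtain ⟨X, -, hX⟩ := exists_zeroArrows K (framedMatrix C) Ω hD'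
    (Sum.elim 0 fun i => (-lam i).toNat)
  have h1 := fun i => (hasRankAt_iff (hD' i) _).1 (hX i)
  refine ⟨X, ?_, fun i => (h1 i).1, ?_⟩
  · rintro _ ⟨i, rfl⟩ x hx - -
    have h2 := (h1 (Sum.inl i)).2.2
    rw [Sum.elim_inl, Pi.zero_apply, mul_zero] at h2
    have := Module.finrank_zero_iff.1 h2
    exact congrArg Subtype.val
      (Subsingleton.elim (⟨x, hx⟩ : vsp K (framedMatrix C) (framedSymmetrizer D) Ω X _) 0)
  · funext i
    rw [dimVec, (h1 i).2.2]
    rcases i with i | i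
    · simp [framedDim]
    · rw [Sum.elim_inr, Nat.cast_mul, Int.toNat_of_nonneg (neg_nonneg.2 (hlam i)), mul_neg]
      rfl

end

/-- Existence of filtered modules whose dimension vector is conjugate to one supported on the
framing vertices. -/
theorem exists_isGood_filtered (hC : IsGCM C) (hD : IsSymmetrizer C D)
    (hΩ : IsOrientation (framedMatrix C) Ω) {lam : ι → ℤ} (hlam : ∀ i, lam i ≤ 0)
    {l : List (ι ⊕ ι)} (hl : ∀ i ∈ l, i ∈ Set.range Sum.inl) {n : ι ⊕ ι → ℤ}
    (hn : wordAct (framedMatrix C) l n = framedDim D (0, lam)) :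
    ∃ X : FDMod K (framedMatrix C) (framedSymmetrizer D) Ω,
      IsGood K (framedMatrix C) (framedSymmetrizer D) Ω (Set.range Sum.inl) n X ∧
      Relation.ReflTransGen (GenStep K (framedMatrix C) (framedSymmetrizer D) Ω X) ⊥ ⊤ := by
  have hC' := isGCM_framedMatrix hC
  have hD' := isSymmetrizer_framedSymmetrizer hD
  have hex : ∀ {q : ι → ℤ}, (∀ i, q i ≤ 0) → ∀ {l : List (ι ⊕ ι)}, (∀ i ∈ l, i ∈ Set.range Sum.inl) →
      ∀ {n : ι ⊕ ι → ℤ}, wordAct (framedMatrix C) l n = framedDim D (0, q) →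
      ∃ X : FDMod K (framedMatrix C) (framedSymmetrizer D) Ω,
        IsGood K (framedMatrix C) (framedSymmetrizer D) Ω (Set.range Sum.inl) n X :=
    fun hq l hl n hn => exists_isGood hΩ hD' hC' (framedDim_zero _)
      (exists_isGood_base C K Ω hD hq) hl hn
  -- Nonnegativity is needed for other anti-dominant weights than λ, since it will be applied to a
  -- weight read off from n itself.
  have hnn : ∀ {q : ι → ℤ}, (∀ i, q i ≤ 0) → ∀ {l : List (ι ⊕ ι)}, (∀ i ∈ l, i ∈ Set.range Sum.inl) →
      ∀ {n : ι ⊕ ι → ℤ}, wordAct (framedMatrix C) l n = framedDim D (0, q) →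
      ∀ i, 0 ≤ n i := by
    intro q hq l hl n hn i
    obtain ⟨X, hX⟩ := hex hq hl hn
    rw [← hX.dim]
    exact Int.natCast_nonneg _
  obtain ⟨N, hN⟩ : ∃ N : ℕ, ∑ i, n (Sum.inl i) = N :=
    ⟨_, (Int.toNat_of_nonneg (Finset.sum_nonneg fun i _ => hnn hlam hl hn _)).symm⟩
  induction N using Nat.strong_induction_on generalizing l n with
  | _ N ih =>
    obtain ⟨X, hX⟩ := hex hlam hl hn
    -- A positive pairing allows a reflection that lowers the total unframed dimension. The smaller
    -- vector then has negative pairing with i, so in is surjective there and reflecting up returns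
    -- to n with a filtration.
    by_cases h : ∃ i, 0 < pairing (framedMatrix C) (Sum.inl i) n
    · obtain ⟨i, hi⟩ := h
      have hi' : Sum.inl i ∈ Set.range (Sum.inl : ι → ι ⊕ ι) := ⟨i, rfl⟩
      have hl' : ∀ j ∈ Sum.inl i :: l, j ∈ Set.range Sum.inl := fun j hj =>
        (List.mem_cons.1 hj).elim (fun h => h ▸ hi') (hl j)
      have hn' : wordAct (framedMatrix C) (Sum.inl i :: l)
          (refl (framedMatrix C) (Sum.inl i) n) = framedDim D (0, lam) := by
        rw [wordAct_cons, refl_refl hC', hn]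
      have hsum : ∑ j, refl (framedMatrix C) (Sum.inl i) n (Sum.inl j) =
          N - pairing (framedMatrix C) (Sum.inl i) n := by
        rw [← hN, refl_apply]
        simp only [Pi.sub_apply, Finset.sum_sub_distrib]
        congr 1
        rw [Finset.sum_eq_single i, Pi.single_eq_same]
        · exact fun j _ hj => Pi.single_eq_of_ne (fun h => hj (Sum.inl_injective h)) _
        · exact fun hi => absurd (Finset.mem_univ i) hi
      have hsum' : 0 ≤ ∑ j, refl (framedMatrix C) (Sum.inl i) n (Sum.inl j) :=
        Finset.sum_nonneg fun i _ => hnn hlam hl' hn' _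
      obtain ⟨Y, hY, hY'⟩ := ih (∑ j, refl (framedMatrix C) (Sum.inl i) n (Sum.inl j)).toNat
        (by omega) hl' hn' (Int.toNat_of_nonneg hsum').symm
      have hs := (inSurj_or_exactX hΩ hD' hC' hY.noSoc hl' (fun j hj => by
        rw [hY.dim, hn', framedDim_zero _ j hj]) hi').1 (by
          rw [hY.dim, pairing_refl_self hC']; omega)
      obtain ⟨Z, ⟨e⟩⟩ := exists_fdMod_equiv (K := K) (C := framedMatrix C)
        (D := framedSymmetrizer D) (Ω := Ω) (upData (K := K) (M := Y) hΩ hD' (Sum.inl i)).Space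
      have hZ := (isGood_up hΩ hD' hC' hY hi' hs).of_equiv e
      rw [refl_refl hC'] at hZ
      exact ⟨Z, hZ, reflTransGen_of_equiv hD'.pos e (reflTransGen_up hΩ hD' hC' hY hi' hs hY')⟩
    · push Not at h
      -- No pairing is positive. Local freeness makes the pairings divisible by c_i, so they are
      -- those of a vector n' concentrated on the framing, for the anti-dominant weight -q.
      have hq : ∀ i, ∃ q : ℕ, - pairing (framedMatrix C) (Sum.inl i) n = D i * q := by
        intro i
        choose a ha _ using hX.exists_rank hD'.pos
        have h1 : - pairing (framedMatrix C) (Sum.inl i) n =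
            D i * ((a (Sum.inr i) : ℤ) - ∑ j, C i j * a (Sum.inl j)) := by
          rw [pairing_framedMatrix, neg_sub, ha, mul_sub, Finset.mul_sum]
          congr 1
          refine Finset.sum_congr rfl fun j _ => ?_
          rw [ha, ← mul_assoc, ← mul_assoc, hD.symm, mul_comm (C j i)]
          rfl
        have h2 : 0 ≤ (a (Sum.inr i) : ℤ) - ∑ j, C i j * a (Sum.inl j) := by
          have h3 := h i
          have h4 : (0 : ℤ) < D i := by exact_mod_cast hD.pos i
          refine nonneg_of_mul_nonneg_right ?_ h4
          rw [← h1]; omega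
        exact ⟨_, by rw [h1, Int.toNat_of_nonneg h2]⟩
      choose q hq using hq
      let n' : ι ⊕ ι → ℤ := framedDim D (0, fun i => -(q i : ℤ))
      have hpair : ∀ i ∈ Set.range Sum.inl,
          pairing (framedMatrix C) i n = pairing (framedMatrix C) i n' := by
        rintro _ ⟨i, rfl⟩
        rw [pairing_framedMatrix i n']
        simp only [n', framedDim, Sum.elim_inl, Sum.elim_inr, Pi.zero_apply, mul_zero, mul_neg,
          Finset.sum_const_zero, ← hq]
        ring
      -- Equal pairings give w n - n = w n' - n'. At an unframed vertex the left side is -n_i, since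
      -- w n vanishes there, and the right side is (w n')_i ≥ 0. With n_i ≥ 0 this gives n_i = 0, so
      -- no arrow acts on X.
      have hsub := wordAct_sub_eq hl hpair
      have hn0 : ∀ i, n (Sum.inl i) = 0 := by
        intro i
        have h1 := congrFun hsub (Sum.inl i)
        have h2 := hnn (q := fun i => -(q i : ℤ)) (fun i => by simp) (l := l.reverse) (fun i hi => hl i (List.mem_reverse.1 hi))
          (n := wordAct (framedMatrix C) l n') (wordAct_reverse hC' l n') (Sum.inl i)
        have h3 := hnn hlam hl hn (Sum.inl i)
        rw [hn, Pi.sub_apply, Pi.sub_apply] at h1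
        simp only [n', framedDim, Sum.elim_inl, Pi.zero_apply, mul_zero] at h1 h2
        omega
      exact ⟨X, hX, (hX.zeroArrows hΩ hn0).reflTransGen hD'.pos hX.free⟩

section

variable {M : Type*} [AddCommGroup M] [Module (FramedPreproj K C D Ω) M] [Module K M]
  [IsScalarTower K (FramedPreproj K C D Ω) M]

theorem finiteDimensional_of_hasRankVec (hD : IsSymmetrizer C D) {ν lam : ι → ℤ}
    (h : HasRankVec K C D Ω M ν lam) : FiniteDimensional K M := by
  have hD' := (isSymmetrizer_framedSymmetrizer hD).pos
  refine finiteDimensional_of_vsp (C := framedMatrix C) (D := framedSymmetrizer D) (Ω := Ω)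
    fun i => ?_
  rcases i with i | i
  · obtain ⟨a, -, ha⟩ := (h i).1
    exact ((hasRankAt_iff (hD' _) _).1 ha).2.1
  · obtain ⟨a, -, ha⟩ := (h i).2
    exact ((hasRankAt_iff (hD' _) _).1 ha).2.1

theorem isGood_of_isStable (hD : IsSymmetrizer C D) (hΩ : IsOrientation (framedMatrix C) Ω)
    {ν lam : ι → ℤ} (h : IsStable K C D Ω M) (h' : HasRankVec K C D Ω M ν lam) :
    IsGood K (framedMatrix C) (framedSymmetrizer D) Ω (Set.range Sum.inl)
      (framedDim D (ν, lam)) M := by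
  have hD' := (isSymmetrizer_framedSymmetrizer hD).pos
  refine ⟨?_, fun i => ?_, funext fun i => ?_⟩
  · rintro _ ⟨i, rfl⟩
    exact noSoc_of_subAt hΩ (h.2 i)
  · obtain ⟨a, ha⟩ := h.1.1 i
    exact ((hasRankAt_iff (hD' _) _).1 ha).1
  · rcases i with i | i
    · obtain ⟨a, ha', ha⟩ := (h' i).1
      rw [dimVec, ((hasRankAt_iff (hD' _) _).1 ha).2.2, Nat.cast_mul, ha']
      rfl
    · obtain ⟨a, ha', ha⟩ := (h' i).2
      rw [dimVec, ((hasRankAt_iff (hD' _) _).1 ha).2.2, Nat.cast_mul, ha', mul_neg]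
      rfl

theorem IsGood.hasRankVec [FiniteDimensional K M] (hD : IsSymmetrizer C D) {ν lam : ι → ℤ}
    (h : IsGood K (framedMatrix C) (framedSymmetrizer D) Ω (Set.range Sum.inl)
      (framedDim D (ν, lam)) M) : HasRankVec K C D Ω M ν lam := by
  intro i
  have hi : (D i : ℤ) ≠ 0 := by exact_mod_cast Nat.one_le_iff_ne_zero.1 (hD.pos i)
  constructor
  · obtain ⟨a, ha, ha'⟩ := h.exists_rank (isSymmetrizer_framedSymmetrizer hD).pos (Sum.inl i)
    exact ⟨a, (mul_left_cancel₀ hi ha).symm, ha'⟩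
  · obtain ⟨a, ha, ha'⟩ := h.exists_rank (isSymmetrizer_framedSymmetrizer hD).pos (Sum.inr i)
    refine ⟨a, (mul_left_cancel₀ hi ?_).symm, ha'⟩
    rw [mul_neg]
    exact ha

theorem IsGood.isStable [FiniteDimensional K M] (hD : IsSymmetrizer C D) {n : ι ⊕ ι → ℤ}
    (h : IsGood K (framedMatrix C) (framedSymmetrizer D) Ω (Set.range Sum.inl) n M)
    (h' : Relation.ReflTransGen (GenStep K (framedMatrix C) (framedSymmetrizer D) Ω M) ⊥ ⊤) :
    IsStable K C D Ω M :=
  ⟨isEFiltered_iff.2 ⟨fun i =>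
    let ⟨a, _, ha⟩ := h.exists_rank (isSymmetrizer_framedSymmetrizer hD).pos i
    ⟨a, ha⟩, h'⟩, fun i => subAt_eq_bot (h.noSoc _ ⟨i, rfl⟩)⟩

/-- Extremality gives dim e_iM - dim im(in) = max(0, pairing), and the pairing of dimension vectors
is c_i times that of weights. -/
theorem IsGood.hasSmallFactor [FiniteDimensional K M] (hC : IsGCM C) (hD : IsSymmetrizer C D)
    (hΩ : IsOrientation (framedMatrix C) Ω) {ν lam : ι → ℤ}
    (h : IsGood K (framedMatrix C) (framedSymmetrizer D) Ω (Set.range Sum.inl)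
      (framedDim D (ν, lam)) M) {l : List (ι ⊕ ι)} (hl : ∀ i ∈ l, i ∈ Set.range Sum.inl)
    (hn : ∀ j ∈ Set.range Sum.inl, wordAct (framedMatrix C) l (framedDim D (ν, lam)) j = 0)
    (i : ι) : HasSmallFactor K C D Ω M i := by
  have hD' := isSymmetrizer_framedSymmetrizer hD
  have hi : Sum.inl i ∈ Set.range (Sum.inl : ι → ι ⊕ ι) := ⟨i, rfl⟩
  obtain ⟨h1, h2, h3⟩ := inSurj_or_exactX hΩ hD' (isGCM_framedMatrix hC) h.noSoc hl
    (fun j hj => by rw [h.dim]; exact hn j hj) hi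
  refine ⟨ν, lam, h.hasRankVec hD, hasRankAt_facAt hΩ hD' h.free (h.noSoc _ hi)
    ((le_total (pairing (framedMatrix C) (Sum.inl i) _) 0).imp h1 h2) ?_⟩
  rw [h.dim, pairing_framedDim hD] at h3
  have h4 : max 0 ((D i : ℤ) * coroot C i (ν, lam)) =
      D i * (max 0 (coroot C i (ν, lam))).toNat := by
    rw [Int.toNat_of_nonneg (le_max_left _ _), mul_max_of_nonneg _ _ (Int.natCast_nonneg _),
      mul_zero]
  rw [h4] at h3
  exact_mod_cast h3

end

end Framed

end FramedPreprojective
end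

/-! ### The theorem on stable modules of extremal rank vector -/

theorem mainTheorem2 {K : Type u} [Field K] {ι : Type w} [Fintype ι] [DecidableEq ι]
    (C : Matrix ι ι ℤ) (hC : FramedPreprojective.IsGCM C)
    (D : ι → ℕ) (hD : FramedPreprojective.IsSymmetrizer C D)
    (Ω : ι ⊕ ι → ι ⊕ ι → Prop)
    (hΩ : FramedPreprojective.IsOrientation (FramedPreprojective.framedMatrix C) Ω)
    (lam : ι → ℤ) (hlam : ∀ i, lam i ≤ 0)
    (w : FramedPreprojective.WeightLattice ι ≃ₗ[ℤ] FramedPreprojective.WeightLattice ι)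
    (hw : w ∈ FramedPreprojective.weylGroup hC)
    (ν : ι → ℤ)
    (hν : ν = (w (FramedPreprojective.weight lam) - FramedPreprojective.weight lam).1) :
    (∀ (M : Type v) [AddCommGroup M] [Module (FramedPreprojective.FramedPreproj K C D Ω) M],
      FramedPreprojective.IsStable K C D Ω M →
      FramedPreprojective.HasRankVec K C D Ω M ν lam →
      ∀ i : ι, FramedPreprojective.HasSmallFactor K C D Ω M i) ∧
    (∃ N : ModuleCat.{u} (FramedPreprojective.FramedPreproj K C D Ω),
      FramedPreprojective.IsStable K C D Ω N ∧
      FramedPreprojective.HasRankVec K C D Ω N ν lam ∧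
      ∀ (M : Type v) [AddCommGroup M] [Module (FramedPreprojective.FramedPreproj K C D Ω) M],
        FramedPreprojective.IsStable K C D Ω M →
        FramedPreprojective.HasRankVec K C D Ω M ν lam →
        Nonempty (M ≃ₗ[FramedPreprojective.FramedPreproj K C D Ω] N)) := by
  open FramedPreprojective in
  have hC' := isGCM_framedMatrix hC
  have hD' := isSymmetrizer_framedSymmetrizer hD
  obtain ⟨l, hl, hl'⟩ := exists_word hC hD hw
  have hl0 : ∀ i ∈ l.reverse, i ∈ Set.range Sum.inl := fun i hi => hl i (List.mem_reverse.1 hi)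
  -- The reflections do not touch the P-coordinate: a word in unframed letters fixes the framing
  -- entries of a dimension vector, and c_i ≠ 0 can be cancelled.
  have hw' : w (weight lam) = (ν, lam) := by
    refine Prod.ext ?_ (funext fun i => ?_)
    · rw [hν, Prod.fst_sub]
      exact (sub_zero _).symm
    · have h1 := congrFun (hl' (weight lam)) (Sum.inr i)
      rw [wordAct_of_notMem fun h => by simpa using hl _ h] at h1
      exact mul_left_cancel₀ (Int.natCast_ne_zero.2 (Nat.one_le_iff_ne_zero.1 (hD.pos i)))
        (neg_injective h1)
  have hn : wordAct (framedMatrix C) l.reverse (framedDim D (ν, lam)) = framedDim D (0, lam) := by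
    rw [← hw', hl', wordAct_reverse hC']
    rfl
  have hn0 : ∀ j ∈ Set.range Sum.inl,
      wordAct (framedMatrix C) l.reverse (framedDim D (ν, lam)) j = 0 := fun j hj => by
    rw [hn, framedDim_zero lam j hj]
  refine ⟨fun M _ _ hM hM' i => ?_, ?_⟩
  -- An abstract module carries only the action of the algebra; the K-structure used by the linear
  -- algebra is restriction of scalars.
  · let inst : Module K M := Module.compHom M (algebraMap K (FramedPreproj K C D Ω))
    have tower : IsScalarTower K (FramedPreproj K C D Ω) M :=
      IsScalarTower.of_algebraMap_smul fun _ _ => rfl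
    have := finiteDimensional_of_hasRankVec hD hM'
    exact (isGood_of_isStable hD hΩ hM hM').hasSmallFactor hC hD hΩ hl0 hn0 i
  · obtain ⟨N, hN, hN'⟩ := exists_isGood_filtered (K := K) hC hD hΩ hlam hl0 hn
    refine ⟨ModuleCat.of _ N, hN.isStable hD hN', hN.hasRankVec hD, fun M _ _ hM hM' => ?_⟩
    let inst : Module K M := Module.compHom M (algebraMap K (FramedPreproj K C D Ω))
    have tower : IsScalarTower K (FramedPreproj K C D Ω) M :=
      IsScalarTower.of_algebraMap_smul fun _ _ => rfl
    have := finiteDimensional_of_hasRankVec hD hM'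
    obtain ⟨X, ⟨e⟩⟩ := exists_fdMod_equiv (K := K) (C := framedMatrix C)
      (D := framedSymmetrizer D) (Ω := Ω) M
    -- At the bottom of the word both modules are supported on the framing vertices, so all arrows
    -- vanish and equal dimensions suffice.
    obtain ⟨f⟩ := nonempty_equiv_of_isGood hΩ hD' hC' (framedDim_zero lam)
      (fun X Y hX hY => (hX.zeroArrows hΩ fun i => framedDim_zero lam _ ⟨i, rfl⟩).nonempty_equiv
        hD'.pos (hY.zeroArrows hΩ fun i => framedDim_zero lam _ ⟨i, rfl⟩) hX.free hY.free
        (hX.dim.trans hY.dim.symm)) hl0 hn X N ((isGood_of_isStable hD hΩ hM hM').of_equiv e) hN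
    exact ⟨e.trans f⟩
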